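/- **Theorem (session unlinkability of Ariadne against link observers).** Let $\kappa$ be the security parameter. All parameters and primitives below are computable in time polynomial in $\kappa$. *Primitives.* A key derivation function $\delta:\{0,1\}^\kappa\times\mathbb N\to\{0,1\}^\kappa\times\{0,1\}^\kappa$, $\delta(k,t)=(k^{Enc}_t,k^{Mac}_t)$, such that for every polynomial $q$ the pairs $\delta(k,0),\dots,\delta(k,q(\kappa)-1)$ for a uniform key $k$ are computationally indistinguishable from independent uniform keys; a secure pseudo-random generator $\rho:\{0,1\}^\kappa\to\{0,1\}^{U+L_{full}}$; a message authentication code $\mu$ with keys and tags of $\kappa$ bits; and a pseudo-random permutation of the $l$ slots $\{0,\dots,l-1\}$ (on a uniform seed it is indistinguishable from a uniform permutation). *Packets.* A routing element is a string $\pi\,|\,Addr\,|\,p\,|\,\gamma$ of length $U$: a fixed public pattern, the address of the next node, a pointer to the slot of its element, and a tag $\gamma$ of $\kappa$ bits. A packet is a common header, in clear, with the address of the next node and the pointer to its slot, followed by a body of $L_{full}=l\,U+L_{pay}$ bits: a routing vector of $l$ slots of $U$ bits, and the payload, padded to $L_{pay}$ bits. For a key $k^{Enc}$ let $\rho_{r}$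 be the first $U$ bits of $\rho(k^{Enc})$, $\rho_{Packet}$ the remaining $L_{full}$ bits, and $\rho_{Header}$ the first $l\,U$ bits of $\rho_{Packet}$. There are polynomially many nodes. Each source $s$ shares with each node $v$ a uniform master key $k_{s,v}$, independent for all ordered pairs. *Creation.* For the packet with index $t$ on the path $(N_0,N_1,\dots,N_{n+1})$ (distinct nodes, $n+1\le l$), the source $N_0$ derives $(k_i^{Enc},k_i^{Mac})=\delta(k_{N_0,N_i},t)$, draws a fresh seed, which gives distinct slots $p_1,\dots,p_{n+1}$, and a uniform vector $R$. For $i=1,\dots,n+1$ it overwrites slot $p_i$ of $R$ by $\pi|Addr_{i+1}|p_{i+1}|0^\kappa$ and then replaces $R$ by $R\oplus\rho_{i,Header}$ (for $i=n+1$ the address and pointer are those of $N_{n+1}$ itself). It sets $X=R\,|\,\text{payload}$, and for $i=n+1,\dots,1$ it replaces $X$ by $X\oplus\rho_{i,Packet}$, computes $\gamma_i=\mu(k_i^{Mac};X)$, and overwrites slot $p_i$ of $X$ by $(\pi|Addr_{i+1}|p_{i+1}|\gamma_i)\oplus\rho_{i,r}$. The packet has common header $(Addr_1,p_1)$ and body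 $X$. *Processing.* A node has a table with one line for each source and each index $t$ in a window $0\le t<T(\kappa)$. For a packet with body $X$ whose header points to slot $p$, it looks for a line such that the beginning of slot $p$ equals $\pi$ blinded by the beginning of $\rho_r$ and such that, if $r=\pi'|a|p'|\gamma$ is slot $p$ unblinded by $\rho_r$, then $\gamma=\mu(k^{Mac};X)$ after slot $p$ of $X$ has been overwritten by $\pi'|a|p'|0^\kappa$. It uses the first such line, and drops the packet if there is none. It then replaces $X$ by $X\oplus\rho_{Packet}$, delivers the payload part if $a$ is its own address, and otherwise forwards $X$ with common header $(a,p')$. *Games.* The adversary is a probabilistic polynomial-time algorithm that corrupts no node and holds no key. It names an honest router $N_j$. It may submit polynomially many packets, adaptively, and gets the result of their processing by $N_j$. It then submits two payloads $p_1,p_2$ of at most $L_{pay}$ bits, an index $t$ with $t+1<T(\kappa)$, a path $\mathcal P=(N_0,\dots,N_j,\dots,N_{n+1})$ with $1\le j\le n$, and a path $\mathcal P'$ that ends with the same nodes $N_j,\dots,N_{n+1}$; in the *path-session game* $\mathcal P'$ has the same source as $\mathcal P$ and arbitrary nodes (also in a different number) between the source and $N_j$, and in the *source-session game* $\mathcal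 P'$ differs from $\mathcal P$ in the source only. The challenger draws a uniform bit $b$ and creates $Pkt_1$, carrying $p_1$ along $\mathcal P$ with index $t$, and, with index $t+1$, $Pkt_2$ carrying $p_2$ along $\mathcal P$ and $Pkt_2'$ carrying $p_2$ along $\mathcal P'$. Each packet is processed by the nodes of its path up to and including $N_j$, and the adversary is given $Pkt_1$ and, if $b=0$, $Pkt_2$, if $b=1$, $Pkt_2'$, in the form in which $N_j$ sends them to $N_{j+1}$. It may again submit polynomially many packets to be processed by $N_j$, and finally outputs a guess $b'$. *Claim.* Ariadne achieves session unlinkability: it achieves both path-session unlinkability and source-session unlinkability, that is, for every such adversary, in the path-session game and in the source-session game, $\bigl|\Pr[b'=b]-\tfrac12\bigr|$ is a negligible function of $\kappa$. -/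

import Mathlib

open Filter Polynomial

namespace Ariadne

/-! ## Computation: while-programs on binary trees, with a running time -/

/-- Binary trees, the data on which programs compute. -/
inductive Tree : Type
  | nil : Tree
  | cons : Tree → Tree → Tree
  deriving DecidableEq

namespace Tree

/-- Number of nodes. -/
def size : Tree → ℕ
  | nil => 1
  | cons x y => x.size + y.size + 1

def fst : Tree → Tree
  | nil => nil
  | cons x _ => x

def snd : Tree → Tree
  | nil => nil
  | cons _ y => y

/-- A bit as a tree. -/
def ofBool : Bool → Tree
  | false => nil
  | true => cons nil nil

/-- Every tree reads as a bit: `nil` is `false`, everything else is `true`. -/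
def toBool : Tree → Bool
  | nil => false
  | cons _ _ => true

/-- Lists are right combs. -/
def ofList : List Tree → Tree
  | [] => nil
  | x :: l => cons x (ofList l)

def toList : Tree → List Tree
  | nil => []
  | cons x y => x :: y.toList

/-- Numbers are written in unary. -/
def ofNat (n : ℕ) : Tree := ofList (List.replicate n nil)

def toNat (x : Tree) : ℕ := x.toList.length

def ofBits (l : List Bool) : Tree := ofList (l.map ofBool)

def toBits (x : Tree) : List Bool := x.toList.map toBool

def ofNats (l : List ℕ) : Tree := ofList (l.map ofNat)

def toNats (x : Tree) : List ℕ := x.toList.map toNat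

/-- The `i`-th entry of a tree read as a list (`nil` beyond its end). -/
def entry (x : Tree) (i : ℕ) : Tree := x.toList.getD i nil

end Tree

/-- While-programs with one tree-valued variable. A program transforms the value of the variable. -/
inductive Prog : Type
  | id : Prog
  | nil : Prog
  | head : Prog
  | tail : Prog
  | pair : Prog → Prog → Prog
  | seq : Prog → Prog → Prog
  | cond : Prog → Prog → Prog → Prog
  | loop : Prog → Prog → Prog

/-- `P.Runs x y c`: started on `x`, the program `P` halts with value `y` after `c` steps. Writing a
value costs its size; every instruction costs at least one step. `cond C P Q` runs `P` if `C` gives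
a value other than `nil` and `Q` otherwise; `loop C P` is `while C do P`. -/
inductive Prog.Runs : Prog → Tree → Tree → ℕ → Prop
  | id (x : Tree) : Runs .id x x (x.size + 1)
  | nil (x : Tree) : Runs .nil x .nil 1
  | head (x : Tree) : Runs .head x x.fst (x.fst.size + 1)
  | tail (x : Tree) : Runs .tail x x.snd (x.snd.size + 1)
  | pair {P Q : Prog} {x y z : Tree} {c d : ℕ} (hP : Runs P x y c) (hQ : Runs Q x z d) :
      Runs (.pair P Q) x (.cons y z) (c + d + (Tree.cons y z).size + 1)
  | seq {P Q : Prog} {x y z : Tree} {c d : ℕ} (hP : Runs P x y c) (hQ : Runs Q y z d) :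
      Runs (.seq P Q) x z (c + d + 1)
  | cond_true {C P Q : Prog} {x u y : Tree} {c d : ℕ} (hC : Runs C x u c) (hu : u ≠ .nil)
      (hP : Runs P x y d) : Runs (.cond C P Q) x y (c + d + 1)
  | cond_false {C P Q : Prog} {x y : Tree} {c d : ℕ} (hC : Runs C x .nil c)
      (hQ : Runs Q x y d) : Runs (.cond C P Q) x y (c + d + 1)
  | loop_stop {C P : Prog} {x : Tree} {c : ℕ} (hC : Runs C x .nil c) :
      Runs (.loop C P) x x (c + 1)
  | loop_step {C P : Prog} {x u y z : Tree} {c d e : ℕ} (hC : Runs C x u c) (hu : u ≠ .nil)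
      (hP : Runs P x y d) (hL : Runs (.loop C P) y z e) : Runs (.loop C P) x z (c + d + e + 1)

/-- `f` is computed by a program whose running time is polynomial in the size of the input. -/
def PolyTime (f : Tree → Tree) : Prop :=
  ∃ (P : Prog) (p : ℕ[X]), ∀ x, ∃ c ≤ p.eval x.size, P.Runs x (f x) c

/-- The unary form of `f κ` can be computed from the unary form of `κ` in polynomial time. -/
def PolyTimeNat (f : ℕ → ℕ) : Prop :=
  ∃ F, PolyTime F ∧ ∀ κ, F (Tree.ofNat κ) = Tree.ofNat (f κ)

/-! ## Randomness, negligible functions, indistinguishability -/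

/-- A uniformly random bit string of length `n`. -/
noncomputable def randomBits (n : ℕ) : PMF (List Bool) :=
  (PMF.uniformOfFintype (Fin n → Bool)).map List.ofFn

/-- `f` tends to zero faster than the inverse of any polynomial. -/
def Negligible (f : ℕ → ℝ) : Prop :=
  Asymptotics.SuperpolynomialDecay atTop (fun κ : ℕ => (κ : ℝ)) f

/-- A probabilistic polynomial-time algorithm with a one-bit output: a polynomial-time function
applied to the security parameter (in unary), polynomially many random coins, and the input. -/
structure Distinguisher where
  coins : ℕ[X]
  run : Tree → Tree
  polyTime : PolyTime run

/-- The probability that the distinguisher outputs `1` on a sample from `X`. -/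
noncomputable def Distinguisher.accept (D : Distinguisher) (X : ℕ → PMF Tree) (κ : ℕ) : ℝ :=
  (((X κ).bind fun x => (randomBits (D.coins.eval κ)).map fun r =>
    (D.run (.ofList [.ofNat κ, .ofBits r, x])).toBool) true).toReal

/-- Computational indistinguishability of two families of distributions. -/
def Indistinguishable (X Y : ℕ → PMF Tree) : Prop :=
  ∀ D : Distinguisher, Negligible fun κ => D.accept X κ - D.accept Y κ

/-! ## Bit strings -/

/-- Bitwise exclusive or. -/
def bxor (x y : List Bool) : List Bool := List.zipWith Bool.xor x y

/-- The `w` lowest bits of `n`, lowest bit first. -/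
def natBits : ℕ → ℕ → List Bool
  | 0, _ => []
  | w + 1, n => n.testBit 0 :: natBits w (n / 2)

/-- The number with the given binary digits, lowest bit first. -/
def bitsNat : List Bool → ℕ
  | [] => 0
  | b :: l => b.toNat + 2 * bitsNat l

/-! ## The protocol -/

/-- The public parameters and the primitives of the protocol, as functions of the security
parameter `κ`, which is also the length of the keys. Nodes are numbered from `0`. -/
structure Scheme where
  /-- number of nodes of the network -/
  nodes : ℕ → ℕ
  /-- number of slots of the routing vector -/
  slots : ℕ → ℕ
  /-- length of an address -/
  addrLen : ℕ → ℕ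
  /-- length of a pointer to a slot -/
  ptrLen : ℕ → ℕ
  /-- length of the (padded) payload -/
  payloadLen : ℕ → ℕ
  /-- number of packets for which a node tabulates the temporary keys of each master key -/
  window : ℕ → ℕ
  /-- the byte pattern that references the key -/
  pattern : ℕ → List Bool
  /-- key derivation: master key and packet index give an encryption key and a MAC key -/
  kdf : ℕ → List Bool → ℕ → List Bool × List Bool
  /-- the pseudo-random generator -/
  prg : ℕ → List Bool → List Bool
  /-- the message authentication code: key and message give a tag -/
  mac : ℕ → List Bool → List Bool → List Bool
  /-- length of the seed of the slot permutation -/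
  seedLen : ℕ → ℕ
  /-- the pseudo-random permutation of the slots -/
  perm : (κ : ℕ) → List Bool → Equiv.Perm (Fin (slots κ))

/-- A packet: the common header (address of the next node, pointer to its slot), in clear, and the
body (routing vector followed by payload). -/
structure Packet where
  addr : List Bool
  ptr : List Bool
  body : List Bool
  deriving DecidableEq

def Packet.toTree (k : Packet) : Tree := .ofList [.ofBits k.addr, .ofBits k.ptr, .ofBits k.body]

def Packet.ofTree (x : Tree) : Packet :=
  ⟨(x.entry 0).toBits, (x.entry 1).toBits, (x.entry 2).toBits⟩

/-- What a node does with a packet. -/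
inductive Outcome : Type
  | drop : Outcome
  | forward : Packet → Outcome
  | deliver : List Bool → Outcome
  deriving DecidableEq

def Outcome.toTree : Outcome → Tree
  | drop => .nil
  | forward k => .cons (.ofBool false) k.toTree
  | deliver p => .cons (.ofBool true) (.ofBits p)

/-- The routing data for one node of a path: the node, its slot, its successor and the slot of its
successor. -/
structure Hop where
  node : ℕ
  slot : ℕ
  next : ℕ
  nextSlot : ℕ

/-- The routing data along a list of (node, slot). The last node is its own successor. -/
def hops : List (ℕ × ℕ) → List Hop
  | [] => []
  | [a] => [⟨a.1, a.2, a.1, a.2⟩]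
  | a :: b :: l => ⟨a.1, a.2, b.1, b.2⟩ :: hops (b :: l)

namespace Scheme

variable (S : Scheme) (κ : ℕ)

/-- Length of a routing element: pattern, address, pointer, tag. -/
def elemLen : ℕ := (S.pattern κ).length + S.addrLen κ + S.ptrLen κ + κ

/-- Length of the routing vector. -/
def vecLen : ℕ := S.slots κ * S.elemLen κ

/-- Length of the body of a packet. -/
def fullLen : ℕ := S.vecLen κ + S.payloadLen κ

/-- The encryption key and the MAC key for packet `t`, derived from the master key `k`. -/
def encKey (k : List Bool) (t : ℕ) : List Bool := (S.kdf κ k t).1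

def macKey (k : List Bool) (t : ℕ) : List Bool := (S.kdf κ k t).2

/-- The part of the pseudo-random string that blinds a routing element. Its beginning blinds the
pattern. -/
def padElem (k : List Bool) (t : ℕ) : List Bool :=
  (S.prg κ (S.encKey κ k t)).take (S.elemLen κ)

/-- The part of the pseudo-random string that blinds the body. Its beginning blinds the routing
vector. -/
def padPacket (k : List Bool) (t : ℕ) : List Bool :=
  (S.prg κ (S.encKey κ k t)).drop (S.elemLen κ)

def padHeader (k : List Bool) (t : ℕ) : List Bool := (S.padPacket κ k t).take (S.vecLen κ)

/-- A routing element. -/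
def elem (next nextSlot : ℕ) (tag : List Bool) : List Bool :=
  S.pattern κ ++ natBits (S.addrLen κ) next ++ natBits (S.ptrLen κ) nextSlot ++ tag

/-- Overwrite slot `p` of a string that starts with a routing vector. -/
def putSlot (p : ℕ) (r X : List Bool) : List Bool :=
  X.take (p * S.elemLen κ) ++ r ++ X.drop (p * S.elemLen κ + S.elemLen κ)

/-- Read slot `p`. -/
def getSlot (p : ℕ) (X : List Bool) : List Bool :=
  (X.drop (p * S.elemLen κ)).take (S.elemLen κ)

/-- One step of the preparation of the filler string (from the first node to the last): insert the
element with a zero tag, then blind the vector. `K` gives the master key of each node. -/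
def fill (K : ℕ → List Bool) (t : ℕ) (R : List Bool) (h : Hop) : List Bool :=
  bxor (S.putSlot κ h.slot (S.elem κ h.next h.nextSlot (List.replicate κ false)) R)
    (S.padHeader κ (K h.node) t)

/-- One step of the construction of the body (from the last node to the first): blind the body,
compute its tag, insert the blinded routing element with that tag. -/
def wrap (K : ℕ → List Bool) (t : ℕ) (h : Hop) (X : List Bool) : List Bool :=
  S.putSlot κ h.slot
    (bxor
      (S.elem κ h.next h.nextSlot
        (S.mac κ (S.macKey κ (K h.node) t) (bxor X (S.padPacket κ (K h.node) t))))
      (S.padElem κ (K h.node) t))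
    (bxor X (S.padPacket κ (K h.node) t))

/-- The slots in the order in which they are given to the nodes of the path. -/
def slotList (seed : List Bool) : List ℕ := List.ofFn fun i => (S.perm κ seed i : ℕ)

/-- The payload, padded to the fixed length. -/
def padded (p : List Bool) : List Bool := p ++ List.replicate (S.payloadLen κ - p.length) false

/-- The packet with index `t` that carries `payload` through the nodes `path`, for the random
initial vector `R` and the random seed `seed`; `K` gives the master keys that the source shares with
the nodes. -/
def build (K : ℕ → List Bool) (t : ℕ) (path : List ℕ) (payload R seed : List Bool) : Packet :=
  let hs := hops (path.zip (S.slotList κ seed))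
  ⟨natBits (S.addrLen κ) (path.headD 0), natBits (S.ptrLen κ) ((S.slotList κ seed).headD 0),
    hs.foldr (S.wrap κ K t) (hs.foldl (S.fill κ K t) R ++ S.padded κ payload)⟩

/-- Creation of a packet by the source. -/
noncomputable def create (K : ℕ → List Bool) (t : ℕ) (path : List ℕ) (payload : List Bool) :
    PMF Packet :=
  (randomBits (S.vecLen κ)).bind fun R => (randomBits (S.seedLen κ)).map fun seed =>
    S.build κ K t path payload R seed

/-- Processing of packet `pkt` by node `v` under one line of its table, that of packet index `t` for
the master key `k`. The result is `none` if the encrypted pattern or the tag does not match. -/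
def openWith (v : ℕ) (k : List Bool) (t : ℕ) (pkt : Packet) : Option Outcome :=
  let p := bitsNat pkt.ptr
  let c := S.getSlot κ p pkt.body
  let l := (S.pattern κ).length
  if c.take l = bxor (S.pattern κ) (S.padElem κ k t) then
    let r := bxor c (S.padElem κ k t)
    let tag := r.drop (S.elemLen κ - κ)
    let X := S.putSlot κ p (r.take (S.elemLen κ - κ) ++ List.replicate κ false) pkt.body
    if S.mac κ (S.macKey κ k t) X = tag then
      let addr := (r.drop l).take (S.addrLen κ)
      let ptr := (r.drop (l + S.addrLen κ)).take (S.ptrLen κ)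
      let Y := bxor X (S.padPacket κ k t)
      if addr = natBits (S.addrLen κ) v then some (.deliver (Y.drop (S.vecLen κ)))
      else some (.forward ⟨addr, ptr, Y⟩)
    else none
  else none

/-- Processing of a packet by node `v`. `K s v` is the master key that source `s` shares with `v`.
The table of `v` has a line for each source and each packet index in the window; the first line that
matches the packet is used, and the packet is dropped if there is none or it has a wrong format. -/
def process (K : ℕ → ℕ → List Bool) (v : ℕ) (pkt : Packet) : Outcome :=
  if pkt.body.length = S.fullLen κ ∧ pkt.ptr.length = S.ptrLen κ ∧ bitsNat pkt.ptr < S.slots κ then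
    ((List.product (List.range (S.nodes κ)) (List.range (S.window κ))).findSome?
      fun st => S.openWith κ v (K st.1 v) st.2 pkt).getD .drop
  else .drop

/-- The packet that leaves the last of the given nodes when all of them, in this order, process the
packet; `none` if one of them does not forward it. -/
def relay (K : ℕ → ℕ → List Bool) : List ℕ → Packet → Option Packet
  | [], pkt => some pkt
  | v :: l, pkt =>
    match S.process κ K v pkt with
    | .forward pkt' => relay K l pkt'
    | _ => none

/-- Independent uniform master keys for all (source, node). -/
noncomputable def masterKeys : PMF (ℕ → ℕ → List Bool) :=
  (PMF.uniformOfFintype (Fin (S.nodes κ) → Fin (S.nodes κ) → Fin κ → Bool)).map fun k s v =>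
    if h : s < S.nodes κ ∧ v < S.nodes κ then List.ofFn (k ⟨s, h.1⟩ ⟨v, h.2⟩) else []

/-! ### Well-formedness, efficiency, and security of the primitives -/

/-- All lengths are as they should be, and addresses and pointers fit into their fields. -/
structure WellFormed : Prop where
  nodes_le : ∀ κ, S.nodes κ ≤ 2 ^ S.addrLen κ
  slots_le : ∀ κ, S.slots κ ≤ 2 ^ S.ptrLen κ
  kdf_length : ∀ κ k t, k.length = κ →
    (S.kdf κ k t).1.length = κ ∧ (S.kdf κ k t).2.length = κ
  prg_length : ∀ κ k, k.length = κ → (S.prg κ k).length = S.elemLen κ + S.fullLen κ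
  mac_length : ∀ κ k X, k.length = κ → X.length = S.fullLen κ → (S.mac κ k X).length = κ

/-- The parameters and the primitives can be computed in polynomial time. -/
structure Efficient : Prop where
  nodes : PolyTimeNat S.nodes
  slots : PolyTimeNat S.slots
  addrLen : PolyTimeNat S.addrLen
  ptrLen : PolyTimeNat S.ptrLen
  payloadLen : PolyTimeNat S.payloadLen
  window : PolyTimeNat S.window
  seedLen : PolyTimeNat S.seedLen
  pattern : ∃ F, PolyTime F ∧ ∀ κ, F (.ofNat κ) = .ofBits (S.pattern κ)
  kdf : ∃ F, PolyTime F ∧ ∀ κ k t, k.length = κ →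
    F (.ofList [.ofNat κ, .ofBits k, .ofNat t]) =
      .cons (.ofBits (S.kdf κ k t).1) (.ofBits (S.kdf κ k t).2)
  prg : ∃ F, PolyTime F ∧ ∀ κ k, k.length = κ →
    F (.ofList [.ofNat κ, .ofBits k]) = .ofBits (S.prg κ k)
  mac : ∃ F, PolyTime F ∧ ∀ κ k X, k.length = κ → X.length = S.fullLen κ →
    F (.ofList [.ofNat κ, .ofBits k, .ofBits X]) = .ofBits (S.mac κ k X)
  perm : ∃ F, PolyTime F ∧ ∀ κ seed, seed.length = S.seedLen κ →
    F (.ofList [.ofNat κ, .ofBits seed]) = .ofNats (S.slotList κ seed)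

/-- The generator, on a uniform key, is indistinguishable from a uniform string. -/
def PRGSecure : Prop :=
  Indistinguishable
    (fun κ => (randomBits κ).map fun k => .ofBits (S.prg κ k))
    (fun κ => (randomBits (S.elemLen κ + S.fullLen κ)).map .ofBits)

/-- Polynomially many pairs of keys derived from one uniform master key are indistinguishable from
independent uniform keys. -/
def KDFSecure : Prop :=
  ∀ q : ℕ[X], Indistinguishable
    (fun κ => (randomBits κ).map fun k => .ofList (List.ofFn fun t : Fin (q.eval κ) =>
      .cons (.ofBits (S.kdf κ k t).1) (.ofBits (S.kdf κ k t).2)))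
    (fun κ => (PMF.uniformOfFintype (Fin (q.eval κ) → (Fin κ → Bool) × (Fin κ → Bool))).map
      fun u => .ofList (List.ofFn fun t =>
        .cons (.ofBits (List.ofFn (u t).1)) (.ofBits (List.ofFn (u t).2))))

/-- The permutation of the slots, on a uniform seed, is indistinguishable from a uniform one. -/
def PermSecure : Prop :=
  Indistinguishable
    (fun κ => (randomBits (S.seedLen κ)).map fun seed => .ofNats (S.slotList κ seed))
    (fun κ => (PMF.uniformOfFintype (Equiv.Perm (Fin (S.slots κ)))).map fun σ =>
      .ofNats (List.ofFn fun i => (σ i : ℕ)))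

end Scheme

/-! ## The games -/

/-- What the adversary submits as its challenge: two payloads, the index of the first packet, the
path `(source, before, N_j, after)`, and the other path `(source', before', N_j, after)`, where
`N_j` is the honest router. -/
structure Challenge where
  payload₁ : List Bool
  payload₂ : List Bool
  t : ℕ
  source : ℕ
  before : List ℕ
  after : List ℕ
  source' : ℕ
  before' : List ℕ

def Challenge.ofTree (x : Tree) : Challenge where
  payload₁ := (x.entry 0).toBits
  payload₂ := (x.entry 1).toBits
  t := (x.entry 2).toNat
  source := (x.entry 3).toNat
  before := (x.entry 4).toNats
  after := (x.entry 5).toNats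
  source' := (x.entry 6).toNat
  before' := (x.entry 7).toNats

/-- The two games: the two paths differ before the honest router, or they differ in the source. -/
inductive Game : Type
  | path : Game
  | source : Game
  deriving DecidableEq

/-- A path consists of different nodes, and its nodes other than the source fit into the slots. -/
def ValidPath (S : Scheme) (κ source : ℕ) (path : List ℕ) : Prop :=
  (source :: path).Nodup ∧ (∀ v ∈ source :: path, v < S.nodes κ) ∧ path.length ≤ S.slots κ

/-- The challenges that the challenger accepts. The honest router `j` must have a successor. -/
def Challenge.Valid (S : Scheme) (κ : ℕ) (g : Game) (j : ℕ) (c : Challenge) : Prop :=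
  c.payload₁.length ≤ S.payloadLen κ ∧ c.payload₂.length ≤ S.payloadLen κ ∧
  c.t + 1 < S.window κ ∧ c.after ≠ [] ∧
  ValidPath S κ c.source (c.before ++ j :: c.after) ∧
  ValidPath S κ c.source' (c.before' ++ j :: c.after) ∧
  match g with
  | .path => c.source' = c.source
  | .source => c.before' = c.before

/-- A probabilistic polynomial-time adversary that holds no keys. Each of its actions is a
polynomial-time function of its view: the security parameter in unary, its random coins, and the
list of all answers it has received so far. The numbers of coins and of queries before and after the
challenge are polynomials in the security parameter. -/
structure Adversary where
  coins : ℕ[X]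
  queries₁ : ℕ[X]
  queries₂ : ℕ[X]
  router : Tree → Tree
  query₁ : Tree → Tree
  challenge : Tree → Tree
  query₂ : Tree → Tree
  guess : Tree → Tree
  router_polyTime : PolyTime router
  query₁_polyTime : PolyTime query₁
  challenge_polyTime : PolyTime challenge
  query₂_polyTime : PolyTime query₂
  guess_polyTime : PolyTime guess

/-- The view of the adversary. -/
def view (κ : ℕ) (coins : List Bool) (answers : List Tree) : Tree :=
  .ofList [.ofNat κ, .ofBits coins, .ofList answers]

/-- `n` adaptive queries, `next` giving the query and `oracle` the answer. -/
def interact (next : List Tree → Tree) (oracle : Tree → Tree) : ℕ → List Tree → List Tree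
  | 0, answers => answers
  | n + 1, answers => interact next oracle n (answers ++ [oracle (next answers)])

/-- What the adversary sees of a packet: nothing if it did not get through. -/
def linkView : Option Packet → Tree
  | none => .nil
  | some pkt => pkt.toTree

open Classical in
/-- The packets that the challenger returns, as they leave the honest router `j`: the first one,
with index `t`, along the first path, and the second one, with index `t + 1`, along the first path
if `b` is `false` and along the other path if `b` is `true`. -/
noncomputable def challengePackets (S : Scheme) (κ : ℕ) (g : Game) (K : ℕ → ℕ → List Bool) (j : ℕ)
    (c : Challenge) (b : Bool) : PMF (List Tree) :=
  if c.Valid S κ g j then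
    let source₂ := if b then c.source' else c.source
    let before₂ := if b then c.before' else c.before
    (S.create κ (K c.source) c.t (c.before ++ j :: c.after) c.payload₁).bind fun pkt₁ =>
    (S.create κ (K source₂) (c.t + 1) (before₂ ++ j :: c.after) c.payload₂).map fun pkt₂ =>
      [linkView (S.relay κ K (c.before ++ [j]) pkt₁),
        linkView (S.relay κ K (before₂ ++ [j]) pkt₂)]
  else PMF.pure [.nil, .nil]

/-- The game. The result tells whether the adversary guessed the bit `b`. -/
noncomputable def play (S : Scheme) (g : Game) (A : Adversary) (κ : ℕ) : PMF Bool :=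
  (S.masterKeys κ).bind fun K =>
  (randomBits (A.coins.eval κ)).bind fun r =>
  (PMF.uniformOfFintype Bool).bind fun b =>
  let j := (A.router (view κ r [])).toNat
  let oracle : Tree → Tree := fun x => (S.process κ K j (.ofTree x)).toTree
  let answers₁ := interact (fun as => A.query₁ (view κ r as)) oracle (A.queries₁.eval κ) []
  let c := Challenge.ofTree (A.challenge (view κ r answers₁))
  (challengePackets S κ g K j c b).map fun pkts =>
  let answers₂ := interact (fun as => A.query₂ (view κ r as)) oracle (A.queries₂.eval κ)
    (answers₁ ++ pkts)
  (A.guess (view κ r answers₂)).toBool == b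

/-- No adversary wins the game with a probability that differs non-negligibly from `1/2`. -/
def Unlinkable (S : Scheme) (g : Game) : Prop :=
  ∀ A : Adversary, Negligible fun κ => (play S g A κ true).toReal - 1 / 2

def PathSessionUnlinkable (S : Scheme) : Prop := Unlinkable S .path

def SourceSessionUnlinkable (S : Scheme) : Prop := Unlinkable S .source

def SessionUnlinkable (S : Scheme) : Prop :=
  PathSessionUnlinkable S ∧ SourceSessionUnlinkable S

end Ariadne

/-! For a source s, a node v and an index t, the generator turns the encryption key into a pad: its
first U bits blind a routing element, the others blind the body. The MAC key tags the blinded body.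
The proof replaces the pseudo-random objects by random ones, and then shows by counting that almost
no advantage is left.

Replacement. The whole game is a polynomial-time function of the table of pads, the table of MAC
keys, the slots of the second packet and further coins (`pt_gameResult`), so it can serve as a
distinguisher. Three hops make the derived keys, then the pads, then the slots of the second packet
truly random. The first two concern polynomially many independent samples at once and use the hybrid
argument `Indistinguishable.negligible_samples`. The first packet keeps its pseudo-random slots,
because it is made in the same way for both values of the bit.

Random pads, acceptance. Fix a packet, a MAC key and a pad except for the κ bits that blind the tag.
At most one value of these bits makes the line accept (`Scheme.openAt_unique`). So a line accepts a
packet that does not depend on these bits with probability at most 2^(-κ) (`Scheme.expect_hit_le`);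
unforgeability of the code plays no role. The queries of the adversary are of this kind: a challenge
packet that leaves the router has lost the router's layer, and the router's pad survives in it only
through the filler, which does not use these bits. A packet on its way is of this kind for all lines
except that of its own source and index. Hence, up to a union bound, all queries are dropped and
both challenge packets travel as intended (`expect_gameResult_le`).

Random pads, uniformity. Let w be the successor of the router and p its slot. Add to the body parts
of the pads of the router and of w the same string D, which vanishes in slot p. The two changes
cancel in the filler, so all layers beyond w stay as they are, while the body that w blinds changes
by D. The element part of the pad of w moves slot p independently (`Scheme.exists_outPacket_shift`).
Translations preserve the uniform distribution, so for given w and p the outgoing body is uniform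
(`Scheme.expect_outPacket`). Both paths share w, and the value of a uniform permutation has the same
distribution at every position (`expect_permList`), so p does not reveal the length of the path. The
first packet has a different index and hence uses other pads. The second packet therefore carries no
information about the bit (`expect_guessOn`). -/

namespace Ariadne

/-! ### Data as trees and the calculus of polynomial-time functions -/

theorem eval_mono (p : ℕ[X]) {m n : ℕ} (h : m ≤ n) : p.eval m ≤ p.eval n := by
  rw [eval_eq_sum, eval_eq_sum]
  exact Finset.sum_le_sum fun i _ => Nat.mul_le_mul_left _ (Nat.pow_le_pow_left h i)

/-- Writing a value costs at least its size. The summand `x.size` is needed for a loop that stops at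
once, which returns its input without writing it. This is the source of `PT.pb`, the polynomial
bound on outputs on which composition depends. -/
theorem Prog.Runs.size_le {P : Prog} {x y : Tree} {c : ℕ} (h : P.Runs x y c) :
    y.size ≤ x.size + c := by
  induction h <;> (try simp only [Tree.size] at *) <;> omega

/-- Types whose elements are represented by trees. -/
class Enc (α : Type) where
  enc : α → Tree

open Enc

/-- These encodings agree with the tree forms in the definition of the games, so that conversions
such as `Tree.ofNat` and `Tree.ofBits` do nothing to the representation. -/
instance : Enc Tree := ⟨fun x => x⟩
instance : Enc Unit := ⟨fun _ => .nil⟩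
instance : Enc Bool := ⟨Tree.ofBool⟩
instance : Enc ℕ := ⟨Tree.ofNat⟩
instance {α β : Type} [Enc α] [Enc β] : Enc (α × β) := ⟨fun a => .cons (enc a.1) (enc a.2)⟩
instance {α : Type} [Enc α] : Enc (List α) := ⟨fun l => .ofList (l.map enc)⟩
instance {α : Type} [Enc α] : Enc (Option α) := ⟨fun o => enc o.toList⟩

section

variable {α β γ δ σ : Type} [Enc α] [Enc β] [Enc γ] [Enc δ] [Enc σ]

/-- The size of the tree that represents an element. -/
def esize (a : α) : ℕ := (enc a).size

@[simp] theorem enc_pair (a : α) (b : β) : enc (a, b) = .cons (enc a) (enc b) := rfl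
@[simp] theorem enc_cons (a : α) (l : List α) : enc (a :: l) = .cons (enc a) (enc l) := rfl
@[simp] theorem esize_pair (a : α) (b : β) : esize (a, b) = esize a + esize b + 1 := rfl
@[simp] theorem esize_nil : esize ([] : List α) = 1 := rfl
@[simp] theorem esize_cons (a : α) (l : List α) : esize (a :: l) = esize a + esize l + 1 := rfl

theorem esize_append (l m : List α) : esize (l ++ m) + 1 = esize l + esize m := by
  induction l with
  | nil => simp [Nat.add_comm]
  | cons a l ih => simp only [List.cons_append, esize_cons]; omega

theorem length_le_esize (l : List α) : l.length ≤ esize l := by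
  induction l with
  | nil => simp
  | cons a l ih => simp only [List.length_cons, esize_cons]; omega

theorem esize_le_of_mem {a : α} {l : List α} (h : a ∈ l) : esize a ≤ esize l := by
  induction l with
  | nil => simp at h
  | cons b l ih =>
    simp only [esize_cons]
    rcases List.mem_cons.1 h with rfl | h
    · omega
    · have := ih h; omega

/-- A unary number is a list of units, so that recursion on numbers becomes a fold over a list. -/
theorem enc_nat (n : ℕ) : enc n = enc (List.replicate n ()) := by
  simp [enc, Tree.ofNat]

theorem esize_nat (n : ℕ) : esize n = 2 * n + 1 := by
  have h : esize n = esize (List.replicate n ()) := by simp only [esize, enc_nat]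
  rw [h]
  induction n with
  | zero => rfl
  | succ n ih =>
    rw [List.replicate_succ, esize_cons, ih (by simp only [esize, enc_nat])]
    simp only [show esize () = 1 from rfl]; omega

theorem esize_bool_le (b : Bool) : esize b ≤ 3 := by cases b <;> decide

/-- Polynomial-time computability of a function between represented types. -/
@[fun_prop]
def PT (f : α → β) : Prop :=
  ∃ (P : Prog) (p : ℕ[X]), ∀ a, ∃ c ≤ p.eval (esize a), P.Runs (enc a) (enc (f a)) c

/-- The number `f a` is bounded by a polynomial in the size of `a`. -/
def PB (f : α → ℕ) : Prop := ∃ p : ℕ[X], ∀ a, f a ≤ p.eval (esize a)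

theorem PolyTime.pt {f : Tree → Tree} (h : PolyTime f) : PT f := h

theorem PB.mono {f g : α → ℕ} (hg : PB g) (h : ∀ a, f a ≤ g a) : PB f :=
  let ⟨p, hp⟩ := hg; ⟨p, fun a => (h a).trans (hp a)⟩

theorem PB.const (n : ℕ) : PB fun _ : α => n := ⟨C n, fun _ => by simp⟩

theorem PB.add {f g : α → ℕ} (hf : PB f) (hg : PB g) : PB fun a => f a + g a :=
  let ⟨p, hp⟩ := hf; let ⟨q, hq⟩ := hg
  ⟨p + q, fun a => by rw [eval_add]; exact add_le_add (hp a) (hq a)⟩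

theorem PB.mul {f g : α → ℕ} (hf : PB f) (hg : PB g) : PB fun a => f a * g a :=
  let ⟨p, hp⟩ := hf; let ⟨q, hq⟩ := hg
  ⟨p * q, fun a => by rw [eval_mul]; exact Nat.mul_le_mul (hp a) (hq a)⟩

theorem PB.eval {f : α → ℕ} (hf : PB f) (q : ℕ[X]) : PB fun a => q.eval (f a) :=
  let ⟨p, hp⟩ := hf
  ⟨q.comp p, fun a => by rw [eval_comp]; exact eval_mono q (hp a)⟩

theorem PB.esize_self : PB fun a : α => esize a := ⟨X, fun a => by simp⟩

theorem PT.pb {f : α → β} (hf : PT f) : PB fun a => esize (f a) := by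
  obtain ⟨P, p, h⟩ := hf
  refine ⟨X + p, fun a => ?_⟩
  obtain ⟨c, hc, hr⟩ := h a
  have h2 := hr.size_le
  simp only [eval_add, eval_X]
  exact h2.trans (Nat.add_le_add_left hc _)

theorem PB.comp {f : β → ℕ} {g : α → β} (hf : PB f) (hg : PT g) : PB fun a => f (g a) :=
  let ⟨p, hp⟩ := hf
  (hg.pb.eval p).mono fun a => hp (g a)

theorem PT.pb_nat {f : α → ℕ} (hf : PT f) : PB f :=
  hf.pb.mono fun a => by rw [esize_nat]; omega

theorem PT.pb_length {f : α → List β} (hf : PT f) : PB fun a => (f a).length :=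
  hf.pb.mono fun _ => length_le_esize _

theorem PT.of_runs {f : α → β} (P : Prog) {B : α → ℕ} (hB : PB B)
    (h : ∀ a, ∃ c ≤ B a, P.Runs (enc a) (enc (f a)) c) : PT f := by
  obtain ⟨p, hp⟩ := hB
  refine ⟨P, p, fun a => ?_⟩
  obtain ⟨c, hc, hr⟩ := h a
  exact ⟨c, hc.trans (hp a), hr⟩

theorem PT.runs {f : α → β} (hf : PT f) :
    ∃ (P : Prog) (B : α → ℕ), PB B ∧ ∀ a, ∃ c ≤ B a, P.Runs (enc a) (enc (f a)) c := by
  obtain ⟨P, p, h⟩ := hf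
  exact ⟨P, fun a => p.eval (esize a), ⟨p, fun _ => le_rfl⟩, h⟩

/-- Functions that do the same on representations. -/
theorem PT.congr_enc {f : α → β} {g : γ → δ} (hg : PT g) (e : α → γ)
    (he : ∀ a, enc (e a) = enc a) (h : ∀ a, enc (f a) = enc (g (e a))) : PT f := by
  obtain ⟨P, p, hP⟩ := hg
  refine ⟨P, p, fun a => ?_⟩
  obtain ⟨c, hc, hr⟩ := hP (e a)
  rw [h, ← he]
  refine ⟨c, ?_, hr⟩
  simpa only [esize, he] using hc

theorem PT.congr_out {f : α → β} {g : α → γ} (hg : PT g) (h : ∀ a, enc (f a) = enc (g a)) :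
    PT f := hg.congr_enc (fun a => a) (fun _ => rfl) h

theorem PT.congr {f g : α → β} (hg : PT g) (h : ∀ a, f a = g a) : PT f :=
  hg.congr_out fun a => by rw [h]

@[fun_prop]
theorem PT.id : PT fun a : α => a :=
  .of_runs .id (PB.esize_self.add (.const 1)) fun _ => ⟨_, le_rfl, .id _⟩

theorem PT.comp {g : β → γ} {f : α → β} (hg : PT g) (hf : PT f) : PT fun a => g (f a) := by
  obtain ⟨P, B, hB, hP⟩ := hf.runs
  obtain ⟨Q, D, hD, hQ⟩ := hg.runs
  refine .of_runs (.seq P Q) ((hB.add (hD.comp hf)).add (.const 1)) fun a => ?_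
  obtain ⟨c, hc, hr⟩ := hP a
  obtain ⟨d, hd, hs⟩ := hQ (f a)
  exact ⟨_, by omega, .seq hr hs⟩

attribute [fun_prop] PT.comp

@[fun_prop]
theorem PT.pair {f : α → β} {g : α → γ} (hf : PT f) (hg : PT g) : PT fun a => (f a, g a) := by
  obtain ⟨P, B, hB, hP⟩ := hf.runs
  obtain ⟨Q, D, hD, hQ⟩ := hg.runs
  refine .of_runs (.pair P Q)
    (((hB.add hD).add (hf.pb.add hg.pb)).add (.const 2)) fun a => ?_
  obtain ⟨c, hc, hr⟩ := hP a
  obtain ⟨d, hd, hs⟩ := hQ a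
  refine ⟨_, ?_, .pair hr hs⟩
  simp only [Tree.size, esize] at *; omega

theorem PT.fst' : PT fun a : α × β => a.1 := by
  refine .of_runs .head (PB.esize_self.add (.const 1)) fun a => ⟨_, ?_, .head _⟩
  obtain ⟨a, b⟩ := a
  simp only [enc_pair, Tree.fst, esize, Tree.size]; omega

theorem PT.snd' : PT fun a : α × β => a.2 := by
  refine .of_runs .tail (PB.esize_self.add (.const 1)) fun a => ⟨_, ?_, .tail _⟩
  obtain ⟨a, b⟩ := a
  simp only [enc_pair, Tree.snd, esize, Tree.size]; omega

@[fun_prop]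
theorem PT.fst {f : α → β × γ} (hf : PT f) : PT fun a => (f a).1 := PT.comp PT.fst' hf

@[fun_prop]
theorem PT.snd {f : α → β × γ} (hf : PT f) : PT fun a => (f a).2 := PT.comp PT.snd' hf

theorem PT.const_tree (x : Tree) : PT fun _ : α => x := by
  induction x with
  | nil => exact .of_runs .nil (.const 1) fun _ => ⟨_, le_rfl, .nil _⟩
  | cons x y hx hy => exact (hx.pair hy).congr_out fun _ => rfl

@[fun_prop]
theorem PT.const (b : β) : PT fun _ : α => b := (PT.const_tree (enc b)).congr_out fun _ => rfl

theorem PT.cond_enc {c : α → γ} {f g h : α → β} (hc : PT c) (hf : PT f) (hg : PT g)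
    (h₁ : ∀ a, enc (c a) ≠ .nil → h a = f a) (h₀ : ∀ a, enc (c a) = .nil → h a = g a) :
    PT h := by
  obtain ⟨P, B, hB, hP⟩ := hc.runs
  obtain ⟨Q, D, hD, hQ⟩ := hf.runs
  obtain ⟨R, E, hE, hR⟩ := hg.runs
  refine .of_runs (.cond P Q R) (((hB.add hD).add hE).add (.const 1)) fun a => ?_
  obtain ⟨c', hc', hr⟩ := hP a
  by_cases hn : enc (c a) = .nil
  · obtain ⟨d, hd, hs⟩ := hR a
    rw [h₀ a hn]
    refine ⟨_, ?_, .cond_false (hn ▸ hr) hs⟩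
    omega
  · obtain ⟨d, hd, hs⟩ := hQ a
    rw [h₁ a hn]
    refine ⟨_, ?_, .cond_true hr hn hs⟩
    omega

@[fun_prop]
theorem PT.cond {c : α → Bool} {f g : α → β} (hc : PT c) (hf : PT f) (hg : PT g) :
    PT fun a => bif c a then f a else g a := by
  refine hc.cond_enc hf hg (fun a h => ?_) fun a h => ?_ <;> cases hb : c a <;>
    simp_all [Enc.enc, Tree.ofBool]

@[fun_prop]
theorem PT.ite {p : α → Prop} [∀ a, Decidable (p a)] {f g : α → β} (hp : PT fun a => decide (p a))
    (hf : PT f) (hg : PT g) : PT fun a => if p a then f a else g a := by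
  refine (hp.cond hf hg).congr fun a => ?_
  by_cases h : p a <;> simp [h]

/-- A while-loop runs on the triple of the remaining list, the parameter and the state. The bound on
growth is additive in the state: a polynomial bound on each step alone would allow exponential
growth over the whole loop. -/
theorem PT.foldl {f : α → List β} {i : α → σ} {g : α → σ → β → σ} (hf : PT f) (hi : PT i)
    (hg : PT fun p : α × σ × β => g p.1 p.2.1 p.2.2) {B : α → ℕ} (hB : PB B)
    (h : ∀ a s, ∀ b ∈ f a, esize (g a s b) ≤ esize s + B a) :
    PT fun a => (f a).foldl (g a) (i a) := by
  -- A nonempty list has the same tree as the pair of its head and tail, so the body of the loop can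
  -- be typed on such pairs.
  have hbody : PT fun x : (β × List β) × α × σ => (x.1.2, x.2.1, g x.2.1 x.2.2 x.1.1) := by
    have h1 : PT fun x : (β × List β) × α × σ => g x.2.1 x.2.2 x.1.1 :=
      PT.comp (f := fun x : (β × List β) × α × σ => (x.2.1, x.2.2, x.1.1)) hg (by fun_prop)
    fun_prop
  have hinit : PT fun a => (f a, a, i a) := by fun_prop
  obtain ⟨P, p, hP⟩ := hbody
  obtain ⟨Q, D, hD, hQ⟩ := hinit.runs
  set M : α → ℕ := fun a => esize (f a) + esize a + (esize (i a) + (f a).length * B a) + 3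
    with hM
  have hMB : PB M := ((hf.pb.add PB.esize_self).add (hi.pb.add (hf.pb_length.mul hB))).add
    (.const 3)
  -- The sum on the left of the size condition does not increase when an entry is consumed: the
  -- state gains at most `B a` and the remaining list is shorter by one. So `M a` bounds the size of
  -- all states of the loop.
  have key : ∀ a, ∀ l : List β, ∀ s : σ, (∀ b ∈ l, b ∈ f a) →
      esize l + esize a + (esize s + l.length * B a) + 3 ≤ M a →
      ∃ c ≤ l.length * (M a + p.eval (M a) + 1) + M a + 1,
        (Prog.loop .head P).Runs (enc (l, a, s)) (enc (([] : List β), a, l.foldl (g a) s)) c := by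
    intro a l
    induction l with
    | nil =>
      intro s _ hs
      refine ⟨2 + 1, ?_, Prog.Runs.loop_stop (Prog.Runs.head _)⟩
      simp only [List.length_nil]; omega
    | cons b l ih =>
      intro s hl hs
      have hgs := h a s b (hl b (by simp))
      simp only [esize_cons, List.length_cons, Nat.add_mul, Nat.one_mul] at hs
      obtain ⟨e, he, hloop⟩ := ih (g a s b) (fun b' hb' => hl b' (by simp [hb'])) (by omega)
      obtain ⟨d, hd, hstep⟩ := hP ((b, l), a, s)
      refine ⟨_, ?_, Prog.Runs.loop_step (Prog.Runs.head _) ?_ hstep hloop⟩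
      · have h1 : d ≤ p.eval (M a) := hd.trans (eval_mono p (by simp only [esize_pair]; omega))
        have h2 : (enc (b :: l, a, s)).fst.size + 1 ≤ M a := by
          simp only [enc_pair, enc_cons, Tree.fst, Tree.size, esize] at hs ⊢; omega
        simp only [List.length_cons, Nat.add_mul, Nat.one_mul]; omega
      · simp [Tree.fst]
  -- The condition `.head` reads the remaining list, which is `nil` exactly when it is exhausted;
  -- the two `.tail` extract the state from the final triple.
  refine .of_runs (.seq Q (.seq (.loop .head P) (.seq .tail .tail)))
    (B := fun a => D a + ((f a).length * (M a + p.eval (M a) + 1) + M a + 1)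
      + (esize a + 2 * (esize (i a) + (f a).length * B a)) + 10)
    (((hD.add (((hf.pb_length.mul ((hMB.add (hMB.eval p)).add (.const 1))).add hMB).add
      (.const 1))).add (PB.esize_self.add ((PB.const 2).mul (hi.pb.add (hf.pb_length.mul hB))))).add
      (.const 10)) fun a => ?_
  have hfin : ∀ l : List β, ∀ s : σ, (∀ b ∈ l, b ∈ f a) →
      esize (l.foldl (g a) s) ≤ esize s + l.length * B a := by
    intro l
    induction l with
    | nil => simp
    | cons b l ih =>
      intro s hl
      have h1 := h a s b (hl b (by simp))
      have h2 := ih (g a s b) fun b' hb' => hl b' (by simp [hb'])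
      simp only [List.foldl_cons, List.length_cons, Nat.add_mul, Nat.one_mul]; omega
  obtain ⟨c, hc, hr⟩ := hQ a
  obtain ⟨e, he, hloop⟩ := key a (f a) (i a) (fun _ h => h) le_rfl
  refine ⟨_, ?_, .seq hr (.seq hloop (.seq (.tail _) (.tail _)))⟩
  have h1 := hfin (f a) (i a) fun _ h => h
  simp only [enc_pair, Tree.snd, Tree.size] at *
  simp only [esize] at *
  omega

end

end Ariadne

/-! ### Closure of polynomial time: lists, Booleans, unary arithmetic -/

namespace Ariadne
open Enc

section

variable {α β γ δ σ : Type} [Enc α] [Enc β] [Enc γ] [Enc δ] [Enc σ]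

theorem PB.add_esize_const (n : ℕ) : PB fun a : α => esize a + n := PB.esize_self.add (.const n)

/-! ### Lists -/

@[fun_prop]
theorem PT.list_cons {f : α → β} {g : α → List β} (hf : PT f) (hg : PT g) :
    PT fun a => f a :: g a := (hf.pair hg).congr_out fun _ => rfl

@[fun_prop]
theorem PT.list_tail {f : α → List β} (hf : PT f) : PT fun a => (f a).tail := by
  refine PT.comp (g := List.tail) ?_ hf
  refine .of_runs .tail (PB.add_esize_const 1) fun l =>
    ⟨(enc l.tail).size + 1, ?_, ?_⟩
  · cases l <;> simp [esize, Tree.size]; omega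
  · cases l with
    | nil => exact .tail _
    | cons b l => exact .tail (.cons (enc b) (enc l))

@[fun_prop]
theorem PT.reverse {f : α → List β} (hf : PT f) : PT fun a => (f a).reverse := by
  have h : PT fun a => (f a).foldl (fun s b => b :: s) [] := by
    refine PT.foldl hf (.const _) (by fun_prop) (hf.pb.add (.const 1)) fun a s b hb => ?_
    have := esize_le_of_mem hb
    simp only [esize_cons]; omega
  exact h.congr fun a => by simp

theorem PT.foldr {f : α → List β} {i : α → σ} {g : α → β → σ → σ} (hf : PT f) (hi : PT i)
    (hg : PT fun p : α × β × σ => g p.1 p.2.1 p.2.2) {B : α → ℕ} (hB : PB B)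
    (h : ∀ a s, ∀ b ∈ f a, esize (g a b s) ≤ esize s + B a) :
    PT fun a => (f a).foldr (g a) (i a) := by
  have h1 : PT fun a => (f a).reverse.foldl (fun s b => g a b s) (i a) :=
    PT.foldl (f := fun a => (f a).reverse) (g := fun a s b => g a b s) (by fun_prop) hi
      (PT.comp (f := fun p : α × σ × β => (p.1, p.2.2, p.2.1)) hg (by fun_prop)) hB
      fun a s b hb => h a s b (by simpa using hb)
  exact h1.congr fun a => by simp

@[fun_prop]
theorem PT.append {f g : α → List β} (hf : PT f) (hg : PT g) : PT fun a => f a ++ g a := by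
  have h : PT fun a => (f a).foldr (fun b s => b :: s) (g a) := by
    refine PT.foldr hf hg (by fun_prop) (hf.pb.add (.const 1)) fun a s b hb => ?_
    have := esize_le_of_mem hb
    simp only [esize_cons]; omega
  exact h.congr fun a => by simp

@[fun_prop]
theorem PT.map {f : α → List β} {g : α → β → γ} (hf : PT f)
    (hg : PT fun p : α × β => g p.1 p.2) : PT fun a => (f a).map (g a) := by
  obtain ⟨p, hp⟩ := hg.pb
  have h : PT fun a => (f a).foldr (fun b s => g a b :: s) [] := by
    refine PT.foldr (B := fun a => p.eval (esize a + esize (f a) + 1) + 1) hf (.const _) ?_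
      ((((PB.esize_self.add hf.pb).add (.const 1)).eval p).add (.const 1)) fun a s b hb => ?_
    · refine PT.list_cons ?_ (by fun_prop)
      exact PT.comp (f := fun p : α × β × List γ => (p.1, p.2.1)) hg (by fun_prop)
    · have h1 : esize (g a b) ≤ _ := hp (a, b)
      have h2 : p.eval (esize (a, b)) ≤ p.eval (esize a + esize (f a) + 1) :=
        eval_mono p (by have := esize_le_of_mem hb; simp only [esize_pair]; omega)
      simp only [esize_cons]; omega
  refine h.congr fun a => ?_
  induction f a with
  | nil => rfl
  | cons b l ih => rw [List.map_cons, List.foldr_cons, ih]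

/-- A left fold whose state is always bounded. -/
theorem PT.foldl_bounded {f : α → List β} {i : α → σ} {g : α → σ → β → σ} (hf : PT f) (hi : PT i)
    (hg : PT fun p : α × σ × β => g p.1 p.2.1 p.2.2) {B : α → ℕ} (hB : PB B)
    (h : ∀ a s b, esize (g a s b) ≤ B a) : PT fun a => (f a).foldl (g a) (i a) :=
  PT.foldl hf hi hg hB fun a s b _ => (h a s b).trans (by omega)

/-! ### Booleans -/

@[fun_prop]
theorem PT.bool_not {f : α → Bool} (hf : PT f) : PT fun a => !(f a) :=
  (hf.cond (.const false) (.const true)).congr fun a => by cases f a <;> rfl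

@[fun_prop]
theorem PT.bool_and {f g : α → Bool} (hf : PT f) (hg : PT g) : PT fun a => f a && g a :=
  (hf.cond hg (.const false)).congr fun a => by cases f a <;> rfl

@[fun_prop]
theorem PT.bool_beq {f g : α → Bool} (hf : PT f) (hg : PT g) : PT fun a => f a == g a :=
  (hf.cond hg hg.bool_not).congr fun a => by cases f a <;> cases g a <;> rfl

@[fun_prop]
theorem PT.bool_xor {f g : α → Bool} (hf : PT f) (hg : PT g) : PT fun a => (f a).xor (g a) :=
  (hf.cond hg.bool_not hg).congr fun a => by cases f a <;> cases g a <;> rfl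

@[fun_prop]
theorem PT.decide_bool {f : α → Bool} (hf : PT f) : PT fun a => decide (f a = true) :=
  hf.congr fun a => by simp

@[fun_prop]
theorem PT.decide_and {p q : α → Prop} [∀ a, Decidable (p a)] [∀ a, Decidable (q a)]
    (hp : PT fun a => decide (p a)) (hq : PT fun a => decide (q a)) :
    PT fun a => decide (p a ∧ q a) := (hp.bool_and hq).congr fun a => by simp

@[fun_prop]
theorem PT.all {f : α → List β} {g : α → β → Bool} (hf : PT f)
    (hg : PT fun p : α × β => g p.1 p.2) : PT fun a => (f a).all (g a) := by
  have h : PT fun a => ((f a).map (g a)).foldl (fun s b => s && b) true :=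
    PT.foldl_bounded (f := fun a => (f a).map (g a)) (hf.map hg) (.const _) (by fun_prop)
      (.const 3) fun a s b => esize_bool_le _
  refine h.congr fun a => ?_
  rw [List.foldl_map]
  have : ∀ (l : List β) (s : Bool), l.foldl (fun s b => s && g a b) s = (s && l.all (g a)) := by
    intro l
    induction l with
    | nil => simp
    | cons b l ih => intro s; simp [ih, Bool.and_assoc]
  simp [this]

/-! ### Numbers -/

@[fun_prop]
theorem PT.replicate_unit {f : α → ℕ} (hf : PT f) : PT fun a => List.replicate (f a) () :=
  hf.congr_out fun _ => (enc_nat _).symm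

@[fun_prop]
theorem PT.length {f : α → List β} (hf : PT f) : PT fun a => (f a).length := by
  have h : PT fun a => (f a).map fun _ => () := hf.map (.const _)
  exact h.congr_out fun a => by rw [enc_nat, List.map_const']

@[fun_prop]
theorem PT.nat_add {f g : α → ℕ} (hf : PT f) (hg : PT g) : PT fun a => f a + g a := by
  have h : PT fun a => (List.replicate (f a) () ++ List.replicate (g a) ()).length := by fun_prop
  exact h.congr fun a => by simp

@[fun_prop]
theorem PT.replicate {f : α → ℕ} {g : α → β} (hf : PT f) (hg : PT g) :
    PT fun a => List.replicate (f a) (g a) := by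
  have h : PT fun a => (List.replicate (f a) ()).map fun _ => g a :=
    PT.map (g := fun a _ => g a) (by fun_prop) (by fun_prop)
  exact h.congr fun a => by simp

@[fun_prop]
theorem PT.drop {f : α → ℕ} {g : α → List β} (hf : PT f) (hg : PT g) :
    PT fun a => (g a).drop (f a) := by
  have h : PT fun a => (List.replicate (f a) ()).foldl (fun s _ => s.tail) (g a) := by
    refine PT.foldl (B := fun _ => 0) (f := fun a => List.replicate (f a) ()) (by fun_prop) hg
      (by fun_prop) (.const 0) fun a s b _ => ?_
    cases s <;> simp; omega
  refine h.congr fun a => ?_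
  generalize g a = l
  induction f a generalizing l with
  | zero => rfl
  | succ n ih => rw [List.replicate_succ, List.foldl_cons, ← ih, ← List.drop_one, List.drop_drop,
      Nat.add_comm]

@[fun_prop]
theorem PT.nat_sub {f g : α → ℕ} (hf : PT f) (hg : PT g) : PT fun a => f a - g a := by
  have h : PT fun a => ((List.replicate (f a) ()).drop (g a)).length := by fun_prop
  exact h.congr fun a => by simp

@[fun_prop]
theorem PT.take {f : α → ℕ} {g : α → List β} (hf : PT f) (hg : PT g) :
    PT fun a => (g a).take (f a) := by
  have h : PT fun a => ((g a).reverse.drop ((g a).length - f a)).reverse := by fun_prop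
  refine h.congr fun a => ?_
  rw [← List.reverse_take, List.reverse_reverse]

theorem PT.eq_zero {f : α → ℕ} (hf : PT f) : PT fun a => decide (f a = 0) := by
  refine PT.cond_enc hf (.const false) (.const true) (fun a h => ?_) fun a h => ?_ <;>
    cases hb : f a <;> simp_all [Enc.enc, Tree.ofNat, Tree.ofList, List.replicate_succ]

@[fun_prop]
theorem PT.nat_le {f g : α → ℕ} (hf : PT f) (hg : PT g) : PT fun a => decide (f a ≤ g a) :=
  (hf.nat_sub hg).eq_zero.congr fun a => by simp [Nat.sub_eq_zero_iff_le]

@[fun_prop]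
theorem PT.nat_lt {f g : α → ℕ} (hf : PT f) (hg : PT g) : PT fun a => decide (f a < g a) :=
  ((hf.nat_add (.const 1)).nat_le hg).congr fun _ => rfl

@[fun_prop]
theorem PT.nat_eq {f g : α → ℕ} (hf : PT f) (hg : PT g) : PT fun a => decide (f a = g a) :=
  ((hf.nat_le hg).bool_and (hg.nat_le hf)).congr fun a => by
    simp [← Bool.decide_and, Nat.le_antisymm_iff]

@[fun_prop]
theorem PT.range {f : α → ℕ} (hf : PT f) : PT fun a => List.range (f a) := by
  -- The number `f a - (f a - k)` is the minimum of `f a` and `k`, which is `k` on the states that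
  -- occur. The truncation is there because `PT.foldl` asks for the growth bound at arbitrary
  -- states.
  have h : PT fun a => ((List.replicate (f a) ()).foldl (fun (s : ℕ × List ℕ) _ =>
      (s.1 - 1, (f a - (f a - (s.1 - 1))) :: s.2)) (f a, [])).2 := by
    refine PT.snd (PT.foldl (B := fun a => 2 * f a + 2) (f := fun a => List.replicate (f a) ())
      (g := fun a (s : ℕ × List ℕ) _ => (s.1 - 1, (f a - (f a - (s.1 - 1))) :: s.2))
      (by fun_prop) (by fun_prop) ?_ (((PB.const 2).mul hf.pb_nat).add (.const 2))
      fun a s b _ => ?_)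
    · have h1 : PT fun p : α × (ℕ × List ℕ) × Unit => f p.1 := PT.comp hf (by fun_prop)
      fun_prop
    · obtain ⟨m, l⟩ := s
      simp only [esize_pair, esize_cons, esize_nat]; omega
  have key : ∀ n k : ℕ, ∀ l : List ℕ, k ≤ n → ((List.replicate k ()).foldl
      (fun (s : ℕ × List ℕ) _ => (s.1 - 1, (n - (n - (s.1 - 1))) :: s.2)) (k, l)).2
      = List.range k ++ l := by
    intro n k
    induction k with
    | zero => simp
    | succ k ih =>
      intro l hk
      rw [List.replicate_succ, List.foldl_cons]
      simp only [Nat.add_sub_cancel, ih _ (show k ≤ n by omega)]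
      rw [List.range_succ, show n - (n - k) = k by omega]; simp
  exact h.congr fun a => by rw [key _ _ _ le_rfl, List.append_nil]

@[fun_prop]
theorem PT.option_toList {f : α → Option β} (hf : PT f) : PT fun a => (f a).toList :=
  hf.congr_out fun _ => rfl

@[fun_prop]
theorem PT.some {f : α → β} (hf : PT f) : PT fun a => Option.some (f a) :=
  (hf.list_cons (.const [])).congr_out fun _ => rfl

@[fun_prop]
theorem PT.option_elim {f : α → Option β} {n : α → γ} {g : α → β → γ} (hf : PT f) (hn : PT n)
    (hg : PT fun p : α × β => g p.1 p.2) : PT fun a => (f a).elim (n a) (g a) := by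
  obtain ⟨p, hp⟩ := hg.pb
  have h : PT fun a => (f a).toList.foldl (fun _ b => g a b) (n a) := by
    refine PT.foldl (B := fun a => p.eval (esize a + esize (f a).toList + 1)) (f := fun a =>
        (f a).toList)
      (by fun_prop) hn ?_
      (((PB.esize_self.add hf.option_toList.pb).add (.const 1)).eval p) fun a s b hb => ?_
    · exact PT.comp (f := fun p : α × γ × β => (p.1, p.2.2)) hg (by fun_prop)
    · have h1 : esize (g a b) ≤ _ := hp (a, b)
      have h2 : p.eval (esize (a, b)) ≤ p.eval (esize a + esize (f a).toList + 1) :=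
        eval_mono p (by have := esize_le_of_mem hb; simp only [esize_pair]; omega)
      omega
  exact h.congr fun a => by cases f a <;> rfl

end

end Ariadne

/-! ### Closure of polynomial time: indexing, binary digits, search, trees -/

namespace Ariadne
open Enc

section

variable {α β γ δ σ : Type} [Enc α] [Enc β] [Enc γ] [Enc δ] [Enc σ]

@[fun_prop]
theorem PT.headD {f : α → List β} {d : α → β} (hf : PT f) (hd : PT d) :
    PT fun a => (f a).headD (d a) := by
  have h : PT fun a => (f a).foldr (fun b _ => b) (d a) := by
    refine PT.foldr hf hd (by fun_prop) hf.pb fun a s b hb => ?_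
    have := esize_le_of_mem hb
    omega
  exact h.congr fun a => by cases f a <;> rfl

@[fun_prop]
theorem PT.getD {f : α → List β} {i : α → ℕ} {d : α → β} (hf : PT f) (hi : PT i) (hd : PT d) :
    PT fun a => (f a).getD (i a) (d a) := by
  have h : PT fun a => ((f a).drop (i a)).headD (d a) := by fun_prop
  refine h.congr fun a => ?_
  rw [List.headD_eq_head?_getD, List.head?_drop, List.getD_eq_getElem?_getD]

@[fun_prop]
theorem PT.flatten {f : α → List (List β)} (hf : PT f) : PT fun a => (f a).flatten := by
  have h : PT fun a => (f a).foldr (fun b s => b ++ s) [] := by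
    refine PT.foldr hf (.const _) (by fun_prop) hf.pb fun a s b hb => ?_
    have := esize_le_of_mem hb
    have := esize_append b s
    omega
  refine h.congr fun a => ?_
  induction f a with
  | nil => rfl
  | cons b l ih => rw [List.flatten_cons, List.foldr_cons, ih]

@[fun_prop]
theorem PT.flatMap {f : α → List β} {g : α → β → List γ} (hf : PT f)
    (hg : PT fun p : α × β => g p.1 p.2) : PT fun a => (f a).flatMap (g a) :=
  (hf.map hg).flatten

@[fun_prop]
theorem PT.nat_mul {f g : α → ℕ} (hf : PT f) (hg : PT g) : PT fun a => f a * g a := by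
  have h : PT fun a => ((List.replicate (f a) ()).flatMap
      fun _ => List.replicate (g a) ()).length := by
    refine PT.length (PT.flatMap (g := fun a _ => List.replicate (g a) ()) (by fun_prop) ?_)
    exact PT.replicate (PT.comp hg (by fun_prop)) (by fun_prop)
  exact h.congr fun a => by simp [List.length_flatMap]

theorem PT.poly_eval (p : ℕ[X]) : PT fun n : ℕ => p.eval n := by
  induction p using Polynomial.induction_on' with
  | add p q hp hq => exact (hp.nat_add hq).congr fun n => by simp
  | monomial k c =>
    have h : PT fun n : ℕ => n ^ k := by
      induction k with
      | zero => exact (PT.const 1).congr fun n => by simp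
      | succ k ih => exact (ih.nat_mul .id).congr fun n => pow_succ n k
    exact ((PT.const c).nat_mul h).congr fun n => by simp

@[fun_prop]
theorem PT.eval {f : α → ℕ} (hf : PT f) (p : ℕ[X]) : PT fun a => p.eval (f a) :=
  PT.comp (PT.poly_eval p) hf

@[fun_prop]
theorem PT.nat_min {f g : α → ℕ} (hf : PT f) (hg : PT g) : PT fun a => min (f a) (g a) :=
  ((hf.nat_sub (hf.nat_sub hg))).congr fun a => by omega

theorem PT.zipWith [Inhabited β] [Inhabited γ] {f : α → List β} {g : α → List γ}
    {h : α → β → γ → δ} (hf : PT f) (hg : PT g)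
    (hh : PT fun p : α × β × γ => h p.1 p.2.1 p.2.2) :
    PT fun a => List.zipWith (h a) (f a) (g a) := by
  -- The default entries are never reached, because the indices stay below both lengths.
  have : PT fun a => (List.range (min (f a).length (g a).length)).map fun i =>
      h a ((f a).getD i default) ((g a).getD i default) := by
    refine PT.map (g := fun a i => h a ((f a).getD i default) ((g a).getD i default))
      (by fun_prop) ?_
    refine PT.comp (f := fun p : α × ℕ =>
      (p.1, (f p.1).getD p.2 default, (g p.1).getD p.2 default)) hh ?_
    have hf' : PT fun p : α × ℕ => f p.1 := PT.comp hf (by fun_prop)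
    have hg' : PT fun p : α × ℕ => g p.1 := PT.comp hg (by fun_prop)
    fun_prop
  refine this.congr fun a => ?_
  refine List.ext_getElem (by simp) fun i h₁ h₂ => ?_
  simp only [List.length_zipWith, lt_min_iff] at h₁
  simp [List.getD_eq_getElem?_getD, h₁.1, h₁.2]

@[fun_prop]
theorem PT.zip [Inhabited β] [Inhabited γ] {f : α → List β} {g : α → List γ} (hf : PT f)
    (hg : PT g) : PT fun a => (f a).zip (g a) :=
  PT.zipWith (h := fun _ b c => (b, c)) hf hg (by fun_prop)

@[fun_prop]
theorem PT.bxor {f g : α → List Bool} (hf : PT f) (hg : PT g) : PT fun a => bxor (f a) (g a) :=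
  (PT.zipWith (h := fun _ b c => b.xor c) hf hg (by fun_prop)).congr fun _ => rfl

@[fun_prop]
theorem PT.bits_eq {f g : α → List Bool} (hf : PT f) (hg : PT g) :
    PT fun a => decide (f a = g a) := by
  have h : PT fun a => decide ((f a).length = (g a).length) &&
      (List.zipWith (fun b c => b == c) (f a) (g a)).all fun b => b :=
    PT.bool_and (by fun_prop) (PT.all (g := fun _ b => b)
      (PT.zipWith (h := fun _ b c => b == c) hf hg (by fun_prop)) (by fun_prop))
  refine h.congr fun a => ?_
  generalize f a = x
  generalize g a = y
  induction x generalizing y with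
  | nil => cases y <;> simp
  | cons b x ih =>
    cases y with
    | nil => simp
    | cons c y =>
      have := ih y
      simp only [List.length_cons, List.zipWith_cons_cons, List.all_cons, List.cons.injEq,
        Bool.decide_and, this, Nat.add_right_cancel_iff]
      cases b <;> cases c <;> simp

/-- Counting up to `n` while flipping a parity bit, and adding one to the half whenever the bit
falls back, yields both results with bounded growth per step. -/
theorem PT.half_aux : PT fun n : ℕ => ((n.testBit 0, n / 2) : Bool × ℕ) := by
  have h : PT fun n : ℕ => (List.replicate n ()).foldl
      (fun (s : Bool × ℕ) _ => (!s.1, bif s.1 then s.2 + 1 else s.2)) (false, 0) := by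
    refine PT.foldl (g := fun (_ : ℕ) (s : Bool × ℕ) _ => (!s.1, bif s.1 then s.2 + 1 else s.2))
      (by fun_prop) (by fun_prop) (by fun_prop) (.const 6) fun a s b _ => ?_
    obtain ⟨p, m⟩ := s
    have := esize_bool_le (!p)
    cases p <;> simp only [esize_pair, esize_nat, cond_true, cond_false] <;> omega
  refine h.congr fun n => ?_
  symm
  induction n with
  | zero => rfl
  | succ n ih =>
    rw [List.replicate_succ', List.foldl_append, ih]
    have h0 : n.testBit 0 = decide (n % 2 = 1) := Nat.testBit_zero n
    have h1 : (n + 1).testBit 0 = decide ((n + 1) % 2 = 1) := Nat.testBit_zero _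
    simp only [List.foldl_cons, List.foldl_nil, h0, h1]
    rcases Nat.mod_two_eq_zero_or_one n with h | h
    · simp [h]; omega
    · simp [h]; omega

@[fun_prop]
theorem PT.testBit_zero {f : α → ℕ} (hf : PT f) : PT fun a => (f a).testBit 0 :=
  (PT.comp PT.half_aux hf).fst

@[fun_prop]
theorem PT.half {f : α → ℕ} (hf : PT f) : PT fun a => f a / 2 :=
  (PT.comp PT.half_aux hf).snd

@[fun_prop]
theorem PT.natBits {w n : α → ℕ} (hw : PT w) (hn : PT n) : PT fun a => natBits (w a) (n a) := by
  have h : PT fun a => ((List.replicate (w a) ()).foldl (fun (s : ℕ × List Bool) _ =>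
      (s.1 / 2, s.1.testBit 0 :: s.2)) (n a, [])).2.reverse := by
    refine PT.reverse (PT.snd (PT.foldl (B := fun _ => 4) (f := fun a => List.replicate (w a) ())
      (g := fun _ (s : ℕ × List Bool) _ => (s.1 / 2, s.1.testBit 0 :: s.2))
      (by fun_prop) (by fun_prop) (by fun_prop) (.const 4) fun a s b _ => ?_))
    obtain ⟨m, l⟩ := s
    have := esize_bool_le (m.testBit 0)
    simp only [esize_pair, esize_nat, esize_cons]; omega
  refine h.congr fun a => ?_
  have key : ∀ (k n : ℕ) (l : List Bool), ((List.replicate k ()).foldl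
      (fun (s : ℕ × List Bool) _ => (s.1 / 2, s.1.testBit 0 :: s.2)) (n, l)).2.reverse
      = l.reverse ++ Ariadne.natBits k n := by
    intro k
    induction k with
    | zero => intro n l; simp [Ariadne.natBits]
    | succ k ih =>
      intro n l
      rw [List.replicate_succ, List.foldl_cons, ih]; simp [Ariadne.natBits]
  rw [key]; simp

-- Repeated halving; `n` rounds suffice, and the superfluous ones leave the state fixed once it is
-- below 2. The logarithm gives the number of coins that choose the random position in the hybrid
-- argument.
@[fun_prop]
theorem PT.log_two {f : α → ℕ} (hf : PT f) : PT fun a => Nat.log 2 (f a) := by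
  refine PT.comp (g := fun n => Nat.log 2 n) ?_ hf
  have h : PT fun n : ℕ => ((List.replicate n ()).foldl (fun (s : ℕ × ℕ) _ =>
      if s.1 < 2 then s else (s.1 / 2, s.2 + 1)) (n, 0)).2 := by
    refine PT.snd (PT.foldl (B := fun _ => 4) (g := fun _ (s : ℕ × ℕ) _ =>
      if s.1 < 2 then s else (s.1 / 2, s.2 + 1)) (by fun_prop) (by fun_prop) (by fun_prop)
      (.const 4) fun a s b _ => ?_)
    obtain ⟨m, l⟩ := s
    split_ifs <;> simp only [esize_pair, esize_nat]
    all_goals omega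
  refine h.congr fun n => ?_
  have key : ∀ k n w : ℕ, n ≤ k → ((List.replicate k ()).foldl (fun (s : ℕ × ℕ) _ =>
      if s.1 < 2 then s else (s.1 / 2, s.2 + 1)) (n, w)).2 = w + Nat.log 2 n := by
    intro k
    induction k with
    | zero => intro n w h; simp [Nat.le_zero.1 h]
    | succ k ih =>
      intro n w h
      rw [List.replicate_succ, List.foldl_cons]
      dsimp only
      split_ifs with h2
      · have : n ≤ 0 + 1 := by omega
        by_cases hk : n ≤ k
        · rw [ih _ _ hk]
        · obtain rfl : k = 0 := by omega
          obtain rfl : n = 1 := by omega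
          simp
      · have h3 : Nat.log 2 n = Nat.log 2 (n / 2) + 1 :=
          Nat.log_of_one_lt_of_le (by norm_num) (by omega)
        rw [ih _ _ (by omega), h3]; omega
  rw [key _ _ _ le_rfl, Nat.zero_add]

@[fun_prop]
theorem PT.option_getD {f : α → Option β} {d : α → β} (hf : PT f) (hd : PT d) :
    PT fun a => (f a).getD (d a) :=
  (PT.option_elim (g := fun _ b => b) hf hd (by fun_prop)).congr fun a => by cases f a <;> rfl

@[fun_prop]
theorem PT.findSome? {f : α → List β} {g : α → β → Option γ} (hf : PT f)
    (hg : PT fun p : α × β => g p.1 p.2) : PT fun a => (f a).findSome? (g a) := by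
  have h : PT fun a => ((f a).map (g a)).foldr
      (fun o s => o.elim s Option.some) none := by
    refine PT.foldr (f := fun a => (f a).map (g a))
      (g := fun _ o s => o.elim s Option.some) (hf.map hg) (by fun_prop)
      (by fun_prop) (hf.map hg).pb fun a s o ho => ?_
    have := esize_le_of_mem ho
    cases o <;> simp only [Option.elim] <;> omega
  refine h.congr fun a => ?_
  induction f a with
  | nil => rfl
  | cons b l ih =>
    rw [List.findSome?_cons, List.map_cons, List.foldr_cons, ← ih]
    cases g a b <;> rfl

@[fun_prop]
theorem PT.find? {f : α → List β} {g : α → β → Bool} (hf : PT f)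
    (hg : PT fun p : α × β => g p.1 p.2) : PT fun a => (f a).find? (g a) := by
  have h : PT fun a => (f a).findSome? fun b => bif g a b then Option.some b else none :=
    PT.findSome? (g := fun a b => bif g a b then Option.some b else none) hf (by fun_prop)
  refine h.congr fun a => ?_
  induction f a with
  | nil => rfl
  | cons b l ih =>
    rw [List.find?_cons, List.findSome?_cons, ← ih]
    cases g a b <;> rfl

@[fun_prop]
theorem PT.product {f : α → List β} {g : α → List γ} (hf : PT f) (hg : PT g) :
    PT fun a => (f a).product (g a) := by
  have h : PT fun p : α × β => g p.1 := PT.comp hg (by fun_prop)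
  exact PT.flatMap (g := fun a b => (g a).map (Prod.mk b)) hf (by fun_prop)

@[fun_prop]
theorem PT.nodup {f : α → List ℕ} (hf : PT f) : PT fun a => decide (f a).Nodup := by
  have h : PT fun a => (f a).all fun n =>
      decide (((f a).flatMap fun m => if m = n then [()] else []).length ≤ 1) := by
    refine PT.all (g := fun a n =>
      decide (((f a).flatMap fun m => if m = n then [()] else []).length ≤ 1)) hf ?_
    have hf' : PT fun p : α × ℕ => f p.1 := PT.comp hf (by fun_prop)
    fun_prop
  refine h.congr fun a => ?_
  have hc : ∀ (l : List ℕ) (n : ℕ),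
      (l.flatMap fun m => if m = n then [()] else []).length = l.count n := by
    intro l n
    induction l with
    | nil => rfl
    | cons m l ih =>
      rw [List.flatMap_cons, List.length_append, ih, List.count_cons]
      by_cases h : m = n <;> simp [h, Nat.add_comm]
  simp only [hc]
  rw [Bool.eq_iff_iff]
  simp only [decide_eq_true_eq, List.all_eq_true, List.nodup_iff_count_le_one]
  refine ⟨fun h n _ => h n, fun h n => ?_⟩
  by_cases hn : n ∈ f a
  · exact h n hn
  · simp [List.count_eq_zero_of_not_mem hn]

/-! ### Trees -/

theorem Tree.ofList_toList (x : Tree) : Tree.ofList x.toList = x := by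
  induction x with
  | nil => rfl
  | cons x y _ ih => simp [Tree.toList, Tree.ofList, ih]

@[fun_prop]
theorem PT.tree_toList {f : α → Tree} (hf : PT f) : PT fun a => (f a).toList :=
  hf.congr_out fun a => by
    change Tree.ofList ((f a).toList.map fun x => x) = f a
    rw [List.map_id', Tree.ofList_toList]

@[fun_prop]
theorem PT.tree_toBool {f : α → Tree} (hf : PT f) : PT fun a => (f a).toBool :=
  PT.cond_enc hf (.const true) (.const false)
    (fun a h => by change f a ≠ .nil at h; cases hb : f a <;> simp_all [Tree.toBool])
    (fun a h => by change f a = .nil at h; simp_all [Tree.toBool])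

@[fun_prop]
theorem PT.tree_toNat {f : α → Tree} (hf : PT f) : PT fun a => (f a).toNat :=
  hf.tree_toList.length

@[fun_prop]
theorem PT.tree_toBits {f : α → Tree} (hf : PT f) : PT fun a => (f a).toBits :=
  PT.map (g := fun _ x => Tree.toBool x) hf.tree_toList (by fun_prop)

@[fun_prop]
theorem PT.tree_toNats {f : α → Tree} (hf : PT f) : PT fun a => (f a).toNats :=
  PT.map (g := fun _ x => Tree.toNat x) hf.tree_toList (by fun_prop)

@[fun_prop]
theorem PT.tree_entry {f : α → Tree} {i : α → ℕ} (hf : PT f) (hi : PT i) :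
    PT fun a => (f a).entry (i a) := hf.tree_toList.getD hi (.const _)

@[fun_prop]
theorem PT.enc {f : α → β} (hf : PT f) : PT fun a => Enc.enc (f a) := hf.congr_out fun _ => rfl

@[fun_prop]
theorem PT.tree_ofList {f : α → List Tree} (hf : PT f) : PT fun a => Tree.ofList (f a) :=
  hf.congr_out fun a => by
    change _ = Tree.ofList ((f a).map fun x => x)
    rw [List.map_id']; rfl

@[fun_prop]
theorem PT.tree_ofNat {f : α → ℕ} (hf : PT f) : PT fun a => Tree.ofNat (f a) := hf.enc

@[fun_prop]
theorem PT.tree_ofBits {f : α → List Bool} (hf : PT f) : PT fun a => Tree.ofBits (f a) := hf.enc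

@[fun_prop]
theorem PT.tree_cons {f g : α → Tree} (hf : PT f) (hg : PT g) :
    PT fun a => Tree.cons (f a) (g a) := (hf.pair hg).congr_out fun _ => rfl

theorem Tree.toBool_ofBool (b : Bool) : (Tree.ofBool b).toBool = b := by cases b <;> rfl

theorem Tree.toList_ofList (l : List Tree) : (Tree.ofList l).toList = l := by
  induction l with
  | nil => rfl
  | cons x l ih => simp [Tree.ofList, Tree.toList, ih]

theorem Tree.toNat_ofNat (n : ℕ) : (Tree.ofNat n).toNat = n := by
  simp [Tree.ofNat, Tree.toNat, Tree.toList_ofList]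

theorem Tree.toBits_ofBits (l : List Bool) : (Tree.ofBits l).toBits = l := by
  simp [Tree.ofBits, Tree.toBits, Tree.toList_ofList, Function.comp_def, Tree.toBool_ofBool]

theorem Tree.toNats_ofNats (l : List ℕ) : (Tree.ofNats l).toNats = l := by
  simp [Tree.ofNats, Tree.toNats, Tree.toList_ofList, Function.comp_def, Tree.toNat_ofNat]

theorem Tree.entry_ofList (l : List Tree) (i : ℕ) : (Tree.ofList l).entry i = l.getD i .nil := by
  rw [Tree.entry, Tree.toList_ofList]

end

end Ariadne

namespace Ariadne
open Enc
open scoped BigOperators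

/-! ### Averages -/

theorem expect_prod {α β : Type*} [Fintype α] [Fintype β] (F : α × β → ℝ) :
    𝔼 x, F x = 𝔼 a, 𝔼 b, F (a, b) := by
  rw [← Finset.univ_product_univ, Finset.expect_product]

/-- Resampling one member of an independent family does not change its law. In the hybrid argument
this absorbs the challenge sample into the family. -/
theorem expect_update {ι β : Type*} [Fintype ι] [DecidableEq ι] [Fintype β] [Nonempty β] (i : ι)
    (F : (ι → β) → ℝ) : 𝔼 x, 𝔼 u, F (Function.update u i x) = 𝔼 u, F u := by
  have h : ∀ G : (ι → β) → ℝ, 𝔼 u, G u = 𝔼 a, 𝔼 r, G ((Equiv.funSplitAt i β).symm (a, r)) := by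
    intro G
    rw [Fintype.expect_equiv (Equiv.funSplitAt i β) G
      (fun p => G ((Equiv.funSplitAt i β).symm p)) (fun u => by rw [Equiv.symm_apply_apply]),
      expect_prod]
  rw [h F]
  refine Finset.expect_congr rfl fun x _ => ?_
  rw [h]
  have : ∀ a r, Function.update ((Equiv.funSplitAt i β).symm (a, r)) i x
      = (Equiv.funSplitAt i β).symm (x, r) := by
    intro a r
    funext j
    by_cases hj : j = i
    · subst hj; simp
    · simp [hj]
  simp only [this]
  rw [Fintype.expect_const]

/-- The average of `F` over the bit strings of length `n`. -/
noncomputable def avgBits (n : ℕ) (F : List Bool → ℝ) : ℝ := 𝔼 x : Fin n → Bool, F (List.ofFn x)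

theorem avgBits_congr {n : ℕ} {F G : List Bool → ℝ} (h : ∀ x, x.length = n → F x = G x) :
    avgBits n F = avgBits n G :=
  Finset.expect_congr rfl fun _ _ => h _ (List.length_ofFn)

theorem avgBits_const (n : ℕ) (c : ℝ) : (avgBits n fun _ => c) = c := Fintype.expect_const c

theorem avgBits_add (m n : ℕ) (F : List Bool → ℝ) :
    avgBits (m + n) F = avgBits m fun x => avgBits n fun y => F (x ++ y) := by
  unfold avgBits
  rw [Fintype.expect_equiv (Fin.appendEquiv m n).symm _
    (fun p : (Fin m → Bool) × (Fin n → Bool) => F (List.ofFn p.1 ++ List.ofFn p.2)), expect_prod]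
  intro x
  obtain ⟨p, rfl⟩ := (Fin.appendEquiv m n).surjective x
  rw [Equiv.symm_apply_apply]
  simp [Fin.appendEquiv, List.ofFn_fin_append]

theorem expect_funProd (m n : ℕ) (F : (Fin m → Fin n → Bool) → ℝ) :
    𝔼 u, F u = 𝔼 x : Fin (m * n) → Bool, F fun i j => x (finProdFinEquiv (i, j)) := by
  refine (Fintype.expect_equiv ((finProdFinEquiv.arrowCongr (Equiv.refl Bool)).symm.trans
    (Equiv.curry _ _ _)) _ _ fun x => ?_).symm
  rfl

/-- The `i`-th block of length `n`. -/
def chunk {α : Type} (n : ℕ) (l : List α) (i : ℕ) : List α := (l.drop (i * n)).take n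

theorem chunk_ofFn {α : Type} {m n : ℕ} (x : Fin (m * n) → α) (i : Fin m) :
    chunk n (List.ofFn x) i = List.ofFn fun j => x (finProdFinEquiv (i, j)) := by
  have hi : (i : ℕ) * n + n ≤ m * n := by
    have := Nat.mul_le_mul_right n i.2
    rwa [Nat.succ_mul] at this
  refine List.ext_getElem ?_ fun k h₁ h₂ => ?_
  · simp only [chunk, List.length_take, List.length_drop, List.length_ofFn]; omega
  · simp only [chunk, List.getElem_take, List.getElem_drop, List.getElem_ofFn]
    congr 1
    ext
    simp [finProdFinEquiv, Nat.mul_comm, Nat.add_comm]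

/-- A random tape cut into blocks is a family of independent tapes. The hypothesis says that `F`
looks at the first `m` blocks only, since beyond them `chunk` and the extension by `[]` need not
agree. -/
theorem avgBits_mul (m n : ℕ) (F : (ℕ → List Bool) → ℝ)
    (hF : ∀ f g : ℕ → List Bool, (∀ i < m, f i = g i) → F f = F g) :
    avgBits (m * n) (fun l => F (chunk n l))
      = 𝔼 u : Fin m → Fin n → Bool, F fun i => if h : i < m then List.ofFn (u ⟨i, h⟩) else [] := by
  rw [expect_funProd]
  refine Finset.expect_congr rfl fun x _ => hF _ _ fun i hi => ?_
  rw [dif_pos hi]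
  exact chunk_ofFn x ⟨i, hi⟩

/-! ### Binary representations -/

theorem natBits_length (w n : ℕ) : (natBits w n).length = w := by
  induction w generalizing n with
  | zero => rfl
  | succ w ih => simp [natBits, ih]

theorem bitsNat_natBits {w n : ℕ} (h : n < 2 ^ w) : bitsNat (natBits w n) = n := by
  induction w generalizing n with
  | zero => simp at h; simp [natBits, bitsNat, h]
  | succ w ih =>
    rw [natBits, bitsNat, ih (by omega), Nat.testBit_zero]
    rcases Nat.mod_two_eq_zero_or_one n with h | h <;> simp [h] <;> omega

theorem natBits_bitsNat (l : List Bool) : natBits l.length (bitsNat l) = l := by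
  induction l with
  | nil => rfl
  | cons b l ih =>
    have h2 : (b.toNat + 2 * bitsNat l) / 2 = bitsNat l := by
      have := Bool.toNat_lt b; omega
    have h1 : (b.toNat + 2 * bitsNat l).testBit 0 = b := by
      rw [Nat.testBit_zero]; cases b <;> simp [Nat.add_mod]
    simp [bitsNat, natBits, h1, h2, ih]

theorem natBits_inj {w m n : ℕ} (hm : m < 2 ^ w) (hn : n < 2 ^ w) :
    natBits w m = natBits w n ↔ m = n :=
  ⟨fun h => by rw [← bitsNat_natBits hm, h, bitsNat_natBits hn], fun h => by rw [h]⟩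

/-- The number below `m` with the given binary representation. -/
def findIndex (w m : ℕ) (x : List Bool) : Option ℕ :=
  (List.range m).find? fun i => decide (natBits w i = x)

theorem findIndex_natBits {w m i : ℕ} (hm : m ≤ 2 ^ w) (hi : i < m) :
    findIndex w m (natBits w i) = some i := by
  rw [findIndex, List.find?_range_eq_some]
  refine ⟨by simp, by simpa using hi, fun j hj => ?_⟩
  simp only [Bool.not_eq_eq_eq_not, Bool.not_true, decide_eq_false_iff_not]
  rw [natBits_inj (by omega) (by omega)]; omega

theorem findIndex_eq_some {w m i : ℕ} {x : List Bool} (h : findIndex w m x = some i) :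
    i < m ∧ natBits w i = x := by
  have h1 := List.find?_some h
  have h2 := List.mem_of_find?_eq_some h
  simp only [decide_eq_true_eq] at h1
  exact ⟨by simpa using h2, h1⟩

/-- Random choice with rejection: `m` need not be a power of two, so each index is hit by exactly
one of the `2 ^ w` strings, and the strings that name no index contribute 0. -/
theorem avgBits_findIndex {w m : ℕ} (hm : m ≤ 2 ^ w) (G : ℕ → ℝ) :
    avgBits w (fun x => (findIndex w m x).elim 0 G) = (∑ i ∈ Finset.range m, G i) / 2 ^ w := by
  have h1 : ∀ x : Fin w → Bool, (findIndex w m (List.ofFn x)).elim 0 G =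
      ∑ i ∈ Finset.range m, if x = fun k => (natBits w i).get (k.cast (natBits_length w i).symm)
        then G i else 0 := by
    intro x
    have h2 : ∀ i, (x = fun k => (natBits w i).get (k.cast (natBits_length w i).symm)) ↔
        natBits w i = List.ofFn x := by
      intro i
      constructor
      · rintro rfl
        refine List.ext_getElem (by simp [natBits_length]) fun k h₁ h₂ => by simp
      · intro h
        funext k
        simp [h]
    simp only [h2]
    cases hf : findIndex w m (List.ofFn x) with
    | none =>
      symm
      refine Finset.sum_eq_zero fun i hi => if_neg fun hx => ?_
      rw [← hx, findIndex_natBits hm (Finset.mem_range.1 hi)] at hf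
      cases hf
    | some i =>
      obtain ⟨hi, hx⟩ := findIndex_eq_some hf
      rw [Finset.sum_eq_single i, if_pos hx]
      · rfl
      · intro j hj hji
        refine if_neg fun h => hji ?_
        rw [← hx] at h
        have := Finset.mem_range.1 hj
        exact (natBits_inj (by omega) (by omega)).1 h
      · intro h; exact absurd (Finset.mem_range.2 hi) h
  unfold avgBits
  simp only [h1]
  rw [Fintype.expect_eq_sum_div_card, Finset.sum_comm]
  simp

/-- The indicator of a Boolean. -/
def ind (b : Bool) : ℝ := if b then 1 else 0

/-! ### Probability mass functions -/

theorem toReal_bind_uniform {Ω α : Type} [Fintype Ω] [Nonempty Ω] (f : Ω → PMF α) (b : α) :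
    (((PMF.uniformOfFintype Ω).bind f) b).toReal = 𝔼 ω, ((f ω) b).toReal := by
  rw [PMF.bind_apply, tsum_fintype, ENNReal.toReal_sum, Fintype.expect_eq_sum_div_card,
    Finset.sum_div]
  · refine Finset.sum_congr rfl fun ω _ => ?_
    rw [PMF.uniformOfFintype_apply, ENNReal.toReal_mul, ENNReal.toReal_inv]
    simp [div_eq_inv_mul]
  · intro ω _
    exact ENNReal.mul_ne_top (PMF.apply_ne_top _ _) (PMF.apply_ne_top _ _)

theorem toReal_pure (b : Bool) : ((PMF.pure b) true).toReal = ind b := by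
  cases b <;> simp [ind]

theorem toReal_bind_randomBits {α : Type} (n : ℕ) (f : List Bool → PMF α) (b : α) :
    (((randomBits n).bind f) b).toReal = avgBits n fun x => ((f x) b).toReal := by
  rw [randomBits, PMF.bind_map, toReal_bind_uniform]; rfl

theorem toReal_map_uniform {Ω : Type} [Fintype Ω] [Nonempty Ω] (f : Ω → Bool) :
    (((PMF.uniformOfFintype Ω).map f) true).toReal = 𝔼 ω, ind (f ω) := by
  rw [← PMF.bind_pure_comp, toReal_bind_uniform]
  exact Finset.expect_congr rfl fun ω _ => toReal_pure _

theorem toReal_map_randomBits (n : ℕ) (f : List Bool → Bool) :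
    (((randomBits n).map f) true).toReal = avgBits n fun x => ind (f x) := by
  rw [randomBits, PMF.map_comp, toReal_map_uniform]; rfl

theorem randomBits_map_equiv {Ω : Type} [Fintype Ω] [Nonempty Ω] {n : ℕ} (e : (Fin n → Bool) ≃ Ω) :
    (PMF.uniformOfFintype (Fin n → Bool)).map e = PMF.uniformOfFintype Ω := by
  ext ω
  rw [PMF.map_apply, tsum_eq_single (e.symm ω)]
  · simp [Fintype.card_congr e]
  · intro x hx
    rw [if_neg]
    rintro rfl
    simp at hx

theorem Distinguisher.accept_uniform (D : Distinguisher) {X : ℕ → PMF Tree} {κ : ℕ} {Ω : Type}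
    [Fintype Ω] [Nonempty Ω] {t : Ω → Tree} (hX : X κ = (PMF.uniformOfFintype Ω).map t) :
    D.accept X κ = 𝔼 ω, avgBits (D.coins.eval κ) fun r =>
      ind (D.run (.ofList [.ofNat κ, .ofBits r, t ω])).toBool := by
  rw [Distinguisher.accept, hX, PMF.bind_map, toReal_bind_uniform]
  exact Finset.expect_congr rfl fun ω _ => toReal_map_randomBits _ _

/-! ### Negligible functions -/

theorem Negligible.add {f g : ℕ → ℝ} (hf : Negligible f) (hg : Negligible g) :
    Negligible fun κ => f κ + g κ := Asymptotics.SuperpolynomialDecay.add hf hg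

theorem Negligible.of_abs_le {f g : ℕ → ℝ} (hf : Negligible f) (h : ∀ κ, |g κ| ≤ |f κ|) :
    Negligible g := Asymptotics.SuperpolynomialDecay.trans_abs_le hf h

theorem Negligible.of_eq {f g : ℕ → ℝ} (hf : Negligible f) (h : ∀ κ, g κ = f κ) :
    Negligible g := hf.of_abs_le fun κ => by rw [h]

theorem natCast_eval (p : ℕ[X]) (n : ℕ) :
    ((p.eval n : ℕ) : ℝ) = (p.map (Nat.castRingHom ℝ)).eval (n : ℝ) := by
  rw [eval_natCast_map]; rfl

theorem PB.exists_poly {f : ℕ → ℕ} (hf : PB f) : ∃ p : ℕ[X], ∀ κ, f κ ≤ p.eval κ := by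
  obtain ⟨p, hp⟩ := hf
  refine ⟨p.comp (2 * X + 1), fun κ => (hp κ).trans ?_⟩
  rw [esize_nat]; simp

theorem Negligible.mul_pb {f : ℕ → ℝ} {g : ℕ → ℕ} (hf : Negligible f) (hg : PB g) :
    Negligible fun κ => f κ * g κ := by
  obtain ⟨p, hp⟩ := hg.exists_poly
  refine Negligible.of_abs_le (f := fun κ => f κ * (p.map (Nat.castRingHom ℝ)).eval (κ : ℝ))
    (Asymptotics.SuperpolynomialDecay.mul_polynomial hf _) fun κ => ?_
  rw [← natCast_eval, abs_mul, abs_mul, Nat.abs_cast, Nat.abs_cast]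
  exact mul_le_mul_of_nonneg_left (by exact_mod_cast hp κ) (abs_nonneg _)

theorem negligible_two_pow : Negligible fun κ => (1 / 2 : ℝ) ^ κ := by
  intro n
  have := tendsto_pow_const_mul_const_pow_of_lt_one n (r := (1 / 2 : ℝ)) (by norm_num) (by norm_num)
  exact this

/-! ### Indistinguishability -/

theorem PT.polyTimeNat {f : ℕ → ℕ} (hf : PolyTimeNat f) : PT f := by
  obtain ⟨F, hF, h⟩ := hf
  exact hF.pt.congr_enc Enc.enc (fun _ => rfl) fun κ => (h κ).symm

theorem Indistinguishable.negligible_test {X Y : ℕ → PMF Tree} (h : Indistinguishable X Y)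
    {ΩX ΩY : ℕ → Type} [∀ κ, Fintype (ΩX κ)] [∀ κ, Nonempty (ΩX κ)] [∀ κ, Fintype (ΩY κ)]
    [∀ κ, Nonempty (ΩY κ)] {tX : ∀ κ, ΩX κ → Tree} {tY : ∀ κ, ΩY κ → Tree}
    (hX : ∀ κ, X κ = (PMF.uniformOfFintype (ΩX κ)).map (tX κ))
    (hY : ∀ κ, Y κ = (PMF.uniformOfFintype (ΩY κ)).map (tY κ))
    {c : ℕ → ℕ} (hc : PT c) {T : ℕ × List Bool × Tree → Bool} (hT : PT T) :
    Negligible fun κ => (𝔼 ω, avgBits (c κ) fun r => ind (T (κ, r, tX κ ω)))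
      - 𝔼 ω, avgBits (c κ) fun r => ind (T (κ, r, tY κ ω)) := by
  obtain ⟨p, hp⟩ := hc.pb_nat.exists_poly
  -- A distinguisher has a polynomial number of coins, whereas `c` is only polynomially bounded; the
  -- surplus coins are cut off and average out.
  let D : Distinguisher :=
    { coins := p
      run := fun x => enc (T ((x.entry 0).toNat, ((x.entry 1).toBits).take (c (x.entry 0).toNat),
        x.entry 2))
      polyTime := by
        have : PT fun x : Tree => c (x.entry 0).toNat := PT.comp hc (by fun_prop)
        exact PT.enc (PT.comp hT (by fun_prop)) }
  refine (h D).of_eq fun κ => ?_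
  rw [D.accept_uniform (hX κ), D.accept_uniform (hY κ)]
  have key : ∀ x : Tree, (avgBits (c κ) fun r => ind (T (κ, r, x))) =
      avgBits (D.coins.eval κ) fun r =>
        ind (D.run (.ofList [.ofNat κ, .ofBits r, x])).toBool := by
    intro x
    have h1 : ∀ r, (D.run (.ofList [.ofNat κ, .ofBits r, x])).toBool = T (κ, r.take (c κ), x) := by
      intro r
      simp only [D, Tree.entry_ofList]
      simp only [List.getD_cons_zero, List.getD_cons_succ, Tree.toNat_ofNat, Tree.toBits_ofBits]
      exact Tree.toBool_ofBool _
    simp only [h1]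
    obtain ⟨d, hd⟩ := Nat.exists_eq_add_of_le (hp κ)
    change _ = avgBits (p.eval κ) _
    rw [hd, avgBits_add]
    refine avgBits_congr fun r hr => ?_
    rw [← avgBits_const d (ind _)]
    refine avgBits_congr fun y _ => ?_
    rw [← hr, List.take_left]
  simp only [key]

end Ariadne

/-! ### The hybrid argument for many independent samples -/

namespace Ariadne
open Enc
open scoped BigOperators

@[fun_prop]
theorem PT.chunk {α β : Type} [Enc α] [Enc β] {n i : α → ℕ} {l : α → List β} (hn : PT n) (hl : PT l)
    (hi : PT i) : PT fun a => chunk (n a) (l a) (i a) := by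
  unfold Ariadne.chunk; fun_prop

-- Pointers are looked up by search because the unary form of `bitsNat x` can be exponentially
-- larger than `x`; the search tries only the `m` admissible values.
@[fun_prop]
theorem PT.findIndex {α : Type} [Enc α] {w m : α → ℕ} {x : α → List Bool} (hw : PT w) (hm : PT m)
    (hx : PT x) : PT fun a => findIndex (w a) (m a) (x a) := by
  have hw' : PT fun p : α × ℕ => w p.1 := PT.comp hw (by fun_prop)
  have hx' : PT fun p : α × ℕ => x p.1 := PT.comp hx (by fun_prop)
  exact PT.find? (g := fun a i => decide (Ariadne.natBits (w a) i = x a)) (by fun_prop)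
      (by fun_prop)

/-- Extend a finite family of bit strings by empty strings. -/
def blocks {m n : ℕ} (u : Fin m → Fin n → Bool) (i : ℕ) : List Bool :=
  if h : i < m then List.ofFn (u ⟨i, h⟩) else []

theorem blocks_update {m n : ℕ} (u : Fin m → Fin n → Bool) (i : Fin m) (x : Fin n → Bool) (j : ℕ) :
    blocks (Function.update u i x) j = if j = i then List.ofFn x else blocks u j := by
  unfold blocks
  by_cases hj : j = i
  · subst hj; simp
  · by_cases h : j < m
    · have : (⟨j, h⟩ : Fin m) ≠ i := fun h' => hj (by rw [← h'])
      simp [h, hj, Function.update_of_ne this]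
    · simp [h, hj]

theorem avgBits_chunk (m n : ℕ) (F : (ℕ → List Bool) → ℝ)
    (hF : ∀ f g : ℕ → List Bool, (∀ i < m, f i = g i) → F f = F g) :
    avgBits (m * n) (fun l => F (chunk n l)) = 𝔼 u : Fin m → Fin n → Bool, F (blocks u) :=
  avgBits_mul m n F hF

section

variable (κ m cX cY c : ℕ) (fX fY : ℕ × List Bool → Tree) (T : ℕ × List Bool × List Tree → Bool)

/-- The test applied to a list of samples, whose first `i` entries are replaced. -/
noncomputable def hybrid (i : ℕ) : ℝ :=
  𝔼 u : Fin m → Fin cX → Bool, 𝔼 v : Fin m → Fin cY → Bool, avgBits c fun r =>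
    ind (T (κ, r, (List.range m).map fun j =>
      if j < i then fY (κ, blocks v j) else fX (κ, blocks u j)))

/-- The hybrid test on a single sample: it is put at a random position. -/
def hybridTest (w : ℕ) (l : List Bool) (x : Tree) : Bool :=
  (findIndex w m (l.take w)).elim false fun i =>
    T (κ, ((l.drop w).drop (m * cX)).drop (m * cY), (List.range m).map fun j =>
      if j < i then fY (κ, chunk cY (((l.drop w).drop (m * cX)).take (m * cY)) j)
      else if j = i then x else fX (κ, chunk cX ((l.drop w).take (m * cX)) j))

/-- The tape consists of the position, the randomness for all samples of each kind, and the coins of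
the test. A rejected position answers `false` and contributes nothing, so every position has weight
exactly `1 / 2 ^ w`. -/
theorem avgBits_hybridTest {w : ℕ} (hw : m ≤ 2 ^ w) (x : Tree) :
    (avgBits (w + (m * cX + (m * cY + c))) fun l => ind (hybridTest κ m cX cY fX fY T w l x)) =
      (∑ i ∈ Finset.range m, 𝔼 u : Fin m → Fin cX → Bool, 𝔼 v : Fin m → Fin cY → Bool,
        avgBits c fun r => ind (T (κ, r, (List.range m).map fun j =>
          if j < i then fY (κ, blocks v j) else if j = i then x else fX
              (κ, blocks u j)))) / 2 ^ w := by
  rw [← avgBits_findIndex hw, avgBits_add]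
  refine avgBits_congr fun l₁ h₁ => ?_
  simp only [hybridTest, ← h₁, List.take_left, List.drop_left]
  rw [h₁]
  cases findIndex w m l₁ with
  | none => simp only [Option.elim]; exact avgBits_const _ _
  | some i =>
    simp only [Option.elim]
    have hs : ∀ {α : Type} (f g : ℕ → α), (∀ j < m, f j = g j) →
        (List.range m).map f = (List.range m).map g := fun f g h =>
      List.map_congr_left fun j hj => h j (List.mem_range.1 hj)
    rw [avgBits_add, ← avgBits_chunk m cX fun U => 𝔼 v : Fin m → Fin cY → Bool,
        avgBits c fun r => ind (T (κ, r, (List.range m).map fun j =>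
          if j < i then fY (κ, blocks v j) else if j = i then x else fX (κ, U j)))]
    · refine avgBits_congr fun l₂ h₂ => ?_
      simp only [← h₂, List.take_left, List.drop_left]
      rw [avgBits_add, ← avgBits_chunk m cY fun V =>
        avgBits c fun r => ind (T (κ, r, (List.range m).map fun j =>
          if j < i then fY (κ, V j) else if j = i then x else fX (κ, chunk cX l₂ j)))]
      · refine avgBits_congr fun l₃ h₃ => ?_
        simp only [← h₃, List.take_left, List.drop_left]
      · intro f g h
        have := hs (fun j => if j < i then fY (κ, f j) else if j = i then x else
          fX (κ, chunk cX l₂ j)) (fun j => if j < i then fY (κ, g j) else if j = i then x else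
          fX (κ, chunk cX l₂ j)) fun j hj => by rw [h j hj]
        simp only [this]
    · intro f g h
      have : ∀ v : Fin m → Fin cY → Bool, _ := fun v =>
        hs (fun j => if j < i then fY (κ, blocks v j) else if j = i then x else
          fX (κ, f j)) (fun j => if j < i then fY (κ, blocks v j) else if j = i then x else
          fX (κ, g j)) fun j hj => by rw [h j hj]
      simp only [this]

/-- A sample of the first kind at position `i` joins the entries from `i` on, which gives hybrid
`i`; `expect_update` merges it with the family `u`. -/
theorem expect_hybridTest_left {w : ℕ} (hw : m ≤ 2 ^ w) :
    (𝔼 ω : Fin cX → Bool, avgBits (w + (m * cX + (m * cY + c))) fun l =>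
      ind (hybridTest κ m cX cY fX fY T w l (fX (κ, List.ofFn ω)))) =
      (∑ i ∈ Finset.range m, hybrid κ m cX cY c fX fY T i) / 2 ^ w := by
  simp only [avgBits_hybridTest κ m cX cY c fX fY T hw]
  rw [← Finset.expect_div, Finset.expect_sum_comm]
  congr 1
  refine Finset.sum_congr rfl fun i hi => ?_
  rw [hybrid, ← expect_update (⟨i, Finset.mem_range.1 hi⟩ : Fin m)]
  refine Finset.expect_congr rfl fun ω _ => Finset.expect_congr rfl fun u _ =>
    Finset.expect_congr rfl fun v _ => avgBits_congr fun r _ => ?_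
  congr 5
  funext j
  rw [blocks_update]
  dsimp only
  split_ifs <;> rfl

/-- A sample of the second kind at position `i` joins the entries below `i`, which shifts the hybrid
index by one. -/
theorem expect_hybridTest_right {w : ℕ} (hw : m ≤ 2 ^ w) :
    (𝔼 ω : Fin cY → Bool, avgBits (w + (m * cX + (m * cY + c))) fun l =>
      ind (hybridTest κ m cX cY fX fY T w l (fY (κ, List.ofFn ω)))) =
      (∑ i ∈ Finset.range m, hybrid κ m cX cY c fX fY T (i + 1)) / 2 ^ w := by
  simp only [avgBits_hybridTest κ m cX cY c fX fY T hw]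
  rw [← Finset.expect_div, Finset.expect_sum_comm]
  congr 1
  refine Finset.sum_congr rfl fun i hi => ?_
  rw [hybrid, Finset.expect_comm]
  refine Finset.expect_congr rfl fun u _ => ?_
  rw [← expect_update (⟨i, Finset.mem_range.1 hi⟩ : Fin m)]
  refine Finset.expect_congr rfl fun ω _ =>
    Finset.expect_congr rfl fun v _ => avgBits_congr fun r _ => ?_
  congr 5
  funext j
  rw [blocks_update]
  dsimp only
  rcases lt_trichotomy j i with h | h | h
  · simp [h, h.ne, h.trans (Nat.lt_succ_self i)]
  · simp [h]
  · simp [not_lt.2 h.le, h.ne', show ¬ j < i + 1 by omega]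

end

/-- Polynomially many independent samples of two indistinguishable and samplable distributions are
indistinguishable. -/
theorem Indistinguishable.negligible_samples {X Y : ℕ → PMF Tree} (h : Indistinguishable X Y)
    {cX cY m c : ℕ → ℕ} {fX fY : ℕ × List Bool → Tree}
    (hX : ∀ κ, X κ = (randomBits (cX κ)).map fun x => fX (κ, x))
    (hY : ∀ κ, Y κ = (randomBits (cY κ)).map fun x => fY (κ, x))
    (hcX : PT cX) (hcY : PT cY) (hm : PT m) (hc : PT c) (hfX : PT fX) (hfY : PT fY)
    {T : ℕ × List Bool × List Tree → Bool} (hT : PT T) :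
    Negligible fun κ =>
      (𝔼 u : Fin (m κ) → Fin (cX κ) → Bool, avgBits (c κ) fun r =>
        ind (T (κ, r, (List.range (m κ)).map fun j => fX (κ, blocks u j))))
      - 𝔼 u : Fin (m κ) → Fin (cY κ) → Bool, avgBits (c κ) fun r =>
        ind (T (κ, r, (List.range (m κ)).map fun j => fY (κ, blocks u j))) := by
  -- Enough bits to name all positions, but so few that `2 ^ w` is at most `2 * m + 2`; the inverse
  -- of the weight of a position then stays polynomial.
  set w : ℕ → ℕ := fun κ => Nat.log 2 (m κ) + 1 with hwdef
  have hw : PT w := by fun_prop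
  have hmw : ∀ κ, m κ ≤ 2 ^ w κ := fun κ => (Nat.lt_pow_succ_log_self (by norm_num) _).le
  have hwm : ∀ κ, 2 ^ w κ ≤ 2 * m κ + 2 := by
    intro κ
    rcases Nat.eq_zero_or_pos (m κ) with h0 | h0
    · simp [w, h0]
    · have := Nat.pow_log_le_self 2 h0.ne'
      simp only [w, pow_succ]; omega
  have hT' : PT fun x : ℕ × List Bool × Tree =>
      hybridTest x.1 (m x.1) (cX x.1) (cY x.1) fX fY T (w x.1) x.2.1 x.2.2 := by
    unfold hybridTest
    refine PT.option_elim (g := fun (x : ℕ × List Bool × Tree) i =>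
      T (x.1, ((x.2.1.drop (w x.1)).drop (m x.1 * cX x.1)).drop (m x.1 * cY x.1),
        (List.range (m x.1)).map fun j =>
        if j < i then fY (x.1, chunk (cY x.1)
          (((x.2.1.drop (w x.1)).drop (m x.1 * cX x.1)).take (m x.1 * cY x.1)) j)
        else if j = i then x.2.2 else fX (x.1, chunk (cX x.1)
          ((x.2.1.drop (w x.1)).take (m x.1 * cX x.1)) j))) (by fun_prop) (.const _) ?_
    fun_prop
  have hcoins : PT fun κ => w κ + (m κ * cX κ + (m κ * cY κ + c κ)) := by fun_prop
  have key := h.negligible_test (ΩX := fun κ => Fin (cX κ) → Bool) (ΩY := fun κ => Fin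
      (cY κ) → Bool)
    (tX := fun κ ω => fX (κ, List.ofFn ω)) (tY := fun κ ω => fY (κ, List.ofFn ω))
    (fun κ => by rw [hX, randomBits, PMF.map_comp]; rfl)
    (fun κ => by rw [hY, randomBits, PMF.map_comp]; rfl) hcoins hT'
  have hpb : PB fun κ => 2 ^ w κ :=
    (((PB.const 2).mul hm.pb_nat).add (.const 2)).mono hwm
  -- The sums over positions telescope to the difference of the extreme hybrids divided by `2 ^ w`,
  -- and the polynomially bounded factor `2 ^ w` is multiplied back.
  refine (key.mul_pb hpb).of_eq fun κ => ?_
  have e1 := expect_hybridTest_left κ (m κ) (cX κ) (cY κ) (c κ) fX fY T (hmw κ)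
  have e2 := expect_hybridTest_right κ (m κ) (cX κ) (cY κ) (c κ) fX fY T (hmw κ)
  dsimp only at e1 e2 ⊢
  rw [e1, e2, ← sub_div, ← Finset.sum_sub_distrib, Finset.sum_range_sub']
  push_cast
  rw [div_mul_cancel₀ _ (by positivity)]
  have h0 : hybrid κ (m κ) (cX κ) (cY κ) (c κ) fX fY T 0 = 𝔼 u : Fin (m κ) → Fin (cX κ) → Bool,
      avgBits (c κ) fun r =>
        ind (T (κ, r, (List.range (m κ)).map fun j => fX (κ, blocks u j))) := by
    rw [hybrid]
    simp only [Nat.not_lt_zero, if_false]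
    exact Finset.expect_congr rfl fun u _ => Fintype.expect_const _
  have h1 : hybrid κ (m κ) (cX κ) (cY κ) (c κ) fX fY T (m κ) =
      𝔼 u : Fin (m κ) → Fin (cY κ) → Bool, avgBits (c κ) fun r =>
        ind (T (κ, r, (List.range (m κ)).map fun j => fY (κ, blocks u j))) := by
    rw [hybrid]
    have : ∀ (u : Fin (m κ) → Fin (cX κ) → Bool) (v : Fin (m κ) → Fin (cY κ) → Bool),
        ((List.range (m κ)).map fun j => if j < m κ then fY (κ, blocks v j) else
          fX (κ, blocks u j)) = (List.range (m κ)).map fun j => fY (κ, blocks v j) := fun u v =>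
      List.map_congr_left fun j hj => if_pos (List.mem_range.1 hj)
    simp only [this]
    exact Fintype.expect_const _
  rw [h0, h1]

end Ariadne

namespace Ariadne
open Enc

/-! ### The protocol as a function of the pads and MAC keys -/

/-- The packet that is forwarded, if there is one. -/
def Outcome.forwarded : Outcome → Option Packet
  | .forward pkt => some pkt
  | _ => none

namespace Scheme

variable (S : Scheme) (κ : ℕ)

/-- Processing under the pseudo-random string `pad` and the MAC key `mk`. -/
def openAt (v : ℕ) (pad mk : List Bool) (p : ℕ) (body : List Bool) : Option Outcome :=
  let c := S.getSlot κ p body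
  let l := (S.pattern κ).length
  if c.take l = bxor (S.pattern κ) (pad.take (S.elemLen κ)) then
    let r := bxor c (pad.take (S.elemLen κ))
    let tag := r.drop (S.elemLen κ - κ)
    let X := S.putSlot κ p (r.take (S.elemLen κ - κ) ++ List.replicate κ false) body
    if S.mac κ mk X = tag then
      let addr := (r.drop l).take (S.addrLen κ)
      let ptr := (r.drop (l + S.addrLen κ)).take (S.ptrLen κ)
      let Y := bxor X (pad.drop (S.elemLen κ))
      if addr = natBits (S.addrLen κ) v then some (.deliver (Y.drop (S.vecLen κ)))
      else some (.forward ⟨addr, ptr, Y⟩)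
    else none
  else none

theorem openWith_eq_openAt (v : ℕ) (k : List Bool) (t : ℕ) (pkt : Packet) :
    S.openWith κ v k t pkt = S.openAt κ v (S.prg κ (S.encKey κ k t)) (S.macKey κ k t)
      (bitsNat pkt.ptr) pkt.body := rfl

/-- Processing of a packet, where `P s v t` and `M s v t` are the pseudo-random string and the MAC
key that `v` has in the line of its table for source `s` and packet index `t`. -/
def processPad (P M : ℕ → ℕ → ℕ → List Bool) (v : ℕ) (pkt : Packet) : Outcome :=
  (findIndex (S.ptrLen κ) (S.slots κ) pkt.ptr).elim .drop fun p =>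
    if pkt.body.length = S.fullLen κ then
      ((List.product (List.range (S.nodes κ)) (List.range (S.window κ))).findSome?
        fun st => S.openAt κ v (P st.1 v st.2) (M st.1 v st.2) p pkt.body).getD .drop
    else .drop

def fillPad (pad : ℕ → List Bool) (R : List Bool) (h : Hop) : List Bool :=
  bxor (S.putSlot κ h.slot (S.elem κ h.next h.nextSlot (List.replicate κ false)) R)
    (((pad h.node).drop (S.elemLen κ)).take (S.vecLen κ))

def wrapPad (pad mk : ℕ → List Bool) (h : Hop) (X : List Bool) : List Bool :=
  S.putSlot κ h.slot
    (bxor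
      (S.elem κ h.next h.nextSlot
        (S.mac κ (mk h.node) (bxor X ((pad h.node).drop (S.elemLen κ)))))
      ((pad h.node).take (S.elemLen κ)))
    (bxor X ((pad h.node).drop (S.elemLen κ)))

/-- The packet for the given initial vector and list of slots. -/
def buildPad (pad mk : ℕ → List Bool) (path : List ℕ) (payload R : List Bool) (slots : List ℕ) :
    Packet :=
  let hs := hops (path.zip slots)
  ⟨natBits (S.addrLen κ) (path.headD 0), natBits (S.ptrLen κ) (slots.headD 0),
    hs.foldr (S.wrapPad κ pad mk) (hs.foldl (S.fillPad κ pad) R ++ S.padded κ payload)⟩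

/-- The packet that leaves the last of the given nodes. -/
def relayPad (P M : ℕ → ℕ → ℕ → List Bool) (l : List ℕ) (pkt : Packet) : Option Packet :=
  l.foldl (fun o v => o.elim none fun pkt => (S.processPad κ P M v pkt).forwarded) (some pkt)

end Scheme

open Classical in
/-- The packets that the challenger returns. -/
noncomputable def challengeViews (S : Scheme) (κ : ℕ) (g : Game) (P M : ℕ → ℕ → ℕ → List Bool)
    (j : ℕ) (c : Challenge) (b : Bool) (R₁ R₂ : List Bool) (σ₁ σ₂ : List ℕ) : List Tree :=
  if c.Valid S κ g j then
    let source₂ := bif b then c.source' else c.source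
    let before₂ := bif b then c.before' else c.before
    [linkView (S.relayPad κ P M (c.before ++ [j])
        (S.buildPad κ (fun v => P c.source v c.t) (fun v => M c.source v c.t)
          (c.before ++ j :: c.after) c.payload₁ R₁ σ₁)),
      linkView (S.relayPad κ P M (before₂ ++ [j])
        (S.buildPad κ (fun v => P source₂ v (c.t + 1)) (fun v => M source₂ v (c.t + 1))
          (before₂ ++ j :: c.after) c.payload₂ R₂ σ₂))]
  else [.nil, .nil]

/-- The game as a function of all random choices: it tells whether the adversary wins. If the router
is not a node of the network, the challenge cannot be valid, and a guess `true` is assumed. -/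
noncomputable def gameResult (S : Scheme) (g : Game) (A : Adversary) (κ : ℕ)
    (P M : ℕ → ℕ → ℕ → List Bool) (r : List Bool) (b : Bool) (R₁ R₂ : List Bool)
    (σ₁ σ₂ : List ℕ) : Bool :=
  let j := (A.router (view κ r [])).toNat
  if j < S.nodes κ then
    let oracle : Tree → Tree := fun x => (S.processPad κ P M j (.ofTree x)).toTree
    let answers₁ := interact (fun as => A.query₁ (view κ r as)) oracle (A.queries₁.eval κ) []
    let c := Challenge.ofTree (A.challenge (view κ r answers₁))
    let answers₂ := interact (fun as => A.query₂ (view κ r as)) oracle (A.queries₂.eval κ)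
      (answers₁ ++ challengeViews S κ g P M j c b R₁ R₂ σ₁ σ₂)
    (A.guess (view κ r answers₂)).toBool == b
  else b

/-- The entry for source `s`, node `v` and packet index `t` in a list of `N * N * q` strings. -/
def table (N q : ℕ) (L : List (List Bool)) (s v t : ℕ) : List Bool :=
  if s < N ∧ v < N ∧ t < q then L.getD ((s * N + v) * q + t) [] else []

/-! ### Its running time -/

/-- The parameters and the authentication code can be computed in polynomial time. -/
class Scheme.Feasible (S : Scheme) : Prop where
  nodes : PT S.nodes
  slots : PT S.slots
  addrLen : PT S.addrLen
  ptrLen : PT S.ptrLen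
  payloadLen : PT S.payloadLen
  window : PT S.window
  pattern : PT S.pattern
  mac : PT fun x : ℕ × List Bool × List Bool => S.mac x.1 x.2.1 x.2.2

instance : Enc Packet := ⟨Packet.toTree⟩
instance : Enc Outcome := ⟨Outcome.toTree⟩
instance : Enc Hop := ⟨fun h => enc (h.node, h.slot, h.next, h.nextSlot)⟩

section

variable {α β : Type} [Enc α] [Enc β]

theorem esize_bits_le (l : List Bool) : esize l ≤ 4 * l.length + 1 := by
  induction l with
  | nil => simp
  | cons b l ih =>
    have := esize_bool_le b
    simp only [esize_cons, List.length_cons]; omega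

theorem esize_packet (k : Packet) :
    esize k = esize k.addr + esize k.ptr + esize k.body + 4 := by
  change esize (k.addr, k.ptr, k.body, ()) = _
  simp only [esize_pair, show esize () = 1 from rfl]
  omega

@[fun_prop]
theorem PT.tree_fst {f : α → Tree} (hf : PT f) : PT fun a => (f a).fst := by
  have h : PT fun a => (f a).toList.headD .nil := by fun_prop
  exact h.congr fun a => by cases f a <;> rfl

@[fun_prop]
theorem PT.tree_snd {f : α → Tree} (hf : PT f) : PT fun a => (f a).snd := by
  have h : PT fun a => Tree.ofList (f a).toList.tail := by fun_prop
  refine h.congr fun a => ?_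
  cases f a with
  | nil => rfl
  | cons x y => exact (Tree.ofList_toList y).symm

@[fun_prop]
theorem PT.packet_mk {f g h : α → List Bool} (hf : PT f) (hg : PT g) (hh : PT h) :
    PT fun a => Packet.mk (f a) (g a) (h a) := by
  have : PT fun a => (f a, g a, h a, ()) := by fun_prop
  exact this.congr_out fun _ => rfl

theorem PT.packet_tuple {f : α → Packet} (hf : PT f) :
    PT fun a => ((f a).addr, (f a).ptr, (f a).body, ()) := hf.congr_out fun _ => rfl

@[fun_prop]
theorem PT.packet_ptr {f : α → Packet} (hf : PT f) : PT fun a => (f a).ptr :=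
  hf.packet_tuple.snd.fst

@[fun_prop]
theorem PT.packet_body {f : α → Packet} (hf : PT f) : PT fun a => (f a).body :=
  hf.packet_tuple.snd.snd.fst

@[fun_prop]
theorem PT.packet_toTree {f : α → Packet} (hf : PT f) : PT fun a => (f a).toTree :=
  hf.congr_out fun _ => rfl

@[fun_prop]
theorem PT.packet_ofTree {f : α → Tree} (hf : PT f) : PT fun a => Packet.ofTree (f a) := by
  unfold Packet.ofTree; fun_prop

@[fun_prop]
theorem PT.outcome_toTree {f : α → Outcome} (hf : PT f) : PT fun a => (f a).toTree :=
  hf.congr_out fun _ => rfl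

@[fun_prop]
theorem PT.outcome_forward {f : α → Packet} (hf : PT f) : PT fun a => Outcome.forward (f a) := by
  have : PT fun a => Tree.cons (.ofBool false) (f a).toTree := by fun_prop
  exact this.congr_out fun _ => rfl

@[fun_prop]
theorem PT.outcome_deliver {f : α → List Bool} (hf : PT f) :
    PT fun a => Outcome.deliver (f a) := by
  have : PT fun a => Tree.cons (.ofBool true) (.ofBits (f a)) := by fun_prop
  exact this.congr_out fun _ => rfl

@[fun_prop]
theorem PT.outcome_forwarded {f : α → Outcome} (hf : PT f) : PT fun a => (f a).forwarded := by
  have : PT fun a => bif (f a).toTree.toBool then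
      (bif (f a).toTree.fst.toBool then Tree.nil else Tree.cons (f a).toTree.snd .nil)
      else Tree.nil := by fun_prop
  exact this.congr_out fun a => by cases f a <;> rfl

@[fun_prop]
theorem PT.linkView {f : α → Option Packet} (hf : PT f) : PT fun a => linkView (f a) := by
  have : PT fun a => (f a).elim Tree.nil Packet.toTree :=
    PT.option_elim (g := fun _ k => k.toTree) hf (by fun_prop) (by fun_prop)
  exact this.congr fun a => by cases f a <;> rfl

@[fun_prop]
theorem PT.hop_mk {f g h k : α → ℕ} (hf : PT f) (hg : PT g) (hh : PT h) (hk : PT k) :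
    PT fun a => Hop.mk (f a) (g a) (h a) (k a) := by
  have : PT fun a => (f a, g a, h a, k a) := by fun_prop
  exact this.congr_out fun _ => rfl

theorem PT.hop_tuple {f : α → Hop} (hf : PT f) :
    PT fun a => ((f a).node, (f a).slot, (f a).next, (f a).nextSlot) := hf.congr_out fun _ => rfl

@[fun_prop]
theorem PT.hop_node {f : α → Hop} (hf : PT f) : PT fun a => (f a).node := hf.hop_tuple.fst

@[fun_prop]
theorem PT.hop_slot {f : α → Hop} (hf : PT f) : PT fun a => (f a).slot := hf.hop_tuple.snd.fst

@[fun_prop]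
theorem PT.hop_next {f : α → Hop} (hf : PT f) : PT fun a => (f a).next := hf.hop_tuple.snd.snd.fst

@[fun_prop]
theorem PT.hop_nextSlot {f : α → Hop} (hf : PT f) : PT fun a => (f a).nextSlot :=
  hf.hop_tuple.snd.snd.snd

@[fun_prop]
theorem PT.hops {f : α → List (ℕ × ℕ)} (hf : PT f) : PT fun a => hops (f a) := by
  -- The default for entry `i + 1` is entry `i` itself, which makes the last node its own successor.
  have h : PT fun a => (List.range (f a).length).map fun i =>
      Hop.mk ((f a).getD i (0, 0)).1 ((f a).getD i (0, 0)).2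
        ((f a).getD (i + 1) ((f a).getD i (0, 0))).1
        ((f a).getD (i + 1) ((f a).getD i (0, 0))).2 := by
    have hf' : PT fun x : α × ℕ => f x.1 := PT.comp hf (by fun_prop)
    exact PT.map (g := fun a i => Hop.mk ((f a).getD i (0, 0)).1 ((f a).getD i (0, 0)).2
        ((f a).getD (i + 1) ((f a).getD i (0, 0))).1
        ((f a).getD (i + 1) ((f a).getD i (0, 0))).2) (by fun_prop) (by fun_prop)
  refine h.congr fun a => ?_
  generalize f a = l
  induction l with
  | nil => rfl
  | cons a l ih =>
    cases l with
    | nil => rfl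
    | cons b l =>
      rw [Ariadne.hops, ih, List.length_cons (a := a), List.range_succ_eq_map, List.map_cons,
        List.map_map]
      rfl

@[fun_prop]
theorem PT.table {N q s v t : α → ℕ} {L : α → List (List Bool)} (hN : PT N) (hq : PT q) (hL : PT L)
    (hs : PT s) (hv : PT v) (ht : PT t) :
    PT fun a => table (N a) (q a) (L a) (s a) (v a) (t a) := by
  unfold Ariadne.table; fun_prop

/-- Provides the uniform bound on pads that the running-time estimates for relaying, building and
queries ask for. -/
theorem table_length_le (N q : ℕ) (L : List (List Bool)) (s v t : ℕ) :
    (table N q L s v t).length ≤ esize L := by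
  rw [table]
  split_ifs
  · rw [List.getD_eq_getElem?_getD]
    cases h : L[(s * N + v) * q + t]? with
    | none => simp
    | some x => exact (length_le_esize x).trans (esize_le_of_mem (List.mem_of_getElem? h))
  · simp

namespace Scheme

variable {S : Scheme}

theorem length_bxor_le (x y : List Bool) : (bxor x y).length ≤ y.length := by
  simp [bxor]

/-- The exclusive or truncates to the shorter string, so a processed body is no longer than the pad,
and address and pointer have fixed lengths. The bound does not involve the incoming packet; hence
neither relaying nor repeated queries make the data blow up. -/
theorem esize_openAt_le {κ v p : ℕ} {pad mk body : List Bool} {o : Outcome}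
    (h : S.openAt κ v pad mk p body = some o) :
    esize o ≤ 4 * (S.addrLen κ + S.ptrLen κ + pad.length) + 20 := by
  simp only [openAt] at h
  split_ifs at h
  · cases h
    generalize hY : bxor _ (pad.drop (S.elemLen κ)) = Y
    have h1 : Y.length ≤ pad.length := by
      rw [← hY]; exact (length_bxor_le _ _).trans (by simp)
    have h2 := esize_bits_le (Y.drop (S.vecLen κ))
    rw [List.length_drop] at h2
    change 3 + esize (Y.drop (S.vecLen κ)) + 1 ≤ _
    omega
  · cases h
    generalize hY : bxor _ (pad.drop (S.elemLen κ)) = Y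
    have h1 : Y.length ≤ pad.length := by
      rw [← hY]; exact (length_bxor_le _ _).trans (by simp)
    have h2 := esize_bits_le Y
    generalize hA : List.take (S.addrLen κ) _ = A
    generalize hB : List.take (S.ptrLen κ) _ = B
    have h3 : A.length ≤ S.addrLen κ := by rw [← hA]; simp
    have h4 : B.length ≤ S.ptrLen κ := by rw [← hB]; simp
    have h5 := esize_bits_le A
    have h6 := esize_bits_le B
    change 1 + esize (Packet.mk A B Y) + 1 ≤ _
    rw [esize_packet]
    dsimp only
    omega

theorem esize_processPad_le {κ v B : ℕ} {P M : ℕ → ℕ → ℕ → List Bool} {pkt : Packet}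
    (hB : ∀ s v t, (P s v t).length ≤ B) :
    esize (S.processPad κ P M v pkt) ≤ 4 * (S.addrLen κ + S.ptrLen κ + B) + 20 := by
  have hd : esize Outcome.drop = 1 := rfl
  rw [processPad]
  cases findIndex (S.ptrLen κ) (S.slots κ) pkt.ptr with
  | none => simp only [Option.elim]; omega
  | some p =>
    simp only [Option.elim]
    split_ifs
    · cases h : (List.product (List.range (S.nodes κ)) (List.range (S.window κ))).findSome?
        fun st => S.openAt κ v (P st.1 v st.2) (M st.1 v st.2) p pkt.body with
      | none => simp only [Option.getD]; omega
      | some o =>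
        obtain ⟨st, _, h'⟩ := List.exists_of_findSome?_eq_some h
        have h1 := esize_openAt_le h'
        have h2 := hB st.1 v st.2
        simp only [Option.getD]; omega
    · omega

theorem length_putSlot_le (κ p : ℕ) (r X : List Bool) :
    (S.putSlot κ p r X).length ≤ X.length + r.length := by
  simp only [putSlot, List.length_append, List.length_take, List.length_drop]; omega

variable [hS : S.Feasible] {κ : α → ℕ}

@[fun_prop]
theorem pt_nodes (hκ : PT κ) : PT fun a => S.nodes (κ a) := PT.comp hS.nodes hκ

@[fun_prop]
theorem pt_slots (hκ : PT κ) : PT fun a => S.slots (κ a) := PT.comp hS.slots hκ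

@[fun_prop]
theorem pt_addrLen (hκ : PT κ) : PT fun a => S.addrLen (κ a) := PT.comp hS.addrLen hκ

@[fun_prop]
theorem pt_ptrLen (hκ : PT κ) : PT fun a => S.ptrLen (κ a) := PT.comp hS.ptrLen hκ

@[fun_prop]
theorem pt_payloadLen (hκ : PT κ) : PT fun a => S.payloadLen (κ a) := PT.comp hS.payloadLen hκ

@[fun_prop]
theorem pt_window (hκ : PT κ) : PT fun a => S.window (κ a) := PT.comp hS.window hκ

@[fun_prop]
theorem pt_pattern (hκ : PT κ) : PT fun a => S.pattern (κ a) := PT.comp hS.pattern hκ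

@[fun_prop]
theorem pt_mac {k x : α → List Bool} (hκ : PT κ) (hk : PT k) (hx : PT x) :
    PT fun a => S.mac (κ a) (k a) (x a) :=
  PT.comp (f := fun a => (κ a, k a, x a)) hS.mac (by fun_prop)

@[fun_prop]
theorem pt_elemLen (hκ : PT κ) : PT fun a => S.elemLen (κ a) := by unfold elemLen; fun_prop

@[fun_prop]
theorem pt_vecLen (hκ : PT κ) : PT fun a => S.vecLen (κ a) := by unfold vecLen; fun_prop

@[fun_prop]
theorem pt_fullLen (hκ : PT κ) : PT fun a => S.fullLen (κ a) := by unfold fullLen; fun_prop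

@[fun_prop]
theorem pt_elem {m n : α → ℕ} {x : α → List Bool} (hκ : PT κ) (hm : PT m) (hn : PT n) (hx : PT x) :
    PT fun a => S.elem (κ a) (m a) (n a) (x a) := by unfold elem; fun_prop

@[fun_prop]
theorem pt_putSlot {p : α → ℕ} {x y : α → List Bool} (hκ : PT κ) (hp : PT p) (hx : PT x)
    (hy : PT y) : PT fun a => S.putSlot (κ a) (p a) (x a) (y a) := by unfold putSlot; fun_prop

@[fun_prop]
theorem pt_getSlot {p : α → ℕ} {x : α → List Bool} (hκ : PT κ) (hp : PT p) (hx : PT x) :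
    PT fun a => S.getSlot (κ a) (p a) (x a) := by unfold getSlot; fun_prop

@[fun_prop]
theorem pt_padded {x : α → List Bool} (hκ : PT κ) (hx : PT x) :
    PT fun a => S.padded (κ a) (x a) := by unfold padded; fun_prop

@[fun_prop]
theorem pt_openAt {v p : α → ℕ} {pad mk body : α → List Bool} (hκ : PT κ) (hv : PT v)
    (hpad : PT pad) (hmk : PT mk) (hp : PT p) (hbody : PT body) :
    PT fun a => S.openAt (κ a) (v a) (pad a) (mk a) (p a) (body a) := by
  unfold openAt; fun_prop

variable {P M : α → ℕ → ℕ → ℕ → List Bool}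

theorem pt_processPad {v : α → ℕ} {pkt : α → Packet} (hκ : PT κ)
    (hP : PT fun x : α × ℕ × ℕ × ℕ => P x.1 x.2.1 x.2.2.1 x.2.2.2)
    (hM : PT fun x : α × ℕ × ℕ × ℕ => M x.1 x.2.1 x.2.2.1 x.2.2.2)
    (hv : PT v) (hpkt : PT pkt) :
    PT fun a => S.processPad (κ a) (P a) (M a) (v a) (pkt a) := by
  unfold processPad
  refine PT.option_elim (by fun_prop) (by fun_prop) ?_
  have h1 : PT fun x : α × ℕ => (pkt x.1).body :=
    PT.comp (g := fun a => (pkt a).body) (by fun_prop) (by fun_prop)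
  have hκ1 : PT fun x : α × ℕ => κ x.1 := PT.comp hκ (by fun_prop)
  refine PT.ite (by fun_prop) (PT.option_getD ?_ (by fun_prop)) (by fun_prop)
  refine PT.findSome? (by fun_prop) ?_
  have hκ2 : PT fun x : (α × ℕ) × ℕ × ℕ => κ x.1.1 := PT.comp hκ (by fun_prop)
  have h2 : PT fun x : (α × ℕ) × ℕ × ℕ => (pkt x.1.1).body :=
    PT.comp (g := fun a => (pkt a).body) (by fun_prop) (by fun_prop)
  have hv2 : PT fun x : (α × ℕ) × ℕ × ℕ => v x.1.1 := PT.comp hv (by fun_prop)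
  have hP2 : PT fun x : (α × ℕ) × ℕ × ℕ => P x.1.1 x.2.1 (v x.1.1) x.2.2 :=
    PT.comp (f := fun x : (α × ℕ) × ℕ × ℕ => (x.1.1, x.2.1, v x.1.1, x.2.2)) hP (by fun_prop)
  have hM2 : PT fun x : (α × ℕ) × ℕ × ℕ => M x.1.1 x.2.1 (v x.1.1) x.2.2 :=
    PT.comp (f := fun x : (α × ℕ) × ℕ × ℕ => (x.1.1, x.2.1, v x.1.1, x.2.2)) hM (by fun_prop)
  fun_prop

theorem pt_relayPad {l : α → List ℕ} {pkt : α → Packet} {B : α → ℕ} (hκ : PT κ)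
    (hP : PT fun x : α × ℕ × ℕ × ℕ => P x.1 x.2.1 x.2.2.1 x.2.2.2)
    (hM : PT fun x : α × ℕ × ℕ × ℕ => M x.1 x.2.1 x.2.2.1 x.2.2.2)
    (hB : PB B) (hPB : ∀ a s v t, (P a s v t).length ≤ B a) (hl : PT l) (hpkt : PT pkt) :
    PT fun a => S.relayPad (κ a) (P a) (M a) (l a) (pkt a) := by
  unfold relayPad
  have hadd : PT fun a => S.addrLen (κ a) := by fun_prop
  have hptr : PT fun a => S.ptrLen (κ a) := by fun_prop
  refine PT.foldl_bounded (B := fun a => 4 * (S.addrLen (κ a) + S.ptrLen (κ a) + B a) + 25)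
    hl (by fun_prop) ?_ (((PB.const 4).mul ((hadd.pb_nat.add hptr.pb_nat).add hB)).add (.const 25))
    fun a s v => ?_
  · refine PT.option_elim (by fun_prop) (by fun_prop) (PT.outcome_forwarded ?_)
    refine pt_processPad (PT.comp hκ (by fun_prop)) ?_ ?_ (by fun_prop) (by fun_prop)
    · exact PT.comp (f := fun x : ((α × Option Packet × ℕ) × Packet) × ℕ × ℕ × ℕ =>
        (x.1.1.1, x.2.1, x.2.2.1, x.2.2.2)) hP (by fun_prop)
    · exact PT.comp (f := fun x : ((α × Option Packet × ℕ) × Packet) × ℕ × ℕ × ℕ =>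
        (x.1.1.1, x.2.1, x.2.2.1, x.2.2.2)) hM (by fun_prop)
  · have h0 : esize (none : Option Packet) = 1 := rfl
    cases s with
    | none => simp only [Option.elim]; omega
    | some pkt =>
      simp only [Option.elim]
      have := esize_processPad_le (S := S) (κ := κ a) (v := v) (M := M a) (pkt := pkt) (hPB a)
      cases h : S.processPad (κ a) (P a) (M a) v pkt with
      | forward pkt' =>
        rw [h] at this
        change 1 + esize pkt' + 1 ≤ _ at this
        change esize pkt' + 1 + 1 ≤ _
        omega
      | drop => simp only [Outcome.forwarded]; omega
      | deliver x => simp only [Outcome.forwarded]; omega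

variable {pad mk : α → ℕ → List Bool}

theorem pt_buildPad {path slots : α → List ℕ} {payload R : α → List Bool} {B : α → ℕ} (hκ : PT κ)
    (hpad : PT fun x : α × ℕ => pad x.1 x.2) (hmk : PT fun x : α × ℕ => mk x.1 x.2)
    (hB : PB B) (hPB : ∀ a v, (pad a v).length ≤ B a) (hpath : PT path) (hpay : PT payload)
    (hR : PT R) (hslots : PT slots) :
    PT fun a => S.buildPad (κ a) (pad a) (mk a) (path a) (payload a) (R a) (slots a) := by
  -- A wrapped body has at most `B a` bits from the blinded element and `B a` from the blinded body,
  -- at four units of size per bit.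
  have hB8 : PB fun a => 8 * B a + 1 := ((PB.const 8).mul hB).add (.const 1)
  have hfill : PT fun a => (hops ((path a).zip (slots a))).foldl (S.fillPad (κ a) (pad a)) (R a) :=
      by
    refine PT.foldl_bounded (f := fun a => hops ((path a).zip (slots a))) (by fun_prop) hR ?_
      hB8 fun a s h => ?_
    · have h1 : PT fun x : α × List Bool × Hop => pad x.1 x.2.2.node :=
        PT.comp (f := fun x : α × List Bool × Hop => (x.1, x.2.2.node)) hpad (by fun_prop)
      have h2 : PT fun x : α × List Bool × Hop => κ x.1 := PT.comp hκ (by fun_prop)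
      unfold fillPad
      fun_prop
    · have h1 := esize_bits_le (S.fillPad (κ a) (pad a) s h)
      have h2 : (S.fillPad (κ a) (pad a) s h).length ≤ B a :=
        (length_bxor_le _ _).trans (le_trans (by simp) (hPB a h.node))
      omega
  have hwrap : PT fun a => (hops ((path a).zip (slots a))).foldr (S.wrapPad (κ a) (pad a) (mk a))
      ((hops ((path a).zip (slots a))).foldl (S.fillPad (κ a) (pad a)) (R a)
        ++ S.padded (κ a) (payload a)) := by
    refine PT.foldr (f := fun a => hops ((path a).zip (slots a))) (by fun_prop) (by fun_prop) ?_
      hB8 fun a s h _ => ?_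
    · have h1 : PT fun x : α × Hop × List Bool => pad x.1 x.2.1.node :=
        PT.comp (f := fun x : α × Hop × List Bool => (x.1, x.2.1.node)) hpad (by fun_prop)
      have h3 : PT fun x : α × Hop × List Bool => mk x.1 x.2.1.node :=
        PT.comp (f := fun x : α × Hop × List Bool => (x.1, x.2.1.node)) hmk (by fun_prop)
      have h2 : PT fun x : α × Hop × List Bool => κ x.1 := PT.comp hκ (by fun_prop)
      unfold wrapPad
      fun_prop
    · have h1 := esize_bits_le (S.wrapPad (κ a) (pad a) (mk a) h s)
      have h0 := hPB a h.node
      have h2 : (S.wrapPad (κ a) (pad a) (mk a) h s).length ≤ B a + B a :=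
        (length_putSlot_le _ _ _ _).trans (add_le_add
          ((length_bxor_le _ _).trans (le_trans (by simp) h0))
          ((length_bxor_le _ _).trans (le_trans (by simp) h0)))
      omega
  exact PT.packet_mk (by fun_prop) (by fun_prop) hwrap

end Scheme

end

end Ariadne

/-! ### Running time of the challenge and of the whole game -/

namespace Ariadne
open Enc

/-- What the two paths of a challenge have in common in the given game. -/
def Game.Agrees (g : Game) (c : Challenge) : Prop :=
  match g with
  | .path => c.source' = c.source
  | .source => c.before' = c.before

instance : Enc Challenge := ⟨fun c => enc (c.payload₁, c.payload₂, c.t, c.source, c.before, c.after,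
  c.source', c.before')⟩

section

variable {α : Type} [Enc α]

theorem PT.challenge_tuple {c : α → Challenge} (hc : PT c) : PT fun a =>
    ((c a).payload₁, (c a).payload₂, (c a).t, (c a).source, (c a).before, (c a).after,
      (c a).source', (c a).before') := hc.congr_out fun _ => rfl

@[fun_prop]
theorem PT.challenge_payload₁ {c : α → Challenge} (hc : PT c) : PT fun a => (c a).payload₁ :=
  hc.challenge_tuple.fst

@[fun_prop]
theorem PT.challenge_payload₂ {c : α → Challenge} (hc : PT c) : PT fun a => (c a).payload₂ :=
  hc.challenge_tuple.snd.fst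

@[fun_prop]
theorem PT.challenge_t {c : α → Challenge} (hc : PT c) : PT fun a => (c a).t :=
  hc.challenge_tuple.snd.snd.fst

@[fun_prop]
theorem PT.challenge_source {c : α → Challenge} (hc : PT c) : PT fun a => (c a).source :=
  hc.challenge_tuple.snd.snd.snd.fst

@[fun_prop]
theorem PT.challenge_before {c : α → Challenge} (hc : PT c) : PT fun a => (c a).before :=
  hc.challenge_tuple.snd.snd.snd.snd.fst

@[fun_prop]
theorem PT.challenge_after {c : α → Challenge} (hc : PT c) : PT fun a => (c a).after :=
  hc.challenge_tuple.snd.snd.snd.snd.snd.fst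

@[fun_prop]
theorem PT.challenge_source' {c : α → Challenge} (hc : PT c) : PT fun a => (c a).source' :=
  hc.challenge_tuple.snd.snd.snd.snd.snd.snd.fst

@[fun_prop]
theorem PT.challenge_before' {c : α → Challenge} (hc : PT c) : PT fun a => (c a).before' :=
  hc.challenge_tuple.snd.snd.snd.snd.snd.snd.snd

@[fun_prop]
theorem PT.challenge_ofTree {x : α → Tree} (hx : PT x) : PT fun a => Challenge.ofTree (x a) := by
  have : PT fun a => (((x a).entry 0).toBits, ((x a).entry 1).toBits, ((x a).entry 2).toNat,
    ((x a).entry 3).toNat, ((x a).entry 4).toNats, ((x a).entry 5).toNats, ((x a).entry 6).toNat,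
    ((x a).entry 7).toNats) := by fun_prop
  exact this.congr_out fun _ => rfl

/-- Both decidability instances are arbitrary, so this also passes from a computable test to the
classical instance in the definition of the game. -/
theorem PT.decide_iff {p q : α → Prop} [∀ a, Decidable (p a)] [∀ a, Decidable (q a)]
    (hq : PT fun a => decide (q a)) (h : ∀ a, p a ↔ q a) : PT fun a => decide (p a) :=
  hq.congr fun a => by simp [h]

section

variable {S : Scheme} [S.Feasible] {κ : α → ℕ}

open Classical in
theorem pt_validPath {s : α → ℕ} {l : α → List ℕ} (hκ : PT κ) (hs : PT s) (hl : PT l) :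
    PT fun a => decide (ValidPath S (κ a) (s a) (l a)) := by
  have hall : PT fun a => decide (((s a :: l a).all fun v => decide (v < S.nodes (κ a))) = true) :=
      by
    have hκ' : PT fun x : α × ℕ => κ x.1 := PT.comp hκ (by fun_prop)
    exact PT.decide_bool (PT.all (g := fun a v => decide (v < S.nodes (κ a))) (by fun_prop)
      (by fun_prop))
  have h : PT fun a => decide ((s a :: l a).Nodup ∧
      ((s a :: l a).all fun v => decide (v < S.nodes (κ a))) = true ∧
      (l a).length ≤ S.slots (κ a)) := PT.decide_and (by fun_prop) (PT.decide_and hall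
          (by fun_prop))
  refine PT.decide_iff h fun a => ?_
  simp [ValidPath]

open Classical in
theorem pt_valid (g : Game) {j : α → ℕ} {c : α → Challenge} (hκ : PT κ) (hj : PT j) (hc : PT c) :
    PT fun a => decide ((c a).Valid S (κ a) g (j a)) := by
  have h1 : PT fun a => decide (ValidPath S (κ a) (c a).source
    ((c a).before ++ j a :: (c a).after)) := pt_validPath hκ (by fun_prop) (by fun_prop)
  have h2 : PT fun a => decide (ValidPath S (κ a) (c a).source'
    ((c a).before' ++ j a :: (c a).after)) := pt_validPath hκ (by fun_prop) (by fun_prop)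
  have heq : ∀ l m : List ℕ, l = m ↔ l.length = m.length ∧
      ((List.zipWith (fun x y => decide (x = y)) l m).all fun b => b) = true := by
    intro l
    induction l with
    | nil => intro m; cases m <;> simp
    | cons x l ih =>
      intro m
      cases m with
      | nil => simp
      | cons y m =>
        rw [List.cons.injEq, ih m]
        simp only [List.length_cons, List.zipWith_cons_cons, List.all_cons, Bool.and_eq_true,
          decide_eq_true_eq, Nat.add_right_cancel_iff]
        tauto
  have h3 : PT fun a => decide (g.Agrees (c a)) := by
    cases g with
    | path =>
      exact PT.decide_iff (q := fun a => (c a).source' = (c a).source)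
        (PT.nat_eq (by fun_prop) (by fun_prop)) fun a => Iff.rfl
    | source =>
      refine PT.decide_iff (q := fun a => (c a).before'.length = (c a).before.length ∧
        ((List.zipWith (fun x y => decide (x = y)) (c a).before' (c a).before).all fun b => b) =
            true)
        (PT.decide_and (PT.nat_eq (by fun_prop) (by fun_prop))
          (PT.decide_bool (PT.all (g := fun _ b => b) ?_ (by fun_prop))))
        fun a => heq _ _
      exact PT.zipWith (h := fun _ x y => decide (x = y)) (by fun_prop) (by fun_prop) (by fun_prop)
  have h : PT fun a => decide ((c a).payload₁.length ≤ S.payloadLen (κ a) ∧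
      (c a).payload₂.length ≤ S.payloadLen (κ a) ∧ (c a).t + 1 < S.window (κ a) ∧
      0 < (c a).after.length ∧
      ValidPath S (κ a) (c a).source ((c a).before ++ j a :: (c a).after) ∧
      ValidPath S (κ a) (c a).source' ((c a).before' ++ j a :: (c a).after) ∧
      g.Agrees (c a)) :=
    PT.decide_and (by fun_prop) (PT.decide_and (by fun_prop) (PT.decide_and (by fun_prop)
      (PT.decide_and (by fun_prop) (PT.decide_and h1 (PT.decide_and h2 h3)))))
  refine PT.decide_iff h fun a => ?_
  rw [List.length_pos_iff]
  cases g <;> rfl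

variable {P M : α → ℕ → ℕ → ℕ → List Bool}

open Classical in
theorem pt_challengeViews (g : Game) {j : α → ℕ} {c : α → Challenge} {b : α → Bool}
    {R₁ R₂ : α → List Bool} {σ₁ σ₂ : α → List ℕ} {B : α → ℕ} (hκ : PT κ)
    (hP : PT fun x : α × ℕ × ℕ × ℕ => P x.1 x.2.1 x.2.2.1 x.2.2.2)
    (hM : PT fun x : α × ℕ × ℕ × ℕ => M x.1 x.2.1 x.2.2.1 x.2.2.2)
    (hB : PB B) (hPB : ∀ a s v t, (P a s v t).length ≤ B a) (hj : PT j) (hc : PT c) (hb : PT b)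
    (hR₁ : PT R₁) (hR₂ : PT R₂) (hσ₁ : PT σ₁) (hσ₂ : PT σ₂) :
    PT fun a => challengeViews S (κ a) g (P a) (M a) (j a) (c a) (b a) (R₁ a) (R₂ a)
      (σ₁ a) (σ₂ a) := by
  have hs₂ : PT fun a => bif b a then (c a).source' else (c a).source := by fun_prop
  have hb₂ : PT fun a => bif b a then (c a).before' else (c a).before := by fun_prop
  have hview : ∀ {s t : α → ℕ} {l : α → List ℕ} {x R : α → List Bool} {σ : α → List ℕ},
      PT s → PT t → PT l → PT x → PT R → PT σ → PT fun a =>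
        linkView (S.relayPad (κ a) (P a) (M a) (l a ++ [j a])
        (S.buildPad (κ a) (fun v => P a (s a) v (t a)) (fun v => M a (s a) v (t a))
          (l a ++ j a :: (c a).after) (x a) (R a) (σ a))) := by
    intro s t l x R σ hs ht hl hx hR hσ
    refine PT.linkView (Scheme.pt_relayPad hκ hP hM hB hPB (by fun_prop)
      (Scheme.pt_buildPad hκ ?_ ?_ hB (fun a v => hPB _ _ _ _) (by fun_prop) hx hR hσ))
    · exact PT.comp (f := fun x : α × ℕ => (x.1, s x.1, x.2, t x.1)) hP (by fun_prop)
    · exact PT.comp (f := fun x : α × ℕ => (x.1, s x.1, x.2, t x.1)) hM (by fun_prop)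
  unfold challengeViews
  refine PT.ite (pt_valid g hκ hj hc) (PT.list_cons ?_ (PT.list_cons ?_ (.const _))) (.const _)
  · exact hview (by fun_prop) (by fun_prop) (by fun_prop) (by fun_prop) hR₁ hσ₁
  · exact hview hs₂ (by fun_prop) hb₂ (by fun_prop) hR₂ hσ₂

/-- Each round appends one answer, of a size that is bounded independently of the query. The list of
answers thus grows additively, and the adversary's polynomial-time moves stay polynomial over all
rounds. -/
theorem pt_interact {next : α → List Tree → Tree} {oracle : α → Tree → Tree} {n : α → ℕ}
    {as : α → List Tree} {B : α → ℕ} (hnext : PT fun x : α × List Tree => next x.1 x.2)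
    (horacle : PT fun x : α × Tree => oracle x.1 x.2) (hB : PB B)
    (hle : ∀ a x, esize (oracle a x) ≤ B a) (hn : PT n) (has : PT as) :
    PT fun a => interact (next a) (oracle a) (n a) (as a) := by
  have h : PT fun a => (List.replicate (n a) ()).foldl
      (fun s _ => s ++ [oracle a (next a s)]) (as a) := by
    refine PT.foldl (f := fun a => List.replicate (n a) ())
      (g := fun a s _ => s ++ [oracle a (next a s)]) (by fun_prop) has ?_ (hB.add (.const 1))
      fun a s u _ => ?_
    · have h1 : PT fun x : α × List Tree × Unit => next x.1 x.2.1 :=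
        PT.comp (f := fun x : α × List Tree × Unit => (x.1, x.2.1)) hnext (by fun_prop)
      have h2 : PT fun x : α × List Tree × Unit => oracle x.1 (next x.1 x.2.1) :=
        PT.comp (f := fun x : α × List Tree × Unit => (x.1, next x.1 x.2.1)) horacle (by fun_prop)
      fun_prop
    · have h1 := hle a (next a s)
      have h2 := esize_append s [oracle a (next a s)]
      simp only [esize_cons, esize_nil] at h2
      omega
  refine h.congr fun a => ?_
  generalize as a = l
  induction n a generalizing l with
  | zero => rfl
  | succ n ih => rw [List.replicate_succ, List.foldl_cons, ← ih]; rfl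

@[fun_prop]
theorem pt_view {x : α → List Bool} {as : α → List Tree} (hκ : PT κ) (hx : PT x) (has : PT as) :
    PT fun a => view (κ a) (x a) (as a) := by unfold view; fun_prop

theorem pt_gameResult (g : Game) (A : Adversary) {r : α → List Bool} {b : α → Bool}
    {R₁ R₂ : α → List Bool} {σ₁ σ₂ : α → List ℕ} {B : α → ℕ} (hκ : PT κ)
    (hP : PT fun x : α × ℕ × ℕ × ℕ => P x.1 x.2.1 x.2.2.1 x.2.2.2)
    (hM : PT fun x : α × ℕ × ℕ × ℕ => M x.1 x.2.1 x.2.2.1 x.2.2.2)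
    (hB : PB B) (hPB : ∀ a s v t, (P a s v t).length ≤ B a) (hr : PT r) (hb : PT b)
    (hR₁ : PT R₁) (hR₂ : PT R₂) (hσ₁ : PT σ₁) (hσ₂ : PT σ₂) :
    PT fun a => gameResult S g A (κ a) (P a) (M a) (r a) (b a) (R₁ a) (R₂ a) (σ₁ a) (σ₂ a) := by
  have hrouter : PT fun x => A.router x := A.router_polyTime
  have hquery₁ : PT fun x => A.query₁ x := A.query₁_polyTime
  have hquery₂ : PT fun x => A.query₂ x := A.query₂_polyTime
  have hchallenge : PT fun x => A.challenge x := A.challenge_polyTime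
  have hguess : PT fun x => A.guess x := A.guess_polyTime
  have hj : PT fun a => (A.router (view (κ a) (r a) [])).toNat :=
    PT.tree_toNat (PT.comp hrouter (by fun_prop))
  have hv : PT fun x : α × List Tree => view (κ x.1) (r x.1) x.2 :=
    pt_view (PT.comp hκ (by fun_prop)) (PT.comp hr (by fun_prop)) (by fun_prop)
  have horacle : PT fun x : α × Tree => (S.processPad (κ x.1) (P x.1) (M x.1)
      (A.router (view (κ x.1) (r x.1) [])).toNat (.ofTree x.2)).toTree := by
    refine PT.outcome_toTree (Scheme.pt_processPad (PT.comp hκ (by fun_prop)) ?_ ?_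
      (PT.comp (g := fun a => (A.router (view (κ a) (r a) [])).toNat) hj (by fun_prop))
      (by fun_prop))
    · exact PT.comp (f := fun x : (α × Tree) × ℕ × ℕ × ℕ =>
        (x.1.1, x.2.1, x.2.2.1, x.2.2.2)) hP (by fun_prop)
    · exact PT.comp (f := fun x : (α × Tree) × ℕ × ℕ × ℕ =>
        (x.1.1, x.2.1, x.2.2.1, x.2.2.2)) hM (by fun_prop)
  have hadd : PT fun a => S.addrLen (κ a) := by fun_prop
  have hptr : PT fun a => S.ptrLen (κ a) := by fun_prop
  have hbound : PB fun a => 4 * (S.addrLen (κ a) + S.ptrLen (κ a) + B a) + 20 :=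
    ((PB.const 4).mul ((hadd.pb_nat.add hptr.pb_nat).add hB)).add (.const 20)
  have hle : ∀ (a : α) (x : Tree), esize (S.processPad (κ a) (P a) (M a)
      (A.router (view (κ a) (r a) [])).toNat (.ofTree x)).toTree
      ≤ 4 * (S.addrLen (κ a) + S.ptrLen (κ a) + B a) + 20 :=
    fun a x => Scheme.esize_processPad_le (hPB a)
  have h₁ := pt_interact (next := fun a as => A.query₁ (view (κ a) (r a) as))
    (n := fun a => A.queries₁.eval (κ a)) (as := fun _ => [])
        (PT.comp hquery₁ hv) horacle hbound hle
    (by fun_prop) (by fun_prop)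
  have hc := PT.challenge_ofTree (PT.comp hchallenge (pt_view hκ hr h₁))
  have hviews := pt_challengeViews (S := S) g hκ hP hM hB hPB hj hc hb hR₁ hR₂ hσ₁ hσ₂
  have h₂ := pt_interact (next := fun a as => A.query₂ (view (κ a) (r a) as))
    (n := fun a => A.queries₂.eval (κ a)) (PT.comp hquery₂ hv) horacle hbound hle
    (by fun_prop) (h₁.append hviews)
  exact PT.ite (by fun_prop) (PT.bool_beq
    (PT.tree_toBool (PT.comp hguess (pt_view hκ hr h₂))) hb) hb

end

end

end Ariadne

namespace Ariadne

/-! ### Exclusive or -/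

theorem length_bxor (x y : List Bool) : (bxor x y).length = min x.length y.length := by
  simp [bxor]

theorem take_bxor (n : ℕ) (x y : List Bool) : (bxor x y).take n = bxor (x.take n) (y.take n) := by
  simp [bxor, List.take_zipWith]

theorem drop_bxor (n : ℕ) (x y : List Bool) : (bxor x y).drop n = bxor (x.drop n) (y.drop n) := by
  simp [bxor, List.drop_zipWith]

theorem bxor_append {x y x' y' : List Bool} (h : x.length = y.length) :
    bxor (x ++ x') (y ++ y') = bxor x y ++ bxor x' y' := by
  simp [bxor, List.zipWith_append h]

theorem bxor_assoc (x y z : List Bool) : bxor (bxor x y) z = bxor x (bxor y z) := by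
  induction x generalizing y z with
  | nil => simp [bxor]
  | cons a x ih =>
    cases y with
    | nil => simp [bxor]
    | cons b y =>
      cases z with
      | nil => simp [bxor]
      | cons c z =>
        have := ih y z
        simp only [bxor, List.zipWith_cons_cons, Bool.xor_assoc] at this ⊢
        rw [this]

theorem bxor_comm (x y : List Bool) : bxor x y = bxor y x := by
  rw [bxor, bxor, List.zipWith_comm]
  congr 1
  funext a b
  exact Bool.xor_comm b a

theorem bxor_self (x : List Bool) : bxor x x = List.replicate x.length false := by
  induction x with
  | nil => rfl
  | cons a x ih =>
    simp only [bxor, List.zipWith_cons_cons, Bool.xor_self, List.length_cons, List.replicate_succ]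
    rw [← ih, bxor]

theorem bxor_zero {x : List Bool} {n : ℕ} (h : x.length ≤ n) :
    bxor x (List.replicate n false) = x := by
  induction x generalizing n with
  | nil => simp [bxor]
  | cons a x ih =>
    obtain ⟨n, rfl⟩ : ∃ m, n = m + 1 := ⟨n - 1, by simp at h; omega⟩
    have := ih (n := n) (by simpa using h)
    rw [bxor] at this
    simp [bxor, List.replicate_succ, this]

theorem bxor_cancel_right {x y : List Bool} (h : x.length ≤ y.length) :
    bxor (bxor x y) y = x := by
  rw [bxor_assoc, bxor_self, bxor_zero h]

theorem bxor_right_injective {x y z : List Bool} (hy : y.length = x.length)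
    (hz : z.length = x.length) (h : bxor x y = bxor x z) : y = z := by
  rw [bxor_comm x y, bxor_comm x z] at h
  rw [← bxor_cancel_right hy.le, h, bxor_cancel_right hz.le]

theorem bxor_take_right {x y : List Bool} {n : ℕ} (h : x.length ≤ n) :
    bxor x (y.take n) = bxor x y := by
  have := take_bxor n x y
  rw [List.take_of_length_le h] at this
  rw [← this, List.take_of_length_le]
  rw [length_bxor]; omega

namespace Scheme

variable {S : Scheme} {κ : ℕ}

/-! ### Slots -/

theorem slot_le {p : ℕ} (hp : p < S.slots κ) : p * S.elemLen κ + S.elemLen κ ≤ S.vecLen κ := by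
  have := Nat.mul_le_mul_right (S.elemLen κ) hp
  rwa [Nat.succ_mul] at this

theorem vecLen_le : S.vecLen κ ≤ S.fullLen κ := Nat.le_add_right _ _

theorem length_putSlot {p : ℕ} {r X : List Bool}
    (hX : p * S.elemLen κ + S.elemLen κ ≤ X.length) (hr : r.length = S.elemLen κ) :
    (S.putSlot κ p r X).length = X.length := by
  simp only [putSlot, List.length_append, List.length_take, List.length_drop]; omega

theorem getElem?_putSlot {p : ℕ} {r X : List Bool}
    (hX : p * S.elemLen κ + S.elemLen κ ≤ X.length) (hr : r.length = S.elemLen κ) (i : ℕ) :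
    (S.putSlot κ p r X)[i]? =
    if i < p * S.elemLen κ then X[i]? else if i < p * S.elemLen κ + S.elemLen κ then
      r[i - p * S.elemLen κ]? else X[i]? := by
  have h1 : (X.take (p * S.elemLen κ)).length = p * S.elemLen κ := by
    rw [List.length_take]; omega
  rw [putSlot, List.append_assoc]
  by_cases h : i < p * S.elemLen κ
  · rw [if_pos h, List.getElem?_append_left (by omega), List.getElem?_take_of_lt h]
  · rw [if_neg h, List.getElem?_append_right (by omega), h1]
    by_cases h' : i < p * S.elemLen κ + S.elemLen κ
    · rw [if_pos h', List.getElem?_append_left (by omega)]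
    · rw [if_neg h', List.getElem?_append_right (by omega), List.getElem?_drop]
      congr 1; omega

theorem getElem?_getSlot (p : ℕ) (X : List Bool) (i : ℕ) : (S.getSlot κ p X)[i]? =
    if i < S.elemLen κ then X[p * S.elemLen κ + i]? else none := by
  rw [getSlot]
  split_ifs with h
  · rw [List.getElem?_take_of_lt h, List.getElem?_drop]
  · rw [List.getElem?_eq_none]
    rw [List.length_take]; omega

theorem length_getSlot {p : ℕ} {X : List Bool}
    (hX : p * S.elemLen κ + S.elemLen κ ≤ X.length) :
    (S.getSlot κ p X).length = S.elemLen κ := by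
  simp only [getSlot, List.length_take, List.length_drop]; omega

theorem getSlot_putSlot_self {p : ℕ} {r X : List Bool}
    (hX : p * S.elemLen κ + S.elemLen κ ≤ X.length) (hr : r.length = S.elemLen κ) :
    S.getSlot κ p (S.putSlot κ p r X) = r := by
  refine List.ext_getElem? fun i => ?_
  rw [getElem?_getSlot]
  split_ifs with h
  · rw [getElem?_putSlot hX hr, if_neg (by omega), if_pos (by omega)]
    congr 1; omega
  · rw [List.getElem?_eq_none (by omega)]

theorem getSlot_putSlot_of_ne {p q : ℕ} (hpq : q ≠ p) {r X : List Bool}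
    (hX : p * S.elemLen κ + S.elemLen κ ≤ X.length) (hr : r.length = S.elemLen κ) :
    S.getSlot κ q (S.putSlot κ p r X) = S.getSlot κ q X := by
  refine List.ext_getElem? fun i => ?_
  rw [getElem?_getSlot, getElem?_getSlot]
  split_ifs with h
  · rw [getElem?_putSlot hX hr]
    rcases lt_or_gt_of_ne hpq with h' | h'
    · have := Nat.mul_le_mul_right (S.elemLen κ) h'
      rw [Nat.succ_mul] at this
      rw [if_pos (by omega)]
    · have := Nat.mul_le_mul_right (S.elemLen κ) h'
      rw [Nat.succ_mul] at this
      rw [if_neg (by omega), if_neg (by omega)]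
  · rfl

theorem putSlot_putSlot {p : ℕ} {r r' X : List Bool}
    (hX : p * S.elemLen κ + S.elemLen κ ≤ X.length) (hr : r.length = S.elemLen κ)
    (hr' : r'.length = S.elemLen κ) :
    S.putSlot κ p r (S.putSlot κ p r' X) = S.putSlot κ p r X := by
  refine List.ext_getElem? fun i => ?_
  rw [getElem?_putSlot (by rwa [length_putSlot hX hr']) hr, getElem?_putSlot hX hr,
    getElem?_putSlot hX hr']
  split_ifs <;> rfl

theorem putSlot_getSlot {p : ℕ} {X : List Bool}
    (hX : p * S.elemLen κ + S.elemLen κ ≤ X.length) :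
    S.putSlot κ p (S.getSlot κ p X) X = X := by
  refine List.ext_getElem? fun i => ?_
  rw [getElem?_putSlot hX (length_getSlot hX), getElem?_getSlot]
  split_ifs with h₁ h₂ h₃
  · rfl
  · congr 1; omega
  · omega
  · rfl

theorem getSlot_bxor (p : ℕ) (x y : List Bool) :
    S.getSlot κ p (bxor x y) = bxor (S.getSlot κ p x) (S.getSlot κ p y) := by
  simp only [getSlot, drop_bxor, take_bxor]

theorem getSlot_take {p : ℕ} (hp : p < S.slots κ) (x : List Bool) :
    S.getSlot κ p (x.take (S.vecLen κ)) = S.getSlot κ p x := by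
  have := slot_le hp
  simp only [getSlot, List.drop_take, List.take_take]
  congr 1; omega

theorem getSlot_append_left {p : ℕ} {x : List Bool} (y : List Bool)
    (hX : p * S.elemLen κ + S.elemLen κ ≤ x.length) :
    S.getSlot κ p (x ++ y) = S.getSlot κ p x := by
  simp only [getSlot]
  rw [List.drop_append_of_le_length (by omega), List.take_append_of_le_length]
  rw [List.length_drop]; omega

theorem putSlot_append {p : ℕ} {r x : List Bool} (y : List Bool)
    (hX : p * S.elemLen κ + S.elemLen κ ≤ x.length) :
    S.putSlot κ p r (x ++ y) = S.putSlot κ p r x ++ y := by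
  simp only [putSlot]
  rw [List.take_append_of_le_length (by omega), List.drop_append_of_le_length hX]
  simp

theorem bxor_putSlot {p : ℕ} {r s X Y : List Bool} (hXY : X.length = Y.length)
    (hr : r.length = S.elemLen κ) (hs : s.length = S.elemLen κ) :
    bxor (S.putSlot κ p r X) (S.putSlot κ p s Y) = S.putSlot κ p (bxor r s) (bxor X Y) := by
  simp only [putSlot, List.append_assoc]
  rw [bxor_append (by simp [hXY]), bxor_append (by rw [hr, hs]), take_bxor, drop_bxor]

/-! ### Nominal packets -/

theorem length_elem {m n : ℕ} {tag : List Bool} (h : tag.length = κ) :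
    (S.elem κ m n tag).length = S.elemLen κ := by
  simp only [elem, List.length_append, natBits_length, h, elemLen]

theorem take_elem (m n : ℕ) (tag : List Bool) :
    (S.elem κ m n tag).take (S.elemLen κ - κ) ++ List.replicate κ false
      = S.elem κ m n (List.replicate κ false) := by
  rw [elem, List.take_left', elem]
  simp only [List.length_append, natBits_length, elemLen]; omega

theorem drop_elem (m n : ℕ) (tag : List Bool) :
    (S.elem κ m n tag).drop (S.elemLen κ - κ) = tag := by
  rw [elem, List.drop_left']
  simp only [List.length_append, natBits_length, elemLen]; omega

/-- Length of the pseudo-random string. -/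
def padLen (S : Scheme) (κ : ℕ) : ℕ := S.elemLen κ + S.fullLen κ

variable (S κ) in
/-- The body of the packet before it passes the given hops, for the initial vector `R`. -/
def stage (pad mk : ℕ → List Bool) (pay : List Bool) (hs : List Hop) (R : List Bool) : List Bool :=
  hs.foldr (S.wrapPad κ pad mk) (hs.foldl (S.fillPad κ pad) R ++ pay)

/-- All strings have the right lengths for the given hops. -/
structure Fits (S : Scheme) (κ : ℕ) (pad mk : ℕ → List Bool) (hs : List Hop) : Prop where
  pad_length : ∀ h ∈ hs, (pad h.node).length = S.padLen κ
  mk_length : ∀ h ∈ hs, (mk h.node).length = κ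
  slot_lt : ∀ h ∈ hs, h.slot < S.slots κ

variable {pad mk : ℕ → List Bool} {pay : List Bool}

theorem Fits.tail {h : Hop} {hs : List Hop} (hf : S.Fits κ pad mk (h :: hs)) :
    S.Fits κ pad mk hs :=
  ⟨fun k hk => hf.pad_length k (List.mem_cons_of_mem _ hk), fun k hk => hf.mk_length k
      (List.mem_cons_of_mem _ hk),
    fun k hk => hf.slot_lt k (List.mem_cons_of_mem _ hk)⟩

theorem length_drop_pad {x : List Bool} (h : x.length = S.padLen κ) :
    (x.drop (S.elemLen κ)).length = S.fullLen κ := by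
  rw [List.length_drop, h, padLen]; omega

theorem length_take_pad {x : List Bool} (h : x.length = S.padLen κ) :
    (x.take (S.elemLen κ)).length = S.elemLen κ := by
  rw [List.length_take, h, padLen]; omega

theorem length_fillPad {h : Hop} {R : List Bool} (hpad : (pad h.node).length = S.padLen κ)
    (hs : h.slot < S.slots κ) (hR : R.length = S.vecLen κ) :
    (S.fillPad κ pad R h).length = S.vecLen κ := by
  have h1 := slot_le hs
  have h2 := vecLen_le (S := S) (κ := κ)
  rw [fillPad, length_bxor, length_putSlot (by omega) (length_elem (by simp)), List.length_take,
    length_drop_pad hpad]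
  omega

theorem length_foldl_fillPad {hs : List Hop} {R : List Bool} (hf : S.Fits κ pad mk hs)
    (hR : R.length = S.vecLen κ) : (hs.foldl (S.fillPad κ pad) R).length = S.vecLen κ := by
  induction hs generalizing R with
  | nil => exact hR
  | cons h hs ih =>
    exact ih hf.tail (length_fillPad (hf.pad_length h (by simp)) (hf.slot_lt h (by simp)) hR)

theorem length_wrapPad (hwf : S.WellFormed) {h : Hop} {X : List Bool}
    (hpad : (pad h.node).length = S.padLen κ) (hmk : (mk h.node).length = κ)
    (hs : h.slot < S.slots κ) (hX : X.length = S.fullLen κ) :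
    (S.wrapPad κ pad mk h X).length = S.fullLen κ := by
  have h1 := slot_le hs
  have h2 := vecLen_le (S := S) (κ := κ)
  have h3 : (bxor X ((pad h.node).drop (S.elemLen κ))).length = S.fullLen κ := by
    rw [length_bxor, hX, length_drop_pad hpad, min_self]
  rw [wrapPad, length_putSlot (by omega), h3]
  rw [length_bxor, length_elem (hwf.mac_length _ _ _ hmk h3), length_take_pad hpad, min_self]

theorem length_stage (hwf : S.WellFormed) {hs : List Hop} {R : List Bool}
    (hf : S.Fits κ pad mk hs) (hR : R.length = S.vecLen κ) (hpay : pay.length = S.payloadLen κ) :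
    (S.stage κ pad mk pay hs R).length = S.fullLen κ := by
  induction hs generalizing R with
  | nil => simp [stage, hR, hpay, fullLen]
  | cons h hs ih =>
    exact length_wrapPad hwf (hf.pad_length h (by simp)) (hf.mk_length h (by simp)) (hf.slot_lt h
        (by simp))
      (ih hf.tail (length_fillPad (hf.pad_length h (by simp)) (hf.slot_lt h (by simp)) hR))

/-- Each hop blinds the vector twice with the same string, once when the filler is made and once
when the body is wrapped, and the two cancel in every slot that no remaining hop overwrites. -/
theorem getSlot_stage (hwf : S.WellFormed) {hs : List Hop} {R : List Bool} {p : ℕ}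
    (hf : S.Fits κ pad mk hs) (hR : R.length = S.vecLen κ) (hpay : pay.length = S.payloadLen κ)
    (hp : p < S.slots κ) (hps : ∀ h ∈ hs, h.slot ≠ p) :
    S.getSlot κ p (S.stage κ pad mk pay hs R) = S.getSlot κ p R := by
  induction hs generalizing R with
  | nil => exact getSlot_append_left _ (by rw [List.foldl_nil, hR]; exact slot_le hp)
  | cons h hs ih =>
    have hpad := hf.pad_length h (by simp)
    have hmk := hf.mk_length h (by simp)
    have hs' := hf.slot_lt h (by simp)
    have h1 := slot_le hs'
    have h2 := vecLen_le (S := S) (κ := κ)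
    have hR' := length_fillPad hpad hs' hR
    have hst := length_stage (pay := pay) hwf hf.tail hR' hpay
    have h3 : (bxor (S.stage κ pad mk pay hs (S.fillPad κ pad R h))
        ((pad h.node).drop (S.elemLen κ))).length = S.fullLen κ := by
      rw [length_bxor, hst, length_drop_pad hpad, min_self]
    change S.getSlot κ p (S.wrapPad κ pad mk h (S.stage κ pad mk pay hs (S.fillPad κ pad R h))) = _
    rw [wrapPad, getSlot_putSlot_of_ne (hps h (by simp)).symm (by omega), getSlot_bxor,
      ih hf.tail hR' fun k hk => hps k (List.mem_cons_of_mem _ hk), fillPad, getSlot_bxor,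
      getSlot_take hp, bxor_cancel_right,
      getSlot_putSlot_of_ne (hps h (by simp)).symm (by omega) (length_elem (by simp))]
    · have h4 := slot_le hp
      rw [length_getSlot, length_getSlot]
      · rw [length_drop_pad hpad]; omega
      · rw [length_putSlot (by omega) (length_elem (by simp))]; omega
    · rw [length_bxor, length_elem (hwf.mac_length _ _ _ hmk h3), length_take_pad hpad, min_self]

/-- The filler is made so that, once the body is blinded for this hop, its slot holds the routing
element with zero tag. That is exactly the string which the node restores before it checks the tag,
so the check succeeds; unblinding then gives the body for the remaining hops. The condition `hne`
excludes delivery. -/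
theorem openAt_stage (hwf : S.WellFormed) {h : Hop} {hs : List Hop} {R : List Bool}
    (hf : S.Fits κ pad mk (h :: hs)) (hR : R.length = S.vecLen κ)
    (hpay : pay.length = S.payloadLen κ) (hps : ∀ k ∈ hs, k.slot ≠ h.slot)
    (hn : h.node < S.nodes κ) (hn' : h.next < S.nodes κ) (hne : h.next ≠ h.node) :
    S.openAt κ h.node (pad h.node) (mk h.node) h.slot (S.stage κ pad mk pay (h :: hs) R) =
      some (.forward ⟨natBits (S.addrLen κ) h.next, natBits (S.ptrLen κ) h.nextSlot,
        S.stage κ pad mk pay hs (S.fillPad κ pad R h)⟩) := by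
  have hpad := hf.pad_length h (by simp)
  have hmk := hf.mk_length h (by simp)
  have hs' := hf.slot_lt h (by simp)
  have h1 := slot_le hs'
  have h2 := vecLen_le (S := S) (κ := κ)
  have hR' := length_fillPad hpad hs' hR
  have hst := length_stage (pay := pay) hwf hf.tail hR' hpay
  have hget : S.getSlot κ h.slot (S.stage κ pad mk pay hs (S.fillPad κ pad R h)) = _ :=
    getSlot_stage hwf hf.tail hR' hpay hs' hps
  generalize hY : S.stage κ pad mk pay hs (S.fillPad κ pad R h) = Y at hst hget
  have hW : S.stage κ pad mk pay (h :: hs) R = S.wrapPad κ pad mk h Y := by rw [← hY]; rfl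
  have h3 : (bxor Y ((pad h.node).drop (S.elemLen κ))).length = S.fullLen κ := by
    rw [length_bxor, hst, length_drop_pad hpad, min_self]
  generalize hZ : bxor Y ((pad h.node).drop (S.elemLen κ)) = Z at h3
  have htag := hwf.mac_length _ _ _ hmk h3
  generalize hτ : S.mac κ (mk h.node) Z = τ at htag
  have hE : (S.elem κ h.next h.nextSlot τ).length = S.elemLen κ := length_elem htag
  have hE0 : (S.elem κ h.next h.nextSlot (List.replicate κ false)).length = S.elemLen κ :=
    length_elem (by simp)
  have hpe := length_take_pad hpad
  have hb : (bxor (S.elem κ h.next h.nextSlot τ) ((pad h.node).take (S.elemLen κ))).length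
      = S.elemLen κ := by rw [length_bxor, hE, hpe, min_self]
  -- The remaining hops do not touch this slot, so it still has the value from the filler; blinding
  -- the body removes the blinding of the filler.
  have hZs : S.getSlot κ h.slot Z = S.elem κ h.next h.nextSlot (List.replicate κ false) := by
    rw [← hZ, getSlot_bxor, hget, fillPad, getSlot_bxor, getSlot_take hs', bxor_cancel_right,
      getSlot_putSlot_self (by omega) hE0]
    rw [length_getSlot, length_getSlot]
    · rw [length_drop_pad hpad]; omega
    · rw [length_putSlot (by omega) hE0]; omega
  rw [hW, wrapPad, hZ, hτ]
  simp only [openAt]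
  rw [getSlot_putSlot_self (by omega) hb, bxor_cancel_right (by omega), take_elem,
    drop_elem, putSlot_putSlot (by omega) hE0 hb, ← hZs, putSlot_getSlot (by omega), if_pos,
        if_pos hτ,
    ← hZ, bxor_cancel_right (by rw [hst, length_drop_pad hpad])]
  · have ha : ((S.elem κ h.next h.nextSlot τ).drop (S.pattern κ).length).take (S.addrLen κ)
        = natBits (S.addrLen κ) h.next := by
      rw [elem, List.append_assoc, List.append_assoc, List.drop_left,
        List.take_left' (natBits_length _ _)]
    have hp : ((S.elem κ h.next h.nextSlot τ).drop ((S.pattern κ).length + S.addrLen κ)).take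
        (S.ptrLen κ) = natBits (S.ptrLen κ) h.nextSlot := by
      rw [elem, List.append_assoc, List.drop_left' (by simp [natBits_length]),
        List.take_left' (natBits_length _ _)]
    rw [ha, hp, if_neg]
    rw [natBits_inj (hn'.trans_le (hwf.nodes_le κ)) (hn.trans_le (hwf.nodes_le κ))]
    exact hne
  · rw [take_bxor, ← bxor_take_right (y := List.take _ (pad h.node)) le_rfl]
    congr 1
    rw [elem, List.append_assoc, List.append_assoc, List.take_left]

end Scheme

end Ariadne

/-! ### Delivery of packets along the path -/

namespace Ariadne

theorem hops_map_node (z : List (ℕ × ℕ)) : (hops z).map Hop.node = z.map Prod.fst := by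
  induction z with
  | nil => rfl
  | cons a z ih =>
    cases z with
    | nil => rfl
    | cons b l => rw [hops, List.map_cons, ih]; rfl

theorem hops_map_slot (z : List (ℕ × ℕ)) : (hops z).map Hop.slot = z.map Prod.snd := by
  induction z with
  | nil => rfl
  | cons a z ih =>
    cases z with
    | nil => rfl
    | cons b l => rw [hops, List.map_cons, ih]; rfl

theorem List.findSome?_eq_of_unique {α β : Type} {l : List α} {f : α → Option β} {a : α} {b : β}
    (ha : a ∈ l) (hb : f a = some b) (h : ∀ x ∈ l, x ≠ a → f x = none) : l.findSome? f = some b :=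
        by
  induction l with
  | nil => simp at ha
  | cons x l ih =>
    rw [List.findSome?_cons]
    by_cases hx : x = a
    · rw [hx, hb]
    · rw [h x (by simp) hx]
      exact ih ((List.mem_cons.1 ha).resolve_left (Ne.symm hx)) fun y hy => h y (by simp [hy])

namespace Scheme

variable (S : Scheme) (κ : ℕ)

/-- No line of the table of `v`, except possibly that of `s` and `t`, opens the packet. -/
def Silent (P M : ℕ → ℕ → ℕ → List Bool) (s t v : ℕ) (p : ℕ) (body : List Bool) : Prop :=
  ∀ s' < S.nodes κ, ∀ t' < S.window κ, (s', t') ≠ (s, t) →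
    S.openAt κ v (P s' v t') (M s' v t') p body = none

/-- The `n`-th packet on the path `z`, given as a list of (node, slot). -/
def nominal (pad mk : ℕ → List Bool) (pay : List Bool) (z : List (ℕ × ℕ)) (R : List Bool) (n : ℕ) :
    Packet :=
  ⟨natBits (S.addrLen κ) (z.getD n (0, 0)).1, natBits (S.ptrLen κ) (z.getD n (0, 0)).2,
    S.stage κ pad mk pay ((hops z).drop n) (((hops z).take n).foldl (S.fillPad κ pad) R)⟩

/-- All entries of the tables have the right lengths. -/
def GoodTables (P M : ℕ → ℕ → ℕ → List Bool) : Prop :=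
  ∀ s v t, s < S.nodes κ → v < S.nodes κ → t < S.window κ →
    (P s v t).length = S.padLen κ ∧ (M s v t).length = κ

variable {S κ} {P M : ℕ → ℕ → ℕ → List Bool}

theorem processPad_of_openAt (hwf : S.WellFormed) {s t v p : ℕ} {pkt : Packet} {o : Outcome}
    (hs : s < S.nodes κ) (ht : t < S.window κ) (hp : p < S.slots κ)
    (hptr : pkt.ptr = natBits (S.ptrLen κ) p) (hbody : pkt.body.length = S.fullLen κ)
    (ho : S.openAt κ v (P s v t) (M s v t) p pkt.body = some o)
    (hsil : S.Silent κ P M s t v p pkt.body) : S.processPad κ P M v pkt = o := by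
  rw [processPad, hptr, findIndex_natBits (hwf.slots_le κ) hp]
  simp only [Option.elim, if_pos hbody]
  rw [List.findSome?_eq_of_unique (a := (s, t)) (b := o)]
  · rfl
  · exact List.mem_product.2 ⟨List.mem_range.2 hs, List.mem_range.2 ht⟩
  · exact ho
  · rintro ⟨s', t'⟩ hmem hne
    replace hmem := List.mem_product.1 hmem
    exact hsil s' (List.mem_range.1 hmem.1) t' (List.mem_range.1 hmem.2) hne

theorem processPad_eq_drop {v : ℕ} {pkt : Packet}
    (h : ∀ p, p < S.slots κ → pkt.body.length = S.fullLen κ →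
      findIndex (S.ptrLen κ) (S.slots κ) pkt.ptr = some p →
      ∀ s < S.nodes κ, ∀ t < S.window κ, S.openAt κ v (P s v t) (M s v t) p pkt.body = none) :
    S.processPad κ P M v pkt = .drop := by
  rw [processPad]
  cases hf : findIndex (S.ptrLen κ) (S.slots κ) pkt.ptr with
  | none => rfl
  | some p =>
    simp only [Option.elim]
    split_ifs with hb
    · rw [List.findSome?_eq_none_iff.2]
      · rfl
      · rintro ⟨s, t⟩ hmem
        have := List.mem_product.1 hmem
        exact h p (findIndex_eq_some hf).1 hb hf s (List.mem_range.1 this.1) t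
          (List.mem_range.1 this.2)
    · rfl

theorem fits_hops {s t : ℕ} {z : List (ℕ × ℕ)} (hG : S.GoodTables κ P M) (hs : s < S.nodes κ)
    (ht : t < S.window κ) (hnode : ∀ a ∈ z, a.1 < S.nodes κ) (hslot : ∀ a ∈ z, a.2 < S.slots κ) :
    S.Fits κ (fun v => P s v t) (fun v => M s v t) (hops z) := by
  have h1 : ∀ h ∈ hops z, h.node < S.nodes κ := by
    intro h hh
    have := List.mem_map_of_mem (f := Hop.node) hh
    rw [hops_map_node] at this
    obtain ⟨x, hx, hx'⟩ := List.mem_map.1 this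
    rw [← hx']; exact hnode x hx
  refine ⟨fun h hh => (hG s _ t hs (h1 h hh) ht).1, fun h hh => (hG s _ t hs (h1 h hh) ht).2,
    fun h hh => ?_⟩
  have := List.mem_map_of_mem (f := Hop.slot) hh
  rw [hops_map_slot] at this
  obtain ⟨x, hx, hx'⟩ := List.mem_map.1 this
  rw [← hx']; exact hslot x hx

/-- One step is `openAt_stage`, where `Silent` ensures that no competing line of the table comes
first. What leaves the node is the initial nominal packet of the rest of the path, for the initial
vector after one step of filling, so the induction runs with varying `R`. -/
theorem relayPad_nominal (hwf : S.WellFormed) {s t : ℕ} {pay : List Bool} (n : ℕ)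
    {z : List (ℕ × ℕ)} {R : List Bool} (hG : S.GoodTables κ P M) (hs : s < S.nodes κ)
    (ht : t < S.window κ) (hn : n < z.length) (hnodes : (z.map Prod.fst).Nodup)
    (hslots : (z.map Prod.snd).Nodup) (hnode : ∀ a ∈ z, a.1 < S.nodes κ)
    (hslot : ∀ a ∈ z, a.2 < S.slots κ) (hR : R.length = S.vecLen κ)
    (hpay : pay.length = S.payloadLen κ)
    (hsil : ∀ i < n, S.Silent κ P M s t (z.getD i (0, 0)).1 (z.getD i (0, 0)).2
      (S.nominal κ (fun v => P s v t) (fun v => M s v t) pay z R i).body) :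
    S.relayPad κ P M ((z.take n).map Prod.fst)
        (S.nominal κ (fun v => P s v t) (fun v => M s v t) pay z R 0)
      = some (S.nominal κ (fun v => P s v t) (fun v => M s v t) pay z R n) := by
  induction n generalizing z R with
  | zero => rfl
  | succ n ih =>
    obtain ⟨a, b, l, rfl⟩ : ∃ a b l, z = a :: b :: l := by
      match z, hn with
      | a :: b :: l, _ => exact ⟨a, b, l, rfl⟩
    have hfits := fits_hops hG hs ht hnode hslot
    have hstep : S.processPad κ P M a.1 (S.nominal κ (fun v => P s v t) (fun v => M s v t) pay
        (a :: b :: l) R 0) = .forward (S.nominal κ (fun v => P s v t) (fun v => M s v t) pay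
        (b :: l) (S.fillPad κ (fun v => P s v t) R ⟨a.1, a.2, b.1, b.2⟩) 0) := by
      refine processPad_of_openAt hwf hs ht (hslot a (by simp)) rfl ?_ ?_ (hsil 0 (by omega))
      · exact length_stage hwf hfits hR hpay
      · refine openAt_stage (pad := fun v => P s v t) (mk := fun v => M s v t) hwf hfits hR hpay ?_
          (hnode a (by simp)) (hnode b (by simp)) ?_
        · intro k hk h
          have := List.mem_map_of_mem (f := Hop.slot) hk
          rw [hops_map_slot, h] at this
          exact (List.nodup_cons.1 hslots).1 this
        · intro h
          refine (List.nodup_cons.1 hnodes).1 ?_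
          rw [List.map_cons]
          exact List.mem_cons.2 (Or.inl h.symm)
    have hrec := ih (z := b :: l) (R := S.fillPad κ (fun v => P s v t) R ⟨a.1, a.2, b.1, b.2⟩)
      (by simpa using hn) (List.nodup_cons.1 hnodes).2 (List.nodup_cons.1 hslots).2
      (fun x hx => hnode x (List.mem_cons_of_mem _ hx))
      (fun x hx => hslot x (List.mem_cons_of_mem _ hx))
      (length_fillPad (hfits.pad_length _ (by rw [hops]; simp)) (hslot a (by simp)) hR)
      fun i hi => hsil (i + 1) (by omega)
    rw [List.take_succ_cons, List.map_cons, relayPad, List.foldl_cons, Option.elim, hstep]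
    exact hrec

theorem buildPad_eq_nominal {pad mk : ℕ → List Bool} {path slots : List ℕ} {payload R : List Bool}
    (hpath : path ≠ []) (hslots : slots ≠ []) :
    S.buildPad κ pad mk path payload R slots
      = S.nominal κ pad mk (S.padded κ payload) (path.zip slots) R 0 := by
  obtain ⟨a, l, rfl⟩ := List.exists_cons_of_ne_nil hpath
  obtain ⟨b, m, rfl⟩ := List.exists_cons_of_ne_nil hslots
  rfl

/-- A list of all slots, in some order. -/
structure IsSlotList (S : Scheme) (κ : ℕ) (σ : List ℕ) : Prop where
  length_eq : σ.length = S.slots κ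
  nodup : σ.Nodup
  lt : ∀ x ∈ σ, x < S.slots κ

theorem zip_slots_mem {path σ : List ℕ} (hpath : ∀ v ∈ path, v < S.nodes κ)
    (hσ : S.IsSlotList κ σ) {a : ℕ × ℕ} (ha : a ∈ path.zip σ) :
    a.1 < S.nodes κ ∧ a.2 < S.slots κ :=
  ⟨hpath _ (List.of_mem_zip ha).1, hσ.lt _ (List.of_mem_zip ha).2⟩

theorem getD_zip {path σ : List ℕ} {i : ℕ} (hi : i < path.length) (hi' : i < σ.length) :
    (path.zip σ).getD i (0, 0) = (path.getD i 0, σ.getD i 0) := by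
  simp [List.getD_eq_getElem?_getD, List.zip, hi, hi']

/-- The packet as it leaves the honest router. -/
theorem linkView_relayPad (hwf : S.WellFormed) {s t j : ℕ} {before after : List ℕ}
    {payload R : List Bool} {σ : List ℕ} (hG : S.GoodTables κ P M) (ht : t < S.window κ)
    (hafter : after ≠ []) (hpath : ValidPath S κ s (before ++ j :: after))
    (hpay : payload.length ≤ S.payloadLen κ) (hR : R.length = S.vecLen κ)
    (hσ : S.IsSlotList κ σ)
    (hsil : ∀ i ≤ before.length, S.Silent κ P M s t ((before ++ j :: after).getD i 0) (σ.getD i 0)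
      (S.nominal κ (fun v => P s v t) (fun v => M s v t) (S.padded κ payload)
        ((before ++ j :: after).zip σ) R i).body) :
    linkView (S.relayPad κ P M (before ++ [j])
      (S.buildPad κ (fun v => P s v t) (fun v => M s v t) (before ++ j :: after) payload R σ)) =
    (S.nominal κ (fun v => P s v t) (fun v => M s v t) (S.padded κ payload)
        ((before ++ j :: after).zip σ) R (before.length + 1)).toTree := by
  obtain ⟨hnd, hlt, hle⟩ := hpath
  rw [← hσ.length_eq] at hle
  set path := before ++ j :: after with hp
  set z := path.zip σ with hz
  have hfst : z.map Prod.fst = path := List.map_fst_zip hle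
  have hsnd : z.map Prod.snd = σ.take path.length := by
    refine List.ext_getElem? fun i => ?_
    simp only [hz, List.getElem?_map, List.getElem?_take]
    by_cases hi : i < path.length
    · have hi' : i < σ.length := by omega
      simp [hi, hi', List.zip]
    · simp [hi, List.zip, Option.map]
  have hpos : 0 < path.length := by rw [hp]; simp
  have hlen : z.length = path.length := by rw [← hfst, List.length_map]
  have hgetD : ∀ i < path.length, z.getD i (0, 0) = (path.getD i 0, σ.getD i 0) :=
    fun i hi => getD_zip hi (by omega)
  have hal : 0 < after.length := List.length_pos_iff.2 hafter
  have hlen' : path.length = before.length + (after.length + 1) := by rw [hp]; simp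
  have key := relayPad_nominal (P := P) (M := M) (κ := κ) hwf (s := s) (t := t)
    (pay := S.padded κ payload) (before.length + 1) (z := z) (R := R)
    hG (hlt s (by simp)) ht (by omega) (by rw [hfst]; exact (List.nodup_cons.1 hnd).2)
    (by rw [hsnd]; exact hσ.nodup.sublist (List.take_sublist _ _))
    (fun a ha => (zip_slots_mem (fun v hv => hlt v (List.mem_cons_of_mem _ hv)) hσ ha).1)
    (fun a ha => (zip_slots_mem (fun v hv => hlt v (List.mem_cons_of_mem _ hv)) hσ ha).2) hR
    (by simp [padded, hpay])
    (fun i hi => by rw [hgetD i (by omega)]; exact hsil i (by omega))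
  have htake : (z.take (before.length + 1)).map Prod.fst = before ++ [j] := by
    rw [List.map_take, hfst, hp, List.take_append]; simp
  rw [htake] at key
  rw [buildPad_eq_nominal (by rw [hp]; simp) (by
    intro h; rw [h, List.length_nil] at hle; omega), key]
  rfl

end Scheme

end Ariadne

namespace Ariadne
open scoped BigOperators

/-! ### Averages over translations -/

theorem bxor_ofFn {n : ℕ} (x y : Fin n → Bool) :
    bxor (List.ofFn x) (List.ofFn y) = List.ofFn fun i => (x i).xor (y i) := by
  refine List.ext_getElem (by simp [bxor]) fun i h₁ h₂ => ?_
  simp [bxor]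

/-- The one-time pad: translation by a fixed string is a bijection. -/
theorem avgBits_bxor {n : ℕ} {x : List Bool} (hx : x.length = n) (F : List Bool → ℝ) :
    avgBits n (fun y => F (bxor x y)) = avgBits n F := by
  subst hx
  unfold avgBits
  have hinv : Function.Involutive fun (y : Fin x.length → Bool) i => (x.get i).xor (y i) := by
    intro y
    funext i
    simp
  refine Fintype.expect_equiv hinv.toPerm _ _ fun y => ?_
  change _ = F (List.ofFn fun i => (x.get i).xor (y i))
  rw [← bxor_ofFn, List.ofFn_get]

theorem avgBits_expect {Ω : Type} [Fintype Ω] (n : ℕ) (F : Ω → List Bool → ℝ) :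
    avgBits n (fun x => 𝔼 ω, F ω x) = 𝔼 ω, avgBits n (F ω) := Finset.expect_comm _ _ _

theorem avgBits_comm (m n : ℕ) (F : List Bool → List Bool → ℝ) :
    avgBits m (fun x => avgBits n (F x)) = avgBits n fun y => avgBits m fun x => F x y :=
  Finset.expect_comm _ _ _

open Classical in
/-- The indicator of a proposition. -/
noncomputable def indProp (p : Prop) : ℝ := if p then 1 else 0

theorem indProp_of {p : Prop} (h : p) : indProp p = 1 := if_pos h

theorem indProp_of_not {p : Prop} (h : ¬ p) : indProp p = 0 := if_neg h

theorem indProp_nonneg (p : Prop) : 0 ≤ indProp p := by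
  by_cases h : p
  · rw [indProp_of h]; norm_num
  · rw [indProp_of_not h]

open Classical in
-- At most one of the `2 ^ n` strings satisfies the condition.
theorem avgBits_unique {n : ℕ} {p : List Bool → Prop}
    (h : ∀ x y, x.length = n → y.length = n → p x → p y → x = y) :
    avgBits n (fun x => indProp (p x)) ≤ (1 / 2) ^ n := by
  unfold avgBits indProp
  rw [Fintype.expect_eq_sum_div_card, Finset.sum_boole]
  have h2 : (Finset.univ.filter fun x : Fin n → Bool => p (List.ofFn x)).card ≤ 1 := by
    refine Finset.card_le_one.2 fun x hx y hy => List.ofFn_injective ?_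
    exact h _ _ (by simp) (by simp) (Finset.mem_filter.1 hx).2 (Finset.mem_filter.1 hy).2
  rw [div_pow, one_pow]
  simp only [Fintype.card_pi, Fintype.card_bool, Finset.prod_const, Finset.card_univ,
    Fintype.card_fin, Nat.cast_pow, Nat.cast_ofNat]
  gcongr
  exact_mod_cast h2

/-! ### Random tables -/

/-- The table with the given entries. -/
def randTable (N q : ℕ) {n : ℕ} (u : Fin (N * N * q) → Fin n → Bool) : ℕ → ℕ → ℕ → List Bool :=
  table N q ((List.range (N * N * q)).map (blocks u))

theorem index_lt {N q s v t : ℕ} (hs : s < N) (hv : v < N) (ht : t < q) :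
    (s * N + v) * q + t < N * N * q := by
  have h1 : s * N + v + 1 ≤ N * N := by
    have := Nat.mul_le_mul_right N hs
    rw [Nat.succ_mul] at this; omega
  have := Nat.mul_le_mul_right q h1
  rw [Nat.succ_mul] at this; omega

theorem index_inj {N q s v t s' v' t' : ℕ} (hv : v < N) (ht : t < q) (hv' : v' < N) (ht' : t' < q) :
    (s * N + v) * q + t = (s' * N + v') * q + t' ↔ s = s' ∧ v = v' ∧ t = t' := by
  have key : ∀ {a b c d m : ℕ}, b < m → d < m → a * m + b = c * m + d → a = c ∧ b = d := by
    intro a b c d m hb hd h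
    have h1 := congrArg (· / m) h
    have h2 := congrArg (· % m) h
    simp only [Nat.mul_comm _ m, Nat.mul_add_div (by omega : m > 0), Nat.mul_add_mod,
      Nat.div_eq_of_lt hb, Nat.div_eq_of_lt hd, Nat.mod_eq_of_lt hb, Nat.mod_eq_of_lt hd] at h1 h2
    exact ⟨by omega, h2⟩
  constructor
  · intro h
    obtain ⟨h1, h2⟩ := key ht ht' h
    obtain ⟨h3, h4⟩ := key hv hv' h1
    exact ⟨h3, h4, h2⟩
  · rintro ⟨rfl, rfl, rfl⟩; rfl

theorem randTable_apply {N q n s v t : ℕ} (u : Fin (N * N * q) → Fin n → Bool) (hs : s < N)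
    (hv : v < N) (ht : t < q) :
    randTable N q u s v t = List.ofFn (u ⟨(s * N + v) * q + t, index_lt hs hv ht⟩) := by
  have h := index_lt hs hv ht
  rw [randTable, table, if_pos ⟨hs, hv, ht⟩, List.getD_eq_getElem?_getD, List.getElem?_map,
    List.getElem?_range h]
  simp [blocks, h]

theorem length_randTable {N q n s v t : ℕ} (u : Fin (N * N * q) → Fin n → Bool) (hs : s < N)
    (hv : v < N) (ht : t < q) : (randTable N q u s v t).length = n := by
  rw [randTable_apply u hs hv ht, List.length_ofFn]

/-- Change one entry of a table. -/
def shift (P : ℕ → ℕ → ℕ → List Bool) (s v t : ℕ) (d : List Bool) (s' v' t' : ℕ) : List Bool :=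
  if s' = s ∧ v' = v ∧ t' = t then bxor (P s v t) d else P s' v' t'

theorem shift_self (P : ℕ → ℕ → ℕ → List Bool) (s v t : ℕ) (d : List Bool) :
    shift P s v t d s v t = bxor (P s v t) d := by simp [shift]

theorem shift_of_ne {P : ℕ → ℕ → ℕ → List Bool} {s v t s' v' t' : ℕ} {d : List Bool}
    (h : ¬ (s' = s ∧ v' = v ∧ t' = t)) : shift P s v t d s' v' t' = P s' v' t' := if_neg h

theorem exists_shift {N q n s v t : ℕ} (hs : s < N) (hv : v < N) (ht : t < q) {d : List Bool}
    (hd : d.length = n) : ∃ e : Equiv.Perm (Fin (N * N * q) → Fin n → Bool),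
      ∀ u, randTable N q (e u) = shift (randTable N q u) s v t d := by
  subst hd
  set i : Fin (N * N * q) := ⟨(s * N + v) * q + t, index_lt hs hv ht⟩ with hi
  have hinv : Function.Involutive fun (u : Fin (N * N * q) → Fin d.length → Bool) =>
      Function.update u i fun k => (u i k).xor (d.get k) := by
    intro u
    funext j k
    by_cases hj : j = i
    · subst hj; simp
    · simp [hj]
  refine ⟨hinv.toPerm, fun u => ?_⟩
  change randTable N q (Function.update u i fun k => (u i k).xor (d.get k)) = _
  funext s' v' t'
  by_cases hr : s' < N ∧ v' < N ∧ t' < q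
  · obtain ⟨hs', hv', ht'⟩ := hr
    rw [randTable_apply _ hs' hv' ht', shift, randTable_apply _ hs' hv' ht',
      randTable_apply _ hs hv ht]
    split_ifs with h
    · obtain ⟨rfl, rfl, rfl⟩ := h
      rw [Function.update_self, ← bxor_ofFn, List.ofFn_get]
    · rw [Function.update_of_ne]
      intro h'
      exact h ((index_inj hv' ht' hv ht).1 (congrArg Fin.val h'))
  · rw [shift, if_neg, randTable, table, if_neg hr, randTable, table, if_neg hr]
    rintro ⟨rfl, rfl, rfl⟩
    exact hr ⟨hs, hv, ht⟩

/-- Adding a fixed string to one entry permutes the tables. Both halves of the information-theoretic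
argument rest on this: masks on the tag bits show that packets are rejected, masks on two adjacent
nodes show that the outgoing packet is uniform. -/
theorem expect_shift {N q n s v t : ℕ} (hs : s < N) (hv : v < N) (ht : t < q) {d : List Bool}
    (hd : d.length = n) (F : (ℕ → ℕ → ℕ → List Bool) → ℝ) :
    𝔼 u : Fin (N * N * q) → Fin n → Bool, F (shift (randTable N q u) s v t d) =
      𝔼 u : Fin (N * N * q) → Fin n → Bool, F (randTable N q u) := by
  obtain ⟨e, he⟩ := exists_shift hs hv ht hd
  exact Fintype.expect_equiv e _ _ fun u => by rw [he]

namespace Scheme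

variable {S : Scheme} {κ : ℕ} {M : ℕ → ℕ → ℕ → List Bool}

variable (S κ) in
/-- The string that changes the part of the pad that blinds the tag. -/
def tagMask (δ : List Bool) : List Bool :=
  List.replicate (S.elemLen κ - κ) false ++ δ ++ List.replicate (S.fullLen κ) false

theorem le_elemLen : κ ≤ S.elemLen κ := by rw [elemLen]; omega

theorem length_tagMask {δ : List Bool} (hδ : δ.length = κ) :
    (S.tagMask κ δ).length = S.padLen κ := by
  have := le_elemLen (S := S) (κ := κ)
  simp only [tagMask, List.length_append, List.length_replicate, hδ, padLen]; omega

theorem drop_tagMask {δ : List Bool} (hδ : δ.length = κ) :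
    (S.tagMask κ δ).drop (S.elemLen κ) = List.replicate (S.fullLen κ) false := by
  have := le_elemLen (S := S) (κ := κ)
  rw [tagMask, List.drop_left']
  simp only [List.length_append, List.length_replicate, hδ]; omega

theorem take_tagMask {δ : List Bool} (hδ : δ.length = κ) :
    (S.tagMask κ δ).take (S.elemLen κ) = List.replicate (S.elemLen κ - κ) false ++ δ := by
  have := le_elemLen (S := S) (κ := κ)
  rw [tagMask, List.take_left']
  simp only [List.length_append, List.length_replicate, hδ]; omega

/-- The packet is opened for at most one change of the part of the pad that blinds the tag. -/
theorem openAt_unique {v p : ℕ} {pad mk body : List Bool} (hpad : pad.length = S.padLen κ)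
    (hp : p < S.slots κ) (hbody : body.length = S.fullLen κ) {δ δ' : List Bool}
    (hδ : δ.length = κ) (hδ' : δ'.length = κ)
    (h : S.openAt κ v (bxor pad (S.tagMask κ δ)) mk p body ≠ none)
    (h' : S.openAt κ v (bxor pad (S.tagMask κ δ')) mk p body ≠ none) : δ = δ' := by
  have hle := le_elemLen (S := S) (κ := κ)
  have hc : (S.getSlot κ p body).length = S.elemLen κ :=
    length_getSlot (by rw [hbody]; exact (slot_le hp).trans vecLen_le)
  have hpe := length_take_pad hpad
  -- Acceptance equates a MAC value that does not involve `δ` with the unblinded tag plus `δ`: the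
  -- mask vanishes before the tag, and the tag field is zeroed before the MAC is computed. Two
  -- accepted masks therefore coincide.
  have key : ∀ δ : List Bool, δ.length = κ →
      S.openAt κ v (bxor pad (S.tagMask κ δ)) mk p body ≠ none →
      S.mac κ mk (S.putSlot κ p ((bxor (S.getSlot κ p body) (pad.take (S.elemLen κ))).take
        (S.elemLen κ - κ) ++ List.replicate κ false) body) =
      bxor ((bxor (S.getSlot κ p body) (pad.take (S.elemLen κ))).drop (S.elemLen κ - κ)) δ := by
    intro δ hδ h
    have hr : bxor (S.getSlot κ p body) ((bxor pad (S.tagMask κ δ)).take (S.elemLen κ)) =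
        bxor (bxor (S.getSlot κ p body) (pad.take (S.elemLen κ)))
          (List.replicate (S.elemLen κ - κ) false ++ δ) := by
      rw [take_bxor, take_tagMask hδ, bxor_assoc]
    simp only [openAt, hr] at h
    split_ifs at h with h1 h2
    all_goals first
    | exact absurd rfl h
    | skip
    all_goals
      rw [take_bxor, drop_bxor, List.take_left' (by simp), List.drop_left' (by simp),
        bxor_zero (by simp)] at h2
      exact h2
  have h1 := (key δ hδ h).symm.trans (key δ' hδ' h')
  have hd : ((bxor (S.getSlot κ p body) (pad.take (S.elemLen κ))).drop (S.elemLen κ - κ)).length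
      = κ := by
    rw [List.length_drop, length_bxor, hc, hpe]; omega
  exact bxor_right_injective (by rw [hd, hδ]) (by rw [hd, hδ']) h1

variable (S κ M) in
/-- The line of `v` for `s` and `t` opens the packet. -/
def Hit (P : ℕ → ℕ → ℕ → List Bool) (v s t : ℕ) (pkt : Packet) : Prop :=
  ∃ p, findIndex (S.ptrLen κ) (S.slots κ) pkt.ptr = some p ∧ pkt.body.length = S.fullLen κ ∧
    S.openAt κ v (P s v t) (M s v t) p pkt.body ≠ none

theorem processPad_eq_drop_of_not_hit {P : ℕ → ℕ → ℕ → List Bool} {v : ℕ} {pkt : Packet}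
    (h : ∀ s < S.nodes κ, ∀ t < S.window κ, ¬ S.Hit κ M P v s t pkt) :
    S.processPad κ P M v pkt = .drop :=
  processPad_eq_drop fun p _ hb hf s hs t ht =>
    by_contra fun h' => h s hs t ht ⟨p, hf, hb, h'⟩

variable {q : ℕ}

/-- The tag bits of the entry are rerandomized by a fresh `δ`. The packet `Q` may depend on the
pads, but `hQ` says that it does not see this change, so `openAt_unique` leaves at most one `δ` for
every table. -/
theorem expect_hit_le {v s t : ℕ} (hs : s < S.nodes κ) (hv : v < S.nodes κ) (ht : t < q)
    (Q : (ℕ → ℕ → ℕ → List Bool) → Packet)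
    (hQ : ∀ (u : Fin (S.nodes κ * S.nodes κ * q) → Fin (S.padLen κ) → Bool) (δ : List Bool),
      δ.length = κ → Q (shift (randTable (S.nodes κ) q u) s v t (S.tagMask κ δ))
        = Q (randTable (S.nodes κ) q u)) :
    𝔼 u : Fin (S.nodes κ * S.nodes κ * q) → Fin (S.padLen κ) → Bool,
      indProp (S.Hit κ M (randTable (S.nodes κ) q u) v s t (Q (randTable (S.nodes κ) q u)))
      ≤ (1 / 2) ^ κ := by
  rw [← avgBits_const κ (𝔼 u : Fin (S.nodes κ * S.nodes κ * q) → Fin (S.padLen κ) → Bool,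
      indProp (S.Hit κ M (randTable (S.nodes κ) q u) v s t (Q (randTable (S.nodes κ) q u))))]
  rw [avgBits_congr fun δ hδ => (expect_shift hs hv ht (length_tagMask (S := S) hδ)
    fun P => indProp (S.Hit κ M P v s t (Q P))).symm, avgBits_expect]
  rw [← Fintype.expect_const (ι := Fin (S.nodes κ * S.nodes κ * q) → Fin (S.padLen κ) → Bool)
    ((1 / 2 : ℝ) ^ κ)]
  refine Finset.expect_le_expect fun u _ => avgBits_unique fun δ δ' hδ hδ' h h' => ?_
  rw [hQ u δ hδ] at h
  rw [hQ u δ' hδ'] at h'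
  obtain ⟨p, hp, hb, ho⟩ := h
  obtain ⟨p', hp', -, ho'⟩ := h'
  obtain rfl : p = p' := by rw [hp] at hp'; exact Option.some.inj hp'
  rw [shift_self] at ho ho'
  exact openAt_unique (length_randTable u hs hv ht) (findIndex_eq_some hp).1 hb hδ hδ' ho ho'

/-- Union bound over packets and lines. The predicate `ok` selects the lines that count: for queries
all of them, for a packet on its way all but the intended one. -/
theorem expect_exists_hit_le (K : ℕ) (v : ℕ → ℕ) (ok : ℕ → ℕ → Prop) (hW : S.window κ ≤ q)
    (hv : ∀ i < K, v i < S.nodes κ) (Q : ℕ → (ℕ → ℕ → ℕ → List Bool) → Packet)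
    (hQ : ∀ i < K, ∀ s < S.nodes κ, ∀ t < S.window κ, ok s t →
      ∀ (u : Fin (S.nodes κ * S.nodes κ * q) → Fin (S.padLen κ) → Bool) (δ : List Bool),
      δ.length = κ → Q i (shift (randTable (S.nodes κ) q u) s (v i) t (S.tagMask κ δ))
        = Q i (randTable (S.nodes κ) q u)) :
    𝔼 u : Fin (S.nodes κ * S.nodes κ * q) → Fin (S.padLen κ) → Bool,
      indProp (∃ i < K, ∃ s < S.nodes κ, ∃ t < S.window κ, ok s t ∧
        S.Hit κ M (randTable (S.nodes κ) q u) (v i) s t (Q i (randTable (S.nodes κ) q u)))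
      ≤ (K * S.nodes κ * S.window κ : ℕ) * (1 / 2 : ℝ) ^ κ := by
  set I := Finset.range K ×ˢ Finset.range (S.nodes κ) ×ˢ Finset.range (S.window κ) with hI
  have hcard : I.card = K * S.nodes κ * S.window κ := by
    rw [hI, Finset.card_product, Finset.card_product]; simp [Nat.mul_assoc]
  calc _ ≤ 𝔼 u : Fin (S.nodes κ * S.nodes κ * q) → Fin (S.padLen κ) → Bool,
        ∑ x ∈ I, indProp (ok x.2.1 x.2.2 ∧ S.Hit κ M (randTable (S.nodes κ) q u) (v x.1) x.2.1
          x.2.2 (Q x.1 (randTable (S.nodes κ) q u))) := by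
        refine Finset.expect_le_expect fun u _ => ?_
        by_cases h : ∃ i < K, ∃ s < S.nodes κ, ∃ t < S.window κ, ok s t ∧
          S.Hit κ M (randTable (S.nodes κ) q u) (v i) s t (Q i (randTable (S.nodes κ) q u))
        · obtain ⟨i, hi, s, hs, t, ht, h'⟩ := h
          rw [indProp_of ⟨i, hi, s, hs, t, ht, h'⟩]
          have hmem : (i, s, t) ∈ I := by simp [hI, hi, hs, ht]
          refine le_trans ?_ (Finset.single_le_sum (fun x _ => indProp_nonneg _) hmem)
          rw [indProp_of h']
        · rw [indProp_of_not h]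
          exact Finset.sum_nonneg fun x _ => indProp_nonneg _
    _ = ∑ x ∈ I, 𝔼 u : Fin (S.nodes κ * S.nodes κ * q) → Fin (S.padLen κ) → Bool,
        indProp (ok x.2.1 x.2.2 ∧ S.Hit κ M (randTable (S.nodes κ) q u) (v x.1) x.2.1
          x.2.2 (Q x.1 (randTable (S.nodes κ) q u))) := Finset.expect_sum_comm _ _ _
    _ ≤ ∑ x ∈ I, (1 / 2 : ℝ) ^ κ := by
        refine Finset.sum_le_sum fun x hx => ?_
        obtain ⟨h1, h2⟩ := Finset.mem_product.1 hx
        obtain ⟨h3, h4⟩ := Finset.mem_product.1 h2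
        rw [Finset.mem_range] at h1 h3 h4
        by_cases hok : ok x.2.1 x.2.2
        · simp only [hok, true_and]
          exact expect_hit_le h3 (hv _ h1) (h4.trans_le hW) (Q x.1) fun u δ hδ =>
            hQ _ h1 _ h3 _ h4 hok u δ hδ
        · simp only [hok, false_and, indProp_of_not not_false]
          rw [Fintype.expect_const]
          positivity
    _ = _ := by rw [Finset.sum_const, hcard, nsmul_eq_mul]

end Scheme

end Ariadne

/-! ### The bad events: misrouted packets and accepted queries -/

namespace Ariadne
open scoped BigOperators

namespace Scheme

variable {S : Scheme} {κ : ℕ}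

theorem foldl_fillPad_congr {pad pad' : ℕ → List Bool} {hs : List Hop} (R : List Bool)
    (h : ∀ k ∈ hs, (pad k.node).drop (S.elemLen κ) = (pad' k.node).drop (S.elemLen κ)) :
    hs.foldl (S.fillPad κ pad) R = hs.foldl (S.fillPad κ pad') R := by
  induction hs generalizing R with
  | nil => rfl
  | cons k hs ih =>
    rw [List.foldl_cons, List.foldl_cons, ih _ fun k hk => h k (List.mem_cons_of_mem _ hk), fillPad,
      fillPad, h k (by simp)]

theorem stage_congr {pad pad' mk : ℕ → List Bool} {pay : List Bool} {hs : List Hop} (R : List Bool)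
    (h : ∀ k ∈ hs, pad k.node = pad' k.node) :
    S.stage κ pad mk pay hs R = S.stage κ pad' mk pay hs R := by
  rw [stage, foldl_fillPad_congr R fun k hk => by rw [h k hk], stage]
  generalize hs.foldl (S.fillPad κ pad') R ++ pay = X
  induction hs with
  | nil => rfl
  | cons k hs ih =>
    rw [List.foldr_cons, List.foldr_cons, ih fun k hk => h k (List.mem_cons_of_mem _ hk), wrapPad,
      wrapPad, h k (by simp)]

/-- The packet with index `t` from source `s` as it leaves the router `j`. -/
def outPacket (S : Scheme) (κ : ℕ) (P M : ℕ → ℕ → ℕ → List Bool) (s t j : ℕ)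
    (before after : List ℕ) (payload R : List Bool) (σ : List ℕ) : Packet :=
  S.nominal κ (fun v => P s v t) (fun v => M s v t) (S.padded κ payload)
    ((before ++ j :: after).zip σ) R (before.length + 1)

theorem shift_entry_of_ne {P : ℕ → ℕ → ℕ → List Bool} {s t s' v' t' : ℕ} {d : List Bool}
    (h : (s', t') ≠ (s, t)) : (fun v => shift P s' v' t' d s v t) = fun v => P s v t := by
  funext v
  exact shift_of_ne fun h' => h (by rw [h'.1, h'.2.2])

variable {P M : ℕ → ℕ → ℕ → List Bool}

theorem hops_node_mem {path σ : List ℕ} {n : ℕ} {k : Hop} (hk : k ∈ (hops (path.zip σ)).drop n) :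
    k.node ∈ path.drop n := by
  have h := List.mem_map_of_mem (f := Hop.node) hk
  rw [List.map_drop, hops_map_node] at h
  have h2 : (path.zip σ).map Prod.fst = path.take (min path.length σ.length) := by
    refine List.ext_getElem (by simp) fun i h₁ h₂ => by simp
  rw [h2, List.drop_take] at h
  exact List.mem_of_mem_take h

/-- Behind the router, its pad is present only through the filler, and the filler uses only the bits
beyond the element part, where the mask is zero. The condition `hj` is needed because a later
occurrence of the router would use its element pad in a layer that is still there. Lines of another
source or index do not enter at all. -/
theorem outPacket_shift_tagMask {s t j s' t' : ℕ} {before after : List ℕ} {payload R : List Bool}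
    {σ : List ℕ} {δ : List Bool} (hδ : δ.length = κ) (hj : j ∉ after)
    (hP : (P s j t).length = S.padLen κ) :
    S.outPacket κ (shift P s' j t' (S.tagMask κ δ)) M s t j before after payload R σ =
      S.outPacket κ P M s t j before after payload R σ := by
  by_cases hst : (s', t') = (s, t)
  · obtain ⟨rfl, rfl⟩ := Prod.mk.inj hst
    have hne : ∀ v, v ≠ j → shift P s' j t' (S.tagMask κ δ) s' v t' = P s' v t' :=
      fun v hv => shift_of_ne fun h => hv h.2.1
    have hdrop : ∀ v, (shift P s' j t' (S.tagMask κ δ) s' v t').drop (S.elemLen κ)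
        = (P s' v t').drop (S.elemLen κ) := by
      intro v
      by_cases hv : v = j
      · rw [hv, shift_self, drop_bxor, drop_tagMask hδ, bxor_zero (length_drop_pad hP).le]
      · rw [hne v hv]
    rw [outPacket, nominal, foldl_fillPad_congr (pad' := fun v => P s' v t') _ fun k _ =>
      hdrop k.node, outPacket, nominal]
    congr 1
    refine stage_congr _ fun k hk => hne k.node ?_
    have hmem := hops_node_mem hk
    rw [List.drop_append, List.drop_eq_nil_of_le (by omega), List.nil_append,
      Nat.add_sub_cancel_left] at hmem
    intro h
    rw [h] at hmem
    exact hj hmem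
  · rw [outPacket, shift_entry_of_ne hst, outPacket]

theorem length_nominal_body (hwf : S.WellFormed) {s t : ℕ} {path σ : List ℕ} {pay R : List Bool}
    (hG : S.GoodTables κ P M) (hs : s < S.nodes κ) (ht : t < S.window κ)
    (hpath : ∀ v ∈ path, v < S.nodes κ) (hσ : S.IsSlotList κ σ) (hR : R.length = S.vecLen κ)
    (hpay : pay.length = S.payloadLen κ) (n : ℕ) :
    (S.nominal κ (fun v => P s v t) (fun v => M s v t) pay (path.zip σ) R n).body.length
      = S.fullLen κ := by
  have hf : S.Fits κ (fun v => P s v t) (fun v => M s v t) (hops (path.zip σ)) :=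
    fits_hops hG hs ht (fun a ha => (zip_slots_mem hpath hσ ha).1)
      fun a ha => (zip_slots_mem hpath hσ ha).2
  refine length_stage hwf ?_ (length_foldl_fillPad (mk := fun v => M s v t) ?_ hR) hpay
  · exact ⟨fun h hh => hf.pad_length h (List.mem_of_mem_drop hh),
      fun h hh => hf.mk_length h (List.mem_of_mem_drop hh),
      fun h hh => hf.slot_lt h (List.mem_of_mem_drop hh)⟩
  · exact ⟨fun h hh => hf.pad_length h (List.mem_of_mem_take hh),
      fun h hh => hf.mk_length h (List.mem_of_mem_take hh),
      fun h hh => hf.slot_lt h (List.mem_of_mem_take hh)⟩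

/-- A wrong line opens the packet on its way to the router `j`. -/
def Misrouted (S : Scheme) (κ : ℕ) (P M : ℕ → ℕ → ℕ → List Bool) (s t j : ℕ)
    (before after : List ℕ) (payload R : List Bool) (σ : List ℕ) : Prop :=
  ∃ i < before.length + 1, ∃ s' < S.nodes κ, ∃ t' < S.window κ, (s', t') ≠ (s, t) ∧
    S.Hit κ M P ((before ++ j :: after).getD i 0) s' t'
      (S.nominal κ (fun v => P s v t) (fun v => M s v t) (S.padded κ payload)
        ((before ++ j :: after).zip σ) R i)

theorem length_padded {payload : List Bool} (h : payload.length ≤ S.payloadLen κ) :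
    (S.padded κ payload).length = S.payloadLen κ := by
  simp [padded, h]

theorem linkView_of_not_misrouted (hwf : S.WellFormed) {s t j : ℕ} {before after : List ℕ}
    {payload R : List Bool} {σ : List ℕ} (hG : S.GoodTables κ P M) (ht : t < S.window κ)
    (hafter : after ≠ []) (hpath : ValidPath S κ s (before ++ j :: after))
    (hpay : payload.length ≤ S.payloadLen κ) (hR : R.length = S.vecLen κ)
    (hσ : S.IsSlotList κ σ) (h : ¬ S.Misrouted κ P M s t j before after payload R σ) :
    linkView (S.relayPad κ P M (before ++ [j])
      (S.buildPad κ (fun v => P s v t) (fun v => M s v t) (before ++ j :: after) payload R σ)) =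
    (S.outPacket κ P M s t j before after payload R σ).toTree := by
  refine linkView_relayPad hwf hG ht hafter hpath hpay hR hσ fun i hi s' hs' t' ht' hne => ?_
  by_contra ho
  refine h ⟨i, by omega, s', hs', t', ht', hne, σ.getD i 0, ?_, ?_, ho⟩
  · have hlen := hpath.2.2
    rw [List.length_append, List.length_cons, ← hσ.length_eq] at hlen
    have hi' : i < σ.length := by omega
    simp only [nominal]
    rw [getD_zip (by simp; omega) hi']
    refine findIndex_natBits (hwf.slots_le κ) (hσ.lt _ ?_)
    change σ.getD i 0 ∈ σ
    rw [List.getD_eq_getElem?_getD, List.getElem?_eq_getElem hi']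
    exact List.getElem_mem hi'
  · exact length_nominal_body hwf hG (hpath.2.1 s (by simp)) ht
      (fun v hv => hpath.2.1 v (List.mem_cons_of_mem _ hv)) hσ hR (length_padded hpay) i

variable {q : ℕ}

theorem goodTables_randTable (hW : S.window κ ≤ q)
    (hM : ∀ s v t, s < S.nodes κ → v < S.nodes κ → t < S.window κ → (M s v t).length = κ)
    (u : Fin (S.nodes κ * S.nodes κ * q) → Fin (S.padLen κ) → Bool) :
    S.GoodTables κ (randTable (S.nodes κ) q u) M := fun s v t hs hv ht =>
  ⟨length_randTable u hs hv (ht.trans_le hW), hM s v t hs hv ht⟩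

/-- The pads of a wrong line do not occur in the packet, so any change of them leaves the packet
fixed. The number of nodes up to the router is at most the number of slots. -/
theorem expect_misrouted_le {s t j : ℕ} {before after : List ℕ} {payload R : List Bool}
    {σ : List ℕ} (hW : S.window κ ≤ q) (hpath : ValidPath S κ s (before ++ j :: after)) :
    𝔼 u : Fin (S.nodes κ * S.nodes κ * q) → Fin (S.padLen κ) → Bool,
      indProp (S.Misrouted κ (randTable (S.nodes κ) q u) M s t j before after payload R σ) ≤
      (S.slots κ * S.nodes κ * S.window κ : ℕ) * (1 / 2 : ℝ) ^ κ := by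
  refine (expect_exists_hit_le (before.length + 1) (fun i => (before ++ j :: after).getD i 0)
    (fun s' t' => (s', t') ≠ (s, t)) hW (fun i hi => ?_)
    (fun i P => S.nominal κ (fun v => P s v t) (fun v => M s v t) (S.padded κ payload)
        ((before ++ j :: after).zip σ) R i) fun i _ s' _ t' _ hne u δ _ => ?_).trans ?_
  · refine hpath.2.1 _ (List.mem_cons_of_mem _ ?_)
    have hi' : i < (before ++ j :: after).length := by simp; omega
    rw [List.getD_eq_getElem?_getD, List.getElem?_eq_getElem hi']
    exact List.getElem_mem hi'
  · rw [shift_entry_of_ne hne]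
  · have h := hpath.2.2
    rw [List.length_append, List.length_cons] at h
    gcongr
    omega

end Scheme

/-- This disposes of adaptivity: if every query of the hypothetical run with empty answers gets an
empty answer, then the real run is that run. -/
theorem interact_of_nil {next : List Tree → Tree} {oracle : Tree → Tree} {n : ℕ} {as : List Tree}
    (h : ∀ i < n, oracle (next (as ++ List.replicate i .nil)) = .nil) :
    interact next oracle n as = as ++ List.replicate n .nil := by
  induction n generalizing as with
  | zero => simp [interact]
  | succ n ih =>
    have h0 := h 0 (by omega)
    rw [List.replicate_zero, List.append_nil] at h0
    rw [interact, h0, ih]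
    · simp [List.replicate_succ]
    · intro i hi
      have := h (i + 1) (by omega)
      rwa [List.replicate_succ, List.append_cons] at this

/-- The source of the second packet. -/
def Challenge.source₂ (c : Challenge) (b : Bool) : ℕ := bif b then c.source' else c.source

/-- The path of the second packet to the router. -/
def Challenge.before₂ (c : Challenge) (b : Bool) : List ℕ := bif b then c.before' else c.before

theorem Challenge.Valid.validPath₂ {S : Scheme} {κ j : ℕ} {g : Game} {c : Challenge}
    (h : c.Valid S κ g j) (b : Bool) : ValidPath S κ (c.source₂ b) (c.before₂ b ++ j :: c.after) :=
        by
  obtain ⟨_, _, _, _, h₁, h₂, _⟩ := h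
  cases b
  · exact h₁
  · exact h₂

section

variable (S : Scheme) (g : Game) (A : Adversary) (κ : ℕ) (r : List Bool)

/-- The router that the adversary names. -/
def Adversary.node : ℕ := (A.router (view κ r [])).toNat

/-- The answers to the queries before the challenge if all packets are dropped. -/
def Adversary.dropped : List Tree := List.replicate (A.queries₁.eval κ) .nil

/-- The challenge of the adversary if all packets are dropped. -/
def Adversary.chosen : Challenge := Challenge.ofTree (A.challenge (view κ r (A.dropped κ)))

variable (P M : ℕ → ℕ → ℕ → List Bool) (b : Bool) (R₁ R₂ : List Bool) (σ₁ σ₂ : List ℕ)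

/-- The first packet that the challenger returns. -/
def nominalFirst : Tree :=
  (S.outPacket κ P M (A.chosen κ r).source (A.chosen κ r).t (A.node κ r) (A.chosen κ r).before
    (A.chosen κ r).after (A.chosen κ r).payload₁ R₁ σ₁).toTree

/-- The second packet that the challenger returns. -/
def nominalSecond : Tree :=
  (S.outPacket κ P M ((A.chosen κ r).source₂ b) ((A.chosen κ r).t + 1) (A.node κ r)
    ((A.chosen κ r).before₂ b) (A.chosen κ r).after (A.chosen κ r).payload₂ R₂ σ₂).toTree

open Classical in
/-- What the challenger returns if all packets arrive. -/
noncomputable def nominalViews : List Tree :=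
  if (A.chosen κ r).Valid S κ g (A.node κ r) then
    [nominalFirst S A κ r P M R₁ σ₁, nominalSecond S A κ r P M b R₂ σ₂]
  else [.nil, .nil]

/-- The guess of the adversary for the given challenge packets, if all its queries are dropped. -/
def guessOn (views : List Tree) : Bool :=
  (A.guess (view κ r (A.dropped κ ++ views ++ List.replicate (A.queries₂.eval κ) .nil))).toBool

/-- A query before the challenge is not dropped. -/
def HitBefore : Prop :=
  -- The conjunct `True` is the trivial selection of lines in the shape of
  -- `Scheme.expect_exists_hit_le`.
  ∃ i < A.queries₁.eval κ, ∃ s < S.nodes κ, ∃ t < S.window κ, True ∧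
    S.Hit κ M P (A.node κ r) s t (.ofTree (A.query₁ (view κ r (List.replicate i .nil))))

/-- A query after the challenge is not dropped. -/
noncomputable def HitAfter : Prop :=
  ∃ i < A.queries₂.eval κ, ∃ s < S.nodes κ, ∃ t < S.window κ, True ∧
    S.Hit κ M P (A.node κ r) s t (.ofTree (A.query₂ (view κ r
      (A.dropped κ ++ nominalViews S g A κ r P M b R₁ R₂ σ₁ σ₂ ++ List.replicate i .nil))))

/-- The first packet is misrouted. -/
def MisroutedFirst : Prop :=
  (A.chosen κ r).Valid S κ g (A.node κ r) ∧
    S.Misrouted κ P M (A.chosen κ r).source (A.chosen κ r).t (A.node κ r) (A.chosen κ r).before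
      (A.chosen κ r).after (A.chosen κ r).payload₁ R₁ σ₁

/-- The second packet is misrouted. -/
def MisroutedSecond : Prop :=
  (A.chosen κ r).Valid S κ g (A.node κ r) ∧
    S.Misrouted κ P M ((A.chosen κ r).source₂ b) ((A.chosen κ r).t + 1) (A.node κ r)
      ((A.chosen κ r).before₂ b) (A.chosen κ r).after (A.chosen κ r).payload₂ R₂ σ₂

variable {S g A κ r P M b R₁ R₂ σ₁ σ₂}

/-- The bad events are stated for the hypothetical run in which every query is dropped and the
challenge packets are nominal. If none of them occurs there, the real run agrees with it answer by
answer; no conditioning on the past is needed. -/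
theorem gameResult_eq_guessOn (hwf : S.WellFormed) (hj : A.node κ r < S.nodes κ)
    (hG : S.GoodTables κ P M) (hR₁ : R₁.length = S.vecLen κ) (hR₂ : R₂.length = S.vecLen κ)
    (hσ₁ : S.IsSlotList κ σ₁) (hσ₂ : S.IsSlotList κ σ₂)
    (h₁ : ¬ HitBefore S A κ r P M) (h₂ : ¬ HitAfter S g A κ r P M b R₁ R₂ σ₁ σ₂)
    (h₃ : ¬ MisroutedFirst S g A κ r P M R₁ σ₁) (h₄ : ¬ MisroutedSecond S g A κ r P M b R₂ σ₂) :
    gameResult S g A κ P M r b R₁ R₂ σ₁ σ₂ =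
      (guessOn A κ r (nominalViews S g A κ r P M b R₁ R₂ σ₁ σ₂) == b) := by
  have hviews : challengeViews S κ g P M (A.node κ r) (A.chosen κ r) b R₁ R₂ σ₁ σ₂ =
      nominalViews S g A κ r P M b R₁ R₂ σ₁ σ₂ := by
    rw [challengeViews, nominalViews]
    by_cases hv : (A.chosen κ r).Valid S κ g (A.node κ r)
    · rw [if_pos hv, if_pos hv]
      have hv₂ := hv.validPath₂ b
      obtain ⟨hp₁, hp₂, ht, hafter, hpath, -, -⟩ := id hv
      have e₁ := Scheme.linkView_of_not_misrouted hwf hG (by omega) hafter hpath hp₁ hR₁ hσ₁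
        fun h => h₃ ⟨hv, h⟩
      have e₂ := Scheme.linkView_of_not_misrouted hwf hG ht hafter hv₂ hp₂ hR₂ hσ₂
        fun h => h₄ ⟨hv, h⟩
      exact congrArg₂ (fun x y => [x, y]) e₁ e₂
    · rw [if_neg hv, if_neg hv]
  have ha₁ : interact (fun as => A.query₁ (view κ r as))
      (fun x => (S.processPad κ P M (A.node κ r) (.ofTree x)).toTree) (A.queries₁.eval κ) []
      = A.dropped κ := by
    rw [interact_of_nil]
    · rfl
    · intro i hi
      rw [Scheme.processPad_eq_drop_of_not_hit]
      · rfl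
      · intro s hs t ht h
        exact h₁ ⟨i, hi, s, hs, t, ht, trivial, h⟩
  have ha₂ : interact (fun as => A.query₂ (view κ r as))
      (fun x => (S.processPad κ P M (A.node κ r) (.ofTree x)).toTree) (A.queries₂.eval κ)
      (A.dropped κ ++ nominalViews S g A κ r P M b R₁ R₂ σ₁ σ₂)
      = A.dropped κ ++ nominalViews S g A κ r P M b R₁ R₂ σ₁ σ₂ ++
        List.replicate (A.queries₂.eval κ) .nil := by
    rw [interact_of_nil]
    intro i hi
    rw [Scheme.processPad_eq_drop_of_not_hit]
    · rfl
    · intro s hs t ht h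
      exact h₂ ⟨i, hi, s, hs, t, ht, trivial, h⟩
  change (if A.node κ r < S.nodes κ then _ else b) = _
  rw [if_pos hj]
  change ((A.guess (view κ r (interact (fun as => A.query₂ (view κ r as))
    (fun x => (S.processPad κ P M (A.node κ r) (.ofTree x)).toTree) (A.queries₂.eval κ)
    (interact (fun as => A.query₁ (view κ r as))
      (fun x => (S.processPad κ P M (A.node κ r) (.ofTree x)).toTree) (A.queries₁.eval κ) [] ++
      challengeViews S κ g P M (A.node κ r) (Challenge.ofTree (A.challenge (view κ r
        (interact (fun as => A.query₁ (view κ r as))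
      (fun x => (S.processPad κ P M (A.node κ r) (.ofTree x)).toTree) (A.queries₁.eval κ) []))))
        b R₁ R₂ σ₁ σ₂)))).toBool == b) = _
  rw [ha₁]
  change ((A.guess (view κ r (interact _ _ _ (A.dropped κ ++
    challengeViews S κ g P M (A.node κ r) (A.chosen κ r) b R₁ R₂ σ₁ σ₂)))).toBool == b) = _
  rw [hviews, ha₂]
  rfl

variable {q : ℕ}

/-- In the run with dropped queries, the queries before the challenge depend on the coins only,
hence not on any pad. -/
theorem expect_hitBefore_le (hj : A.node κ r < S.nodes κ) (hW : S.window κ ≤ q) :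
    𝔼 u : Fin (S.nodes κ * S.nodes κ * q) → Fin (S.padLen κ) → Bool,
      indProp (HitBefore S A κ r (randTable (S.nodes κ) q u) M) ≤
      (A.queries₁.eval κ * S.nodes κ * S.window κ : ℕ) * (1 / 2 : ℝ) ^ κ :=
  Scheme.expect_exists_hit_le (A.queries₁.eval κ) (fun _ => A.node κ r) (fun _ _ => True) hW
    (fun _ _ => hj) (fun i _ => .ofTree (A.query₁ (view κ r (List.replicate i .nil))))
    fun _ _ _ _ _ _ _ _ _ _ => rfl

theorem nominalViews_shift_tagMask {s t : ℕ} (hj : A.node κ r < S.nodes κ) (hW : S.window κ ≤ q)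
    (u : Fin (S.nodes κ * S.nodes κ * q) → Fin (S.padLen κ) → Bool) {δ : List Bool}
        (hδ : δ.length = κ) :
    nominalViews S g A κ r (shift (randTable (S.nodes κ) q u) s (A.node κ r) t
        (S.tagMask κ δ)) M b R₁ R₂ σ₁ σ₂ =
      nominalViews S g A κ r (randTable (S.nodes κ) q u) M b R₁ R₂ σ₁ σ₂ := by
  rw [nominalViews, nominalViews]
  by_cases hv : (A.chosen κ r).Valid S κ g (A.node κ r)
  · rw [if_pos hv, if_pos hv]
    have hv₂ := hv.validPath₂ b
    obtain ⟨hp₁, hp₂, ht, hafter, hpath, -, -⟩ := id hv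
    have hnot : A.node κ r ∉ (A.chosen κ r).after := by
      have := (List.nodup_cons.1 hpath.1).2
      exact (List.nodup_cons.1 (List.nodup_append.1 this).2.1).1
    rw [nominalFirst, nominalSecond,
      Scheme.outPacket_shift_tagMask hδ hnot (length_randTable u (hpath.2.1 _ (by simp)) hj
        (by omega)),
      Scheme.outPacket_shift_tagMask hδ hnot (length_randTable u (hv₂.2.1 _ (by simp)) hj
        (by omega))]
    rfl
  · rw [if_neg hv, if_neg hv]

theorem expect_hitAfter_le (hj : A.node κ r < S.nodes κ) (hW : S.window κ ≤ q) :
    𝔼 u : Fin (S.nodes κ * S.nodes κ * q) → Fin (S.padLen κ) → Bool,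
      indProp (HitAfter S g A κ r (randTable (S.nodes κ) q u) M b R₁ R₂ σ₁ σ₂) ≤
      (A.queries₂.eval κ * S.nodes κ * S.window κ : ℕ) * (1 / 2 : ℝ) ^ κ := by
  have h := Scheme.expect_exists_hit_le (M := M) (A.queries₂.eval κ) (fun _ => A.node κ r)
    (fun _ _ => True) hW (fun _ _ => hj) (fun i P => .ofTree (A.query₂ (view κ r
      (A.dropped κ ++ nominalViews S g A κ r P M b R₁ R₂ σ₁ σ₂ ++ List.replicate i .nil))))
    fun i _ s hs t ht _ u δ hδ => by rw [nominalViews_shift_tagMask hj hW u hδ]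
  unfold HitAfter
  exact h

/-- Two indicators differ by at most 1, and only if one of four bad events occurs. The two summands
`S.slots κ` account for the two challenge packets on their way. -/
theorem expect_gameResult_le (hwf : S.WellFormed) (hj : A.node κ r < S.nodes κ)
    (hW : S.window κ ≤ q)
    (hM : ∀ s v t, s < S.nodes κ → v < S.nodes κ → t < S.window κ → (M s v t).length = κ)
    (hR₁ : R₁.length = S.vecLen κ) (hR₂ : R₂.length = S.vecLen κ)
    (hσ₁ : S.IsSlotList κ σ₁) (hσ₂ : S.IsSlotList κ σ₂) :
    |𝔼 u : Fin (S.nodes κ * S.nodes κ * q) → Fin (S.padLen κ) → Bool,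
        ind (gameResult S g A κ (randTable (S.nodes κ) q u) M r b R₁ R₂ σ₁ σ₂) -
      𝔼 u : Fin (S.nodes κ * S.nodes κ * q) → Fin (S.padLen κ) → Bool,
        ind (guessOn A κ r (nominalViews S g A κ r (randTable (S.nodes κ) q u) M b R₁ R₂ σ₁ σ₂)
          == b)| ≤
    ((A.queries₁.eval κ + A.queries₂.eval κ + S.slots κ + S.slots κ) * S.nodes κ * S.window κ : ℕ)
      * (1 / 2 : ℝ) ^ κ := by
  have hbefore := expect_hitBefore_le (M := M) (A := A) (r := r) hj hW
  have hafter := expect_hitAfter_le (g := g) (A := A) (r := r) (b := b) (M := M) (R₁ := R₁)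
    (R₂ := R₂) (σ₁ := σ₁) (σ₂ := σ₂) hj hW
  have hfirst : 𝔼 u : Fin (S.nodes κ * S.nodes κ * q) → Fin (S.padLen κ) → Bool, indProp
      (MisroutedFirst S g A κ r (randTable (S.nodes κ) q u) M R₁ σ₁) ≤
      (S.slots κ * S.nodes κ * S.window κ : ℕ) * (1 / 2 : ℝ) ^ κ := by
    by_cases hv : (A.chosen κ r).Valid S κ g (A.node κ r)
    · simp only [MisroutedFirst, hv, true_and]
      exact Scheme.expect_misrouted_le hW hv.2.2.2.2.1
    · simp only [indProp_of_not fun h : MisroutedFirst S g A κ r _ M R₁ σ₁ => hv h.1]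
      rw [Fintype.expect_const]; positivity
  have hsecond : 𝔼 u : Fin (S.nodes κ * S.nodes κ * q) → Fin (S.padLen κ) → Bool, indProp
      (MisroutedSecond S g A κ r (randTable (S.nodes κ) q u) M b R₂ σ₂) ≤
      (S.slots κ * S.nodes κ * S.window κ : ℕ) * (1 / 2 : ℝ) ^ κ := by
    by_cases hv : (A.chosen κ r).Valid S κ g (A.node κ r)
    · simp only [MisroutedSecond, hv, true_and]
      exact Scheme.expect_misrouted_le hW (hv.validPath₂ b)
    · simp only [indProp_of_not fun h : MisroutedSecond S g A κ r _ M b R₂ σ₂ => hv h.1]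
      rw [Fintype.expect_const]; positivity
  rw [← Finset.expect_sub_distrib]
  have hpoint : ∀ u : Fin (S.nodes κ * S.nodes κ * q) → Fin (S.padLen κ) → Bool, |ind
      (gameResult S g A κ (randTable (S.nodes κ) q u) M r b R₁ R₂ σ₁ σ₂) -
      ind (guessOn A κ r (nominalViews S g A κ r
          (randTable (S.nodes κ) q u) M b R₁ R₂ σ₁ σ₂) == b)| ≤
      indProp (HitBefore S A κ r (randTable (S.nodes κ) q u) M) +
      indProp (HitAfter S g A κ r (randTable (S.nodes κ) q u) M b R₁ R₂ σ₁ σ₂) +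
      indProp (MisroutedFirst S g A κ r (randTable (S.nodes κ) q u) M R₁ σ₁) +
      indProp (MisroutedSecond S g A κ r (randTable (S.nodes κ) q u) M b R₂ σ₂) := by
    intro u
    have hle : ∀ x y : Bool, |ind x - ind y| ≤ 1 := by
      intro x y; cases x <;> cases y <;> simp [ind]
    have n₁ := indProp_nonneg (HitBefore S A κ r (randTable (S.nodes κ) q u) M)
    have n₂ := indProp_nonneg (HitAfter S g A κ r (randTable (S.nodes κ) q u) M b R₁ R₂ σ₁ σ₂)
    have n₃ := indProp_nonneg (MisroutedFirst S g A κ r (randTable (S.nodes κ) q u) M R₁ σ₁)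
    have n₄ := indProp_nonneg (MisroutedSecond S g A κ r (randTable (S.nodes κ) q u) M b R₂ σ₂)
    have h0 := hle (gameResult S g A κ (randTable (S.nodes κ) q u) M r b R₁ R₂ σ₁ σ₂)
      (guessOn A κ r (nominalViews S g A κ r (randTable (S.nodes κ) q u) M b R₁ R₂ σ₁ σ₂) == b)
    by_cases h₁ : HitBefore S A κ r (randTable (S.nodes κ) q u) M
    · have := indProp_of h₁; linarith
    by_cases h₂ : HitAfter S g A κ r (randTable (S.nodes κ) q u) M b R₁ R₂ σ₁ σ₂
    · have := indProp_of h₂; linarith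
    by_cases h₃ : MisroutedFirst S g A κ r (randTable (S.nodes κ) q u) M R₁ σ₁
    · have := indProp_of h₃; linarith
    by_cases h₄ : MisroutedSecond S g A κ r (randTable (S.nodes κ) q u) M b R₂ σ₂
    · have := indProp_of h₄; linarith
    rw [gameResult_eq_guessOn hwf hj (Scheme.goodTables_randTable hW hM u) hR₁ hR₂ hσ₁ hσ₂ h₁ h₂ h₃
      h₄, sub_self, abs_zero]
    positivity
  refine (Finset.abs_expect_le _ _).trans ((Finset.expect_le_expect fun u _ => hpoint u).trans ?_)
  rw [Finset.expect_add_distrib, Finset.expect_add_distrib, Finset.expect_add_distrib]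
  push_cast at *
  nlinarith [hbefore, hafter, hfirst, hsecond]

end

end Ariadne

/-! ### Uniformity of the packet behind the router -/

namespace Ariadne
open scoped BigOperators

theorem exists_eq_append_cons_cons {α : Type} {l : List α} {n : ℕ} (h : n + 1 < l.length) :
    ∃ l₁ a b l₂, l = l₁ ++ a :: b :: l₂ ∧ l₁.length = n := by
  refine ⟨l.take n, l[n], l[n + 1], l.drop (n + 2), ?_, by rw [List.length_take]; omega⟩
  conv_lhs => rw [← List.take_append_drop n l, List.drop_eq_getElem_cons (by omega),
    List.drop_eq_getElem_cons h]

theorem exists_hops_append (z₁ : List (ℕ × ℕ)) (a b : ℕ × ℕ) (z₂ : List (ℕ × ℕ)) :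
    ∃ hs, hops (z₁ ++ a :: b :: z₂) = hs ++ ⟨a.1, a.2, b.1, b.2⟩ :: hops (b :: z₂) ∧
      hs.map Hop.node = z₁.map Prod.fst := by
  induction z₁ with
  | nil => exact ⟨[], rfl, rfl⟩
  | cons c z₁ ih =>
    obtain ⟨hs, h₁, h₂⟩ := ih
    cases z₁ with
    | nil => exact ⟨[⟨c.1, c.2, a.1, a.2⟩], rfl, rfl⟩
    | cons d z₁ =>
      refine ⟨⟨c.1, c.2, d.1, d.2⟩ :: hs, ?_, ?_⟩
      · rw [List.cons_append, List.cons_append, hops, ← List.cons_append, h₁]; rfl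
      · rw [List.map_cons, h₂]; rfl

theorem exists_hops_cons (a : ℕ × ℕ) (z : List (ℕ × ℕ)) :
    ∃ h hs, hops (a :: z) = h :: hs ∧ h.node = a.1 ∧ h.slot = a.2 ∧
      hs.map Hop.node = z.map Prod.fst := by
  cases z with
  | nil => exact ⟨_, [], rfl, rfl, rfl, rfl⟩
  | cons b z => exact ⟨_, _, rfl, rfl, rfl, hops_map_node _⟩

namespace Scheme

variable {S : Scheme} {κ : ℕ} {pad pad' mk : ℕ → List Bool} {pay : List Bool}

/-- Changing the pads of two consecutive hops by the same string, which vanishes in the slot of the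
second, has no effect on the initial vector that they produce. -/
theorem fillPad_fillPad_bxor {k h : Hop} {R D : List Bool}
    (hk : (pad k.node).length = S.padLen κ) (hh : (pad h.node).length = S.padLen κ)
    (hks : k.slot < S.slots κ) (hhs : h.slot < S.slots κ) (hR : R.length = S.vecLen κ)
    (hD : D.length = S.fullLen κ)
    (hDs : S.putSlot κ h.slot (List.replicate (S.elemLen κ) false) D = D)
    (hk' : (pad' k.node).drop (S.elemLen κ) = bxor ((pad k.node).drop (S.elemLen κ)) D)
    (hh' : (pad' h.node).drop (S.elemLen κ) = bxor ((pad h.node).drop (S.elemLen κ)) D) :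
    S.fillPad κ pad' (S.fillPad κ pad' R k) h = S.fillPad κ pad (S.fillPad κ pad R k) h := by
  have hV := vecLen_le (S := S) (κ := κ)
  have hslot := slot_le hhs
  have hslot' := slot_le hks
  have he : ∀ m n, (S.elem κ m n (List.replicate κ false)).length = S.elemLen κ :=
    fun m n => length_elem (by simp)
  set D' := D.take (S.vecLen κ) with hD'
  have hD'len : D'.length = S.vecLen κ := by rw [hD', List.length_take]; omega
  have hfull : D = D' ++ D.drop (S.vecLen κ) := (List.take_append_drop _ _).symm
  have hD's : S.putSlot κ h.slot (List.replicate (S.elemLen κ) false) D' = D' := by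
    have h1 := congrArg (List.take (S.vecLen κ)) hDs
    rw [hfull, putSlot_append _ (by omega), List.take_left' (by
      rw [length_putSlot (by omega) (by simp), hD'len]), List.take_left' hD'len] at h1
    exact h1
  have hkl := length_drop_pad hk
  have hhl := length_drop_pad hh
  have hA := length_fillPad (S := S) (κ := κ) (pad := pad) hk hks hR
  have hstep : S.fillPad κ pad' R k = bxor (S.fillPad κ pad R k) D' := by
    rw [fillPad, hk', take_bxor, ← bxor_assoc, fillPad]
  rw [hstep]
  generalize S.fillPad κ pad R k = A at hA
  -- As the change vanishes in the slot of `h`, overwriting this slot commutes with it; the pad of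
  -- `h` then adds the same change again and cancels it.
  have hput : S.putSlot κ h.slot (S.elem κ h.next h.nextSlot (List.replicate κ false))
      (bxor A D') =
      bxor (S.putSlot κ h.slot (S.elem κ h.next h.nextSlot (List.replicate κ false)) A) D' := by
    conv_rhs => rw [← hD's]
    rw [bxor_putSlot (by omega) (he _ _) (by simp), bxor_zero (he _ _).le]
  rw [fillPad, fillPad, hh', take_bxor, ← hD', hput, bxor_comm (List.take _ _) D', ← bxor_assoc,
    bxor_cancel_right]
  rw [length_putSlot (by omega) (he _ _)]; omega

variable {P M : ℕ → ℕ → ℕ → List Bool}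

/-- A change of the pads that the source shares with the router and with its successor, and its
effect on the packet between the two: the slot of the successor and the rest of the body change
independently. -/
theorem exists_outPacket_shift (hwf : S.WellFormed) {s t j w : ℕ} {before rest : List ℕ}
    {payload R : List Bool} {σ : List ℕ} (hG : S.GoodTables κ P M) (ht : t < S.window κ)
    (hpath : ValidPath S κ s (before ++ j :: w :: rest)) (hpay : payload.length ≤ S.payloadLen κ)
    (hR : R.length = S.vecLen κ) (hσ : S.IsSlotList κ σ) :
    ∃ (E : List Bool → List Bool) (Y : List Bool), Y.length = S.fullLen κ ∧
      (∀ Δ, Δ.length = S.fullLen κ → (E Δ).length = S.elemLen κ) ∧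
      ∀ δ Δ, δ.length = S.elemLen κ → Δ.length = S.fullLen κ →
        S.outPacket κ (shift (shift P s w t (δ ++ S.putSlot κ (σ.getD (before.length + 1) 0)
              (List.replicate (S.elemLen κ) false) Δ)) s j t
            (List.replicate (S.elemLen κ) false ++ S.putSlot κ (σ.getD (before.length + 1) 0)
              (List.replicate (S.elemLen κ) false) Δ)) M s t j before (w :: rest) payload R σ =
          ⟨natBits (S.addrLen κ) w, natBits (S.ptrLen κ) (σ.getD (before.length + 1) 0),
            S.putSlot κ (σ.getD (before.length + 1) 0) (bxor (E Δ) δ) (bxor Y Δ)⟩ := by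
  obtain ⟨hnd, hlt, hle⟩ := hpath
  rw [List.length_append, List.length_cons, List.length_cons, ← hσ.length_eq] at hle
  have hnd' := (List.nodup_cons.1 hnd).2
  obtain ⟨σ₁, c, p, σ₂, rfl, hσ₁⟩ := exists_eq_append_cons_cons (l := σ) (n := before.length)
    (by omega)
  have hp : (σ₁ ++ c :: p :: σ₂).getD (before.length + 1) 0 = p := by
    rw [← hσ₁, List.getD_append_right _ _ _ _ (by omega)]; simp
  rw [hp]
  have hzip : (before ++ j :: w :: rest).zip (σ₁ ++ c :: p :: σ₂) =
      before.zip σ₁ ++ (j, c) :: (w, p) :: rest.zip σ₂ := by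
    rw [List.zip_append hσ₁.symm]; rfl
  obtain ⟨hs, hhops, hnode⟩ := exists_hops_append (before.zip σ₁) (j, c) (w, p) (rest.zip σ₂)
  obtain ⟨h, tl, hcons, hh, hslot, htl⟩ := exists_hops_cons (w, p) (rest.zip σ₂)
  rw [hcons] at hhops
  have hs_len : hs.length = before.length := by
    have := congrArg List.length hnode
    simpa [hσ₁] using this
  set k : Hop := ⟨j, c, w, p⟩ with hk
  have hfits := fits_hops (P := P) (M := M) (z := (before ++ j :: w :: rest).zip
    (σ₁ ++ c :: p :: σ₂)) hG (hlt s (by simp)) ht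
    (fun a ha => (zip_slots_mem (fun v hv => hlt v (List.mem_cons_of_mem _ hv)) hσ ha).1)
    fun a ha => (zip_slots_mem (fun v hv => hlt v (List.mem_cons_of_mem _ hv)) hσ ha).2
  rw [hzip, hhops] at hfits
  -- The nodes of the path are distinct, so the two changed pads occur at no other hop.
  have hhs : ∀ x ∈ hs, x.node ≠ j ∧ x.node ≠ w := by
    intro x hx
    have := List.mem_map_of_mem (f := Hop.node) hx
    rw [hnode, List.map_fst_zip hσ₁.ge] at this
    have hd := (List.nodup_append.1 hnd').2.2 _ this
    exact ⟨hd j (by simp), hd w (by simp)⟩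
  have hjw := List.nodup_cons.1 (List.nodup_append.1 hnd').2.1
  have hjne : j ≠ w := fun h => hjw.1 (by simp [h])
  have htl' : ∀ x ∈ tl, x.node ≠ j ∧ x.node ≠ w := by
    intro x hx
    have hm := List.mem_map_of_mem (f := Hop.node) hx
    rw [htl] at hm
    obtain ⟨y, hy, hy'⟩ := List.mem_map.1 hm
    have hrest : x.node ∈ rest := by rw [← hy']; exact (List.of_mem_zip hy).1
    exact ⟨fun h => hjw.1 (by rw [← h]; exact List.mem_cons_of_mem _ hrest),
      fun h => (List.nodup_cons.1 hjw.2).1 (by rw [← h]; exact hrest)⟩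
  have hpadj := hfits.pad_length k (by simp)
  have hpadw := hfits.pad_length h (by simp)
  have hmkw := hfits.mk_length h (by simp)
  have hslotk := hfits.slot_lt k (by simp)
  have hslotw := hfits.slot_lt h (by simp)
  rw [hh] at hpadw hmkw
  rw [hslot] at hslotw
  dsimp only at hpadw hmkw hslotw
  have hR₁ : (hs.foldl (S.fillPad κ fun v => P s v t) R).length = S.vecLen κ :=
    length_foldl_fillPad (mk := fun v => M s v t) ⟨fun x hx => hfits.pad_length x (by simp [hx]),
      fun x hx => hfits.mk_length x (by simp [hx]), fun x hx => hfits.slot_lt x (by simp [hx])⟩ hR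
  set R₁ := hs.foldl (S.fillPad κ fun v => P s v t) R with hR₁def
  have hR₂ := length_fillPad (S := S) (κ := κ) (pad := fun v => P s v t) hpadj hslotk hR₁
  have hR₃ := length_fillPad (S := S) (κ := κ) (h := h) (pad := fun v => P s v t)
    (by rw [hh]; exact hpadw) (by rw [hslot]; exact hslotw) hR₂
  set R₃ := S.fillPad κ (fun v => P s v t) (S.fillPad κ (fun v => P s v t) R₁ k) h with hR₃def
  set Z := S.stage κ (fun v => P s v t) (fun v => M s v t) (S.padded κ payload) tl R₃ with hZ
  have hZlen : Z.length = S.fullLen κ :=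
    length_stage hwf ⟨fun x hx => hfits.pad_length x (by simp [hx]),
      fun x hx => hfits.mk_length x (by simp [hx]), fun x hx => hfits.slot_lt x (by simp [hx])⟩
      hR₃ (length_padded hpay)
  have hdropw := length_drop_pad hpadw
  have htakew := length_take_pad hpadw
  have hpl := slot_le hslotw
  have hV := vecLen_le (S := S) (κ := κ)
  set Y := bxor Z ((P s w t).drop (S.elemLen κ)) with hY
  have hYlen : Y.length = S.fullLen κ := by rw [hY, length_bxor]; omega
  -- The witnesses are the blinded element of the successor and the body that it blinds. The element
  -- depends on `Δ` because its tag is the MAC of the changed body; this is why `E` is a function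
  -- and why `δ` must be averaged after `Δ` is fixed.
  refine ⟨fun Δ => bxor (S.elem κ h.next h.nextSlot (S.mac κ (M s w t)
    (bxor Y (S.putSlot κ p (List.replicate (S.elemLen κ) false) Δ)))) ((P s w t).take
        (S.elemLen κ)),
    Y, hYlen, fun Δ hΔ => ?_, fun δ Δ hδ hΔ => ?_⟩
  · rw [length_bxor, length_elem, htakew, min_self]
    refine hwf.mac_length _ _ _ hmkw ?_
    rw [length_bxor, length_putSlot (by omega) (by simp)]; omega
  set D := S.putSlot κ p (List.replicate (S.elemLen κ) false) Δ with hD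
  have hDlen : D.length = S.fullLen κ := by rw [hD, length_putSlot (by omega) (by simp), hΔ]
  set P' := shift (shift P s w t (δ ++ D)) s j t (List.replicate (S.elemLen κ) false ++ D) with hP'
  have hne : ∀ v, v ≠ j ∧ v ≠ w → P' s v t = P s v t := fun v hv => by
    rw [hP', shift_of_ne fun h => hv.1 h.2.1, shift_of_ne fun h => hv.2 h.2.1]
  have hPw : P' s w t = bxor (P s w t) (δ ++ D) := by
    rw [hP', shift_of_ne fun h => hjne h.2.1.symm, shift_self]
  have hPj : P' s j t = bxor (P s j t) (List.replicate (S.elemLen κ) false ++ D) := by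
    rw [hP', shift_self, shift_of_ne fun h => hjne h.2.1]
  have hfold : hs.foldl (S.fillPad κ fun v => P' s v t) R = R₁ :=
    foldl_fillPad_congr R fun x hx => by rw [hne _ (hhs x hx)]
  -- The changes for the router and its successor cancel, so the filler beyond the successor, and
  -- with it all later layers, is the old one.
  have hfill : S.fillPad κ (fun v => P' s v t) (S.fillPad κ (fun v => P' s v t) R₁ k) h = R₃ := by
    refine fillPad_fillPad_bxor (D := D) hpadj (by rw [hh]; exact hpadw) hslotk
      (by rw [hslot]; exact hslotw) hR₁ hDlen ?_ ?_ ?_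
    · rw [hslot]
      dsimp only
      rw [hD, putSlot_putSlot (by omega) (by simp) (by simp)]
    · change (P' s j t).drop _ = bxor ((P s j t).drop _) D
      rw [hPj, drop_bxor, List.drop_left' (by simp)]
    · rw [hh]
      change (P' s w t).drop _ = bxor ((P s w t).drop _) D
      rw [hPw, drop_bxor, List.drop_left' hδ]
  have hstage : S.stage κ (fun v => P' s v t) (fun v => M s v t) (S.padded κ payload) (h :: tl)
      (S.fillPad κ (fun v => P' s v t) R₁ k) = S.wrapPad κ (fun v => P' s v t) (fun v => M s v t) h
        Z := by
    rw [hZ, ← stage_congr (pad := fun v => P' s v t) _ fun x hx => hne _ (htl' x hx), ← hfill]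
    rfl
  have htake : ((hs ++ k :: h :: tl).take (before.length + 1)).foldl
      (S.fillPad κ fun v => P' s v t) R = S.fillPad κ (fun v => P' s v t) R₁ k := by
    rw [← hs_len, List.take_append, List.take_of_length_le (by omega), Nat.add_sub_cancel_left,
      List.foldl_append, hfold]
    rfl
  have hdrop : (hs ++ k :: h :: tl).drop (before.length + 1) = h :: tl := by
    rw [← hs_len, List.drop_append, List.drop_of_length_le (by omega), Nat.add_sub_cancel_left]
    rfl
  have hget : (before.zip σ₁ ++ (j, c) :: (w, p) :: rest.zip σ₂).getD (before.length + 1) (0, 0)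
      = (w, p) := by
    rw [List.getD_append_right _ _ _ _ (by simp [hσ₁])]
    simp [hσ₁]
  rw [outPacket, nominal, hzip, hhops, hget, htake, hdrop, hstage, wrapPad, hh, hslot]
  congr 1
  change S.putSlot κ p (bxor (S.elem κ h.next h.nextSlot (S.mac κ (M s w t)
    (bxor Z ((P' s w t).drop _)))) ((P' s w t).take _)) (bxor Z ((P' s w t).drop _)) = _
  have hZY : bxor Z ((P' s w t).drop (S.elemLen κ)) = bxor Y D := by
    rw [hPw, drop_bxor, List.drop_left' hδ, ← bxor_assoc]
  rw [hZY, hPw, take_bxor, List.take_left' hδ, ← bxor_assoc]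
  have hmac : (S.mac κ (M s w t) (bxor Y D)).length = κ :=
    hwf.mac_length _ _ _ hmkw (by rw [length_bxor]; omega)
  have hE : (bxor (bxor (S.elem κ h.next h.nextSlot (S.mac κ (M s w t) (bxor Y D)))
      ((P s w t).take (S.elemLen κ))) δ).length = S.elemLen κ := by
    rw [length_bxor, length_bxor, length_elem hmac]; omega
  -- Zeroing slot `p` of `Δ` has no effect on the final body, because that slot is overwritten by
  -- the element anyway.
  have hYD : bxor Y D = S.putSlot κ p (S.getSlot κ p Y) (bxor Y Δ) := by
    conv_lhs => rw [← putSlot_getSlot (S := S) (κ := κ) (p := p) (X := Y) (by omega)]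
    rw [hD, bxor_putSlot (by omega) (length_getSlot (by omega)) (by simp),
      bxor_zero (length_getSlot (by omega)).le]
  change S.putSlot κ p _ (bxor Y D) = S.putSlot κ p (bxor (bxor (S.elem κ h.next h.nextSlot
    (S.mac κ (M s w t) (bxor Y D))) ((P s w t).take (S.elemLen κ))) δ) (bxor Y Δ)
  generalize bxor (bxor (S.elem κ h.next h.nextSlot (S.mac κ (M s w t) (bxor Y D)))
      ((P s w t).take (S.elemLen κ))) δ = X at hE
  rw [hYD, putSlot_putSlot _ hE (length_getSlot (by omega))]
  rw [length_bxor]; omega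

end Scheme

end Ariadne

/-! ### The game with random pads and slots -/

namespace Ariadne
open scoped BigOperators

/-- The list of the values of a permutation. -/
def permList {l : ℕ} (σ : Equiv.Perm (Fin l)) : List ℕ := List.ofFn fun i => (σ i : ℕ)

theorem isSlotList_permList {S : Scheme} {κ : ℕ} (σ : Equiv.Perm (Fin (S.slots κ))) :
    S.IsSlotList κ (permList σ) := by
  refine ⟨List.length_ofFn, List.nodup_ofFn.2 fun i j h => σ.injective (Fin.ext h), fun x hx => ?_⟩
  obtain ⟨i, rfl⟩ := List.mem_ofFn.1 hx
  exact (σ i).2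

/-- Composition with a transposition of positions preserves the uniform distribution. So the slot of
the router's successor does not show how many nodes precede it on the path. -/
theorem expect_permList {l : ℕ} {i : ℕ} (hi : i < l) (F : ℕ → ℝ) :
    𝔼 σ : Equiv.Perm (Fin l), F ((permList σ).getD i 0) =
      𝔼 σ : Equiv.Perm (Fin l), F ((permList σ).getD 0 0) := by
  have h : ∀ k (hk : k < l) (σ : Equiv.Perm (Fin l)), (permList σ).getD k 0 = σ ⟨k, hk⟩ := by
    intro k hk σ
    rw [permList, List.getD_eq_getElem?_getD, List.getElem?_eq_getElem (by simpa using hk)]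
    simp
  refine Fintype.expect_equiv (Equiv.mulRight (Equiv.swap ⟨i, hi⟩ ⟨0, by omega⟩)) _ _ fun σ => ?_
  rw [h i hi, h 0 (by omega)]
  simp

theorem abs_expect_sub_le {ι : Type} [Fintype ι] [Nonempty ι] {f g : ι → ℝ} {ε : ℝ}
    (h : ∀ i, |f i - g i| ≤ ε) : |𝔼 i, f i - 𝔼 i, g i| ≤ ε := by
  rw [← Finset.expect_sub_distrib, ← Fintype.expect_const (ι := ι) ε]
  exact (Finset.abs_expect_le _ _).trans (Finset.expect_le_expect fun i _ => h i)

theorem expect_beq (g : Bool) : 𝔼 b : Bool, ind (g == b) = 1 / 2 := by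
  rw [Fintype.expect_eq_sum_div_card]
  cases g <;> simp [ind]

namespace Scheme

variable {S : Scheme} {κ q : ℕ} {M : ℕ → ℕ → ℕ → List Bool}

/-- With random pads, the body of the outgoing packet is uniform. -/
theorem expect_outPacket (hwf : S.WellFormed) {s t j w : ℕ} {before rest : List ℕ}
    {payload R : List Bool} {σ : List ℕ} (hW : S.window κ ≤ q)
    (hM : ∀ s v t, s < S.nodes κ → v < S.nodes κ → t < S.window κ → (M s v t).length = κ)
    (ht : t < S.window κ) (hpath : ValidPath S κ s (before ++ j :: w :: rest))
    (hpay : payload.length ≤ S.payloadLen κ) (hR : R.length = S.vecLen κ)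
    (hσ : S.IsSlotList κ σ) (H : (ℕ → ℕ → ℕ → List Bool) → Packet → ℝ)
    (hH : ∀ P v d, H (shift P s v t d) = H P) :
    𝔼 u : Fin (S.nodes κ * S.nodes κ * q) → Fin (S.padLen κ) → Bool,
      H (randTable (S.nodes κ) q u) (S.outPacket κ (randTable (S.nodes κ) q u) M s t j before
        (w :: rest) payload R σ) =
    𝔼 u : Fin (S.nodes κ * S.nodes κ * q) → Fin (S.padLen κ) → Bool,
      avgBits (S.fullLen κ) fun Δ => avgBits (S.elemLen κ) fun δ =>
        H (randTable (S.nodes κ) q u) ⟨natBits (S.addrLen κ) w,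
          natBits (S.ptrLen κ) (σ.getD (before.length + 1) 0),
          S.putSlot κ (σ.getD (before.length + 1) 0) δ Δ⟩ := by
  have hs : s < S.nodes κ := hpath.2.1 s (by simp)
  have hj : j < S.nodes κ := hpath.2.1 j (by simp)
  have hw : w < S.nodes κ := hpath.2.1 w (by simp)
  have htq := ht.trans_le hW
  set p := σ.getD (before.length + 1) 0 with hp
  have hpl : p * S.elemLen κ + S.elemLen κ ≤ S.fullLen κ := by
    refine (slot_le (hσ.lt p ?_)).trans vecLen_le
    have hle := hpath.2.2
    simp only [List.length_append, List.length_cons, ← hσ.length_eq] at hle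
    have hi : before.length + 1 < σ.length := by omega
    rw [hp, List.getD_eq_getElem?_getD, List.getElem?_eq_getElem hi]
    exact List.getElem_mem hi
  choose E Y hY hE hout using fun u => exists_outPacket_shift hwf
    (goodTables_randTable (M := M) hW hM u) ht hpath hpay hR hσ
  set D : List Bool → List Bool := S.putSlot κ p (List.replicate (S.elemLen κ) false) with hD
  have hDlen : ∀ Δ, Δ.length = S.fullLen κ → (D Δ).length = S.fullLen κ := fun Δ hΔ => by
    rw [hD, length_putSlot (by omega) (by simp), hΔ]
  set F : (ℕ → ℕ → ℕ → List Bool) → ℝ := fun P =>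
    H P (S.outPacket κ P M s t j before (w :: rest) payload R σ) with hF
  calc 𝔼 u : Fin (S.nodes κ * S.nodes κ * q) → Fin (S.padLen κ) → Bool,
        F (randTable (S.nodes κ) q u)
      = avgBits (S.fullLen κ) fun Δ => avgBits (S.elemLen κ) fun δ =>
        𝔼 u : Fin (S.nodes κ * S.nodes κ * q) → Fin (S.padLen κ) → Bool,
        F (shift (shift (randTable (S.nodes κ) q u) s w t (δ ++ D Δ)) s j t
          (List.replicate (S.elemLen κ) false ++ D Δ)) := by
        -- Superfluous averages over `Δ` and `δ` are introduced, and for each value the table is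
        -- shifted at the successor and at the router.
        conv_lhs => rw [← avgBits_const (S.fullLen κ) (𝔼 u, F (randTable (S.nodes κ) q u))]
        refine avgBits_congr fun Δ hΔ => ?_
        conv_lhs => rw [← avgBits_const (S.elemLen κ) (𝔼 u, F (randTable (S.nodes κ) q u))]
        refine avgBits_congr fun δ hδ => ?_
        rw [expect_shift hs hw htq (n := S.padLen κ) (d := δ ++ D Δ)
          (by rw [List.length_append, hδ, hDlen Δ hΔ, padLen])
          fun P => F (shift P s j t (List.replicate (S.elemLen κ) false ++ D Δ)),
          expect_shift hs hj htq (by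
            rw [List.length_append, List.length_replicate, hDlen Δ hΔ, padLen]) F]
    _ = 𝔼 u : Fin (S.nodes κ * S.nodes κ * q) → Fin (S.padLen κ) → Bool,
        avgBits (S.fullLen κ) fun Δ => avgBits (S.elemLen κ) fun δ =>
        H (randTable (S.nodes κ) q u) ⟨natBits (S.addrLen κ) w, natBits (S.ptrLen κ) p,
          S.putSlot κ p (bxor (E u Δ) δ) (bxor (Y u) Δ)⟩ := by
        rw [← avgBits_expect]
        refine avgBits_congr fun Δ hΔ => ?_
        rw [← avgBits_expect]
        refine avgBits_congr fun δ hδ => Finset.expect_congr rfl fun u _ => ?_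
        simp only [hF]
        -- The shifts make the body explicit in `δ` and `Δ`; `H` itself ignores them, since both
        -- concern the source `s` and the index `t`.
        rw [hout u δ Δ hδ hΔ, hH, hH]
    _ = _ := by
        refine Finset.expect_congr rfl fun u _ => ?_
        -- First `Δ` absorbs the fixed string `Y u`; then, for each `Δ`, the element `E u Δ` is a
        -- fixed string that `δ` absorbs.
        rw [← avgBits_bxor (hY u) fun Δ => avgBits (S.elemLen κ) fun δ =>
          H (randTable (S.nodes κ) q u) ⟨natBits (S.addrLen κ) w, natBits (S.ptrLen κ) p,
            S.putSlot κ p δ Δ⟩]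
        refine avgBits_congr fun Δ hΔ => ?_
        exact avgBits_bxor (hE u Δ hΔ) fun δ => H (randTable (S.nodes κ) q u)
          ⟨natBits (S.addrLen κ) w, natBits (S.ptrLen κ) p, S.putSlot κ p δ (bxor (Y u) Δ)⟩

end Scheme

variable {S : Scheme} {g : Game} {A : Adversary} {κ q : ℕ} {r : List Bool}
  {M : ℕ → ℕ → ℕ → List Bool} {R₁ R₂ : List Bool} {σ₁ : List ℕ}

/-- With random pads and slots, and if all packets arrive, the adversary learns nothing about the
bit. -/
theorem expect_guessOn (hwf : S.WellFormed) (hW : S.window κ ≤ q)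
    (hM : ∀ s v t, s < S.nodes κ → v < S.nodes κ → t < S.window κ → (M s v t).length = κ)
    (hR₂ : R₂.length = S.vecLen κ) :
    𝔼 b : Bool, 𝔼 σ : Equiv.Perm (Fin (S.slots κ)),
      𝔼 u : Fin (S.nodes κ * S.nodes κ * q) → Fin (S.padLen κ) → Bool,
        ind (guessOn A κ r (nominalViews S g A κ r (randTable (S.nodes κ) q u) M b R₁ R₂ σ₁
          (permList σ)) == b) = 1 / 2 := by
  by_cases hv : (A.chosen κ r).Valid S κ g (A.node κ r)
  · obtain ⟨w, rest, hafter⟩ := List.exists_cons_of_ne_nil hv.2.2.2.1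
    have key : ∀ b : Bool, (𝔼 σ : Equiv.Perm (Fin (S.slots κ)),
        𝔼 u : Fin (S.nodes κ * S.nodes κ * q) → Fin (S.padLen κ) → Bool,
        ind (guessOn A κ r (nominalViews S g A κ r (randTable (S.nodes κ) q u) M b R₁ R₂ σ₁
          (permList σ)) == b)) = 𝔼 σ : Equiv.Perm (Fin (S.slots κ)),
        𝔼 u : Fin (S.nodes κ * S.nodes κ * q) → Fin (S.padLen κ) → Bool,
        avgBits (S.fullLen κ) fun Δ => avgBits (S.elemLen κ) fun δ =>
          ind (guessOn A κ r [nominalFirst S A κ r (randTable (S.nodes κ) q u) M R₁ σ₁,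
            Packet.toTree ⟨natBits (S.addrLen κ) w, natBits (S.ptrLen κ) ((permList σ).getD 0 0),
              S.putSlot κ ((permList σ).getD 0 0) δ Δ⟩] == b) := by
      intro b
      have hpath := hv.validPath₂ b
      rw [hafter] at hpath
      have hi : ((A.chosen κ r).before₂ b).length + 1 < S.slots κ := by
        have := hpath.2.2
        simp only [List.length_append, List.length_cons] at this
        omega
      -- The position of the successor's slot depends on the bit, so it is moved to position 0.
      rw [← expect_permList hi fun p =>
        𝔼 u : Fin (S.nodes κ * S.nodes κ * q) → Fin (S.padLen κ) → Bool,
        avgBits (S.fullLen κ) fun Δ => avgBits (S.elemLen κ) fun δ =>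
          ind (guessOn A κ r [nominalFirst S A κ r (randTable (S.nodes κ) q u) M R₁ σ₁,
            Packet.toTree ⟨natBits (S.addrLen κ) w, natBits (S.ptrLen κ) p,
              S.putSlot κ p δ Δ⟩] == b)]
      refine Finset.expect_congr rfl fun σ _ => ?_
      -- The first packet belongs to the test `H`: it uses index `t`, so changing pads with index `t
      -- + 1` leaves it fixed, even if both packets have the same source.
      have h := Scheme.expect_outPacket (M := M) hwf hW hM hv.2.2.1 hpath hv.2.1 hR₂
        (isSlotList_permList σ) (fun P pkt => ind (guessOn A κ r
          [nominalFirst S A κ r P M R₁ σ₁, pkt.toTree] == b)) fun P v d => by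
          funext pkt
          rw [nominalFirst, nominalFirst, Scheme.outPacket, Scheme.shift_entry_of_ne (by
            intro h
            have := (Prod.mk.inj h).2
            omega), Scheme.outPacket]
      rw [← h]
      refine Finset.expect_congr rfl fun u _ => ?_
      rw [nominalViews, if_pos hv, nominalSecond, hafter]
    -- What the adversary sees no longer involves the bit, and a guess that does not depend on a
    -- uniform bit is right with probability one half.
    simp only [key]
    rw [Finset.expect_comm]
    rw [← Fintype.expect_const (ι := Equiv.Perm (Fin (S.slots κ))) (1 / 2 : ℝ)]
    refine Finset.expect_congr rfl fun σ _ => ?_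
    rw [Finset.expect_comm]
    rw [← Fintype.expect_const
      (ι := Fin (S.nodes κ * S.nodes κ * q) → Fin (S.padLen κ) → Bool) (1 / 2 : ℝ)]
    refine Finset.expect_congr rfl fun u _ => ?_
    rw [← avgBits_expect, ← avgBits_const (S.fullLen κ) (1 / 2 : ℝ)]
    refine avgBits_congr fun Δ _ => ?_
    rw [← avgBits_expect, ← avgBits_const (S.elemLen κ) (1 / 2 : ℝ)]
    exact avgBits_congr fun δ _ => expect_beq _
  · simp only [nominalViews, if_neg hv, Fintype.expect_const]
    exact expect_beq _

/-- With random pads and slots, the adversary has almost no advantage. -/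
theorem abs_expect_gameResult_le (hwf : S.WellFormed) (hW : S.window κ ≤ q)
    (hM : ∀ s v t, s < S.nodes κ → v < S.nodes κ → t < S.window κ → (M s v t).length = κ)
    (hR₁ : R₁.length = S.vecLen κ) (hR₂ : R₂.length = S.vecLen κ) (hσ₁ : S.IsSlotList κ σ₁) :
    |(𝔼 b : Bool, 𝔼 σ : Equiv.Perm (Fin (S.slots κ)),
      𝔼 u : Fin (S.nodes κ * S.nodes κ * q) → Fin (S.padLen κ) → Bool,
        ind (gameResult S g A κ (randTable (S.nodes κ) q u) M r b R₁ R₂ σ₁ (permList σ))) - 1 / 2| ≤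
    ((A.queries₁.eval κ + A.queries₂.eval κ + S.slots κ + S.slots κ) * S.nodes κ * S.window κ : ℕ)
      * (1 / 2 : ℝ) ^ κ := by
  by_cases hj : A.node κ r < S.nodes κ
  · generalize hε : ((A.queries₁.eval κ + A.queries₂.eval κ + S.slots κ + S.slots κ) * S.nodes κ *
      S.window κ : ℕ) * (1 / 2 : ℝ) ^ κ = ε
    rw [← expect_guessOn (S := S) (g := g) (A := A) (r := r) (R₁ := R₁) (σ₁ := σ₁) hwf hW hM hR₂]
    refine abs_expect_sub_le fun b => abs_expect_sub_le fun σ => ?_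
    rw [← hε]
    exact expect_gameResult_le hwf hj hW hM hR₁ hR₂ hσ₁ (isSlotList_permList σ)
  · have h : ∀ P b σ₂, gameResult S g A κ P M r b R₁ R₂ σ₁ σ₂ = b := fun P b σ₂ => if_neg hj
    simp only [h, Fintype.expect_const]
    have : 𝔼 b : Bool, ind b = 1 / 2 := by
      rw [← expect_beq true]; simp
    rw [this, sub_self, abs_zero]
    positivity

end Ariadne

/-! ### From master keys to tables of pads and MAC keys -/

namespace Ariadne
open scoped BigOperators

/-- One search performs both format checks on a pointer, its length and its range. This links the
protocol, which reads pointers with `bitsNat`, to the polynomial-time form. -/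
theorem findIndex_eq_ite {w m : ℕ} (hm : m ≤ 2 ^ w) (x : List Bool) :
    findIndex w m x = if x.length = w ∧ bitsNat x < m then some (bitsNat x) else none := by
  split_ifs with h
  · obtain ⟨rfl, h⟩ := h
    conv_lhs => rw [← natBits_bitsNat x]
    rw [natBits_length, findIndex_natBits hm h]
  · cases hf : findIndex w m x with
    | none => rfl
    | some i =>
      obtain ⟨hi, rfl⟩ := findIndex_eq_some hf
      exact absurd ⟨natBits_length w i, by rwa [bitsNat_natBits (by omega)]⟩ h

theorem List.findSome?_congr_of_mem {α β : Type} {l : List α} {f g : α → Option β}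
    (h : ∀ a ∈ l, f a = g a) : l.findSome? f = l.findSome? g := by
  induction l with
  | nil => rfl
  | cons a l ih =>
    rw [List.findSome?_cons, List.findSome?_cons, h a (by simp),
      ih fun b hb => h b (List.mem_cons_of_mem _ hb)]

namespace Scheme

/-- The scheme with an authentication code that is defined on strings of the right lengths only. -/
def total (S : Scheme) : Scheme :=
  { S with mac := fun κ k X => if k.length = κ ∧ X.length = S.fullLen κ then S.mac κ k X else [] }

variable {S : Scheme} {κ : ℕ}

theorem total_mac {k X : List Bool} (hk : k.length = κ) (hX : X.length = S.fullLen κ) :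
    S.total.mac κ k X = S.mac κ k X := if_pos ⟨hk, hX⟩

theorem WellFormed.total (hwf : S.WellFormed) : S.total.WellFormed where
  nodes_le := hwf.nodes_le
  slots_le := hwf.slots_le
  kdf_length := hwf.kdf_length
  prg_length := hwf.prg_length
  mac_length κ k X hk hX := by
    rw [total_mac (S := S) hk hX]; exact hwf.mac_length κ k X hk hX

theorem openAt_total {v p : ℕ} {pad mk body : List Bool} (hpad : pad.length = S.padLen κ)
    (hmk : mk.length = κ) (hp : p < S.slots κ) (hbody : body.length = S.fullLen κ) :
    S.total.openAt κ v pad mk p body = S.openAt κ v pad mk p body := by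
  have hslot := (slot_le hp).trans (vecLen_le (S := S) (κ := κ))
  have hle := le_elemLen (S := S) (κ := κ)
  have h : S.total.mac κ mk (S.putSlot κ p ((bxor (S.getSlot κ p body)
      (pad.take (S.elemLen κ))).take (S.elemLen κ - κ) ++ List.replicate κ false) body) =
      S.mac κ mk (S.putSlot κ p ((bxor (S.getSlot κ p body)
      (pad.take (S.elemLen κ))).take (S.elemLen κ - κ) ++ List.replicate κ false) body) := by
    refine total_mac hmk ?_
    rw [length_putSlot (by omega), hbody]
    rw [List.length_append, List.length_take, length_bxor, length_getSlot (by omega),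
      length_take_pad hpad, List.length_replicate]
    omega
  have h' : S.total.openAt κ v pad mk p body =
      if (S.getSlot κ p body).take (S.pattern κ).length = bxor (S.pattern κ)
          (pad.take (S.elemLen κ)) then
        if S.total.mac κ mk (S.putSlot κ p ((bxor (S.getSlot κ p body)
            (pad.take (S.elemLen κ))).take (S.elemLen κ - κ) ++ List.replicate κ false) body) =
          (bxor (S.getSlot κ p body) (pad.take (S.elemLen κ))).drop (S.elemLen κ - κ) then _
        else none
      else none := rfl
  rw [h', h]
  rfl

theorem stage_total {pad mk : ℕ → List Bool} {pay : List Bool} (hwf : S.WellFormed) {hs : List Hop}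
    {R : List Bool} (hf : S.Fits κ pad mk hs) (hR : R.length = S.vecLen κ)
    (hpay : pay.length = S.payloadLen κ) :
    S.total.stage κ pad mk pay hs R = S.stage κ pad mk pay hs R := by
  induction hs generalizing R with
  | nil => rfl
  | cons h hs ih =>
    have hR' := length_fillPad (hf.pad_length h (by simp)) (hf.slot_lt h (by simp)) hR
    have hlen := length_stage hwf hf.tail hR' hpay
    have hcons : ∀ S' : Scheme, S'.stage κ pad mk pay (h :: hs) R =
      S'.wrapPad κ pad mk h (S'.stage κ pad mk pay hs (S'.fillPad κ pad R h)) := fun _ => rfl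
    have hfill : S.total.fillPad κ pad R h = S.fillPad κ pad R h := rfl
    rw [hcons, hcons, hfill, ih hf.tail hR']
    have hmac : S.total.mac κ (mk h.node) (bxor (S.stage κ pad mk pay hs (S.fillPad κ pad R h))
        ((pad h.node).drop (S.elemLen κ))) = S.mac κ (mk h.node)
        (bxor (S.stage κ pad mk pay hs (S.fillPad κ pad R h))
        ((pad h.node).drop (S.elemLen κ))) := by
      refine total_mac (hf.mk_length h (by simp)) ?_
      rw [length_bxor, hlen, length_drop_pad (hf.pad_length h (by simp)), min_self]
    exact congrArg (fun x => S.putSlot κ h.slot (bxor (S.elem κ h.next h.nextSlot x)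
      ((pad h.node).take (S.elemLen κ))) (bxor (S.stage κ pad mk pay hs (S.fillPad κ pad R h))
        ((pad h.node).drop (S.elemLen κ)))) hmac

/-- `P` and `M` are the tables for the master keys `K`. -/
structure Tabulates (S : Scheme) (κ : ℕ) (K : ℕ → ℕ → List Bool) (P M : ℕ → ℕ → ℕ → List Bool) :
    Prop where
  key_length : ∀ s v, s < S.nodes κ → v < S.nodes κ → (K s v).length = κ
  pad_eq : ∀ s v t, s < S.nodes κ → v < S.nodes κ → t < S.window κ →
    P s v t = S.prg κ (S.encKey κ (K s v) t)
  mac_eq : ∀ s v t, s < S.nodes κ → v < S.nodes κ → t < S.window κ →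
    M s v t = S.macKey κ (K s v) t

variable {K : ℕ → ℕ → List Bool} {P M : ℕ → ℕ → ℕ → List Bool}

theorem Tabulates.goodTables (h : S.Tabulates κ K P M) (hwf : S.WellFormed) :
    S.GoodTables κ P M := by
  intro s v t hs hv ht
  have hk := hwf.kdf_length κ (K s v) t (h.key_length s v hs hv)
  rw [h.pad_eq s v t hs hv ht, h.mac_eq s v t hs hv ht]
  exact ⟨hwf.prg_length _ _ hk.1, hk.2⟩

theorem Tabulates.process (h : S.Tabulates κ K P M) (hwf : S.WellFormed) {v : ℕ}
    (hv : v < S.nodes κ) (pkt : Packet) :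
    S.process κ K v pkt = S.total.processPad κ P M v pkt := by
  have hf := findIndex_eq_ite (hwf.slots_le κ) pkt.ptr
  have h' : S.total.processPad κ P M v pkt =
    (findIndex (S.ptrLen κ) (S.slots κ) pkt.ptr).elim .drop fun p =>
    if pkt.body.length = S.fullLen κ then
      ((List.product (List.range (S.nodes κ)) (List.range (S.window κ))).findSome?
        fun st => S.total.openAt κ v (P st.1 v st.2) (M st.1 v st.2) p pkt.body).getD .drop
    else .drop := rfl
  rw [h', hf, Scheme.process]
  by_cases hb : pkt.body.length = S.fullLen κ
  · by_cases hp : pkt.ptr.length = S.ptrLen κ ∧ bitsNat pkt.ptr < S.slots κ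
    · rw [if_pos ⟨hb, hp⟩, if_pos hp, Option.elim, if_pos hb]
      congr 1
      refine List.findSome?_congr_of_mem fun st hst => ?_
      obtain ⟨hs, ht⟩ := List.mem_product.1 hst
      rw [List.mem_range] at hs ht
      have hG := h.goodTables hwf st.1 v st.2 hs hv ht
      rw [openAt_total hG.1 hG.2 hp.2 hb, openWith_eq_openAt, h.pad_eq _ _ _ hs hv ht,
        h.mac_eq _ _ _ hs hv ht]
    · rw [if_neg fun h => hp h.2, if_neg hp, Option.elim]
  · rw [if_neg fun h => hb h.1]
    split_ifs
    · rfl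
    · rfl

theorem Tabulates.relay (h : S.Tabulates κ K P M) (hwf : S.WellFormed) {l : List ℕ}
    (hl : ∀ v ∈ l, v < S.nodes κ) (pkt : Packet) :
    S.relay κ K l pkt = S.total.relayPad κ P M l pkt := by
  have hnone : ∀ l : List ℕ, l.foldl (fun (o : Option Packet) v =>
      o.elim none fun pkt => (S.total.processPad κ P M v pkt).forwarded) none = none := by
    intro l
    induction l with
    | nil => rfl
    | cons v l ih => exact ih
  induction l generalizing pkt with
  | nil => rfl
  | cons v l ih =>
    rw [Scheme.relay, relayPad, List.foldl_cons, Option.elim, h.process hwf (hl v (by simp))]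
    cases S.total.processPad κ P M v pkt with
    | forward pkt' => exact ih (fun x hx => hl x (List.mem_cons_of_mem _ hx)) pkt'
    | drop => exact (hnone l).symm
    | deliver x => exact (hnone l).symm

theorem isSlotList_slotList (seed : List Bool) : S.IsSlotList κ (S.slotList κ seed) :=
  isSlotList_permList (S.perm κ seed)

theorem Tabulates.build (h : S.Tabulates κ K P M) (hwf : S.WellFormed) {s t : ℕ} {path : List ℕ}
    {payload R seed : List Bool} (ht : t < S.window κ) (hpath : ValidPath S κ s path)
    (hpay : payload.length ≤ S.payloadLen κ) (hR : R.length = S.vecLen κ) :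
    S.build κ (K s) t path payload R seed =
      S.total.buildPad κ (fun v => P s v t) (fun v => M s v t) path payload R
        (S.slotList κ seed) := by
  have hs := hpath.2.1 s (by simp)
  have hfits := fits_hops (h.goodTables hwf) hs ht
    (fun a ha => (zip_slots_mem (fun v hv => hpath.2.1 v (List.mem_cons_of_mem _ hv))
      (isSlotList_slotList (S := S) (κ := κ) seed) ha).1)
    fun a ha => (zip_slots_mem (fun v hv => hpath.2.1 v (List.mem_cons_of_mem _ hv))
      (isSlotList_slotList (S := S) (κ := κ) seed) ha).2
  have hstage := stage_total hwf hfits hR (length_padded hpay)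
  have hnode : ∀ k ∈ hops (path.zip (S.slotList κ seed)), k.node < S.nodes κ := by
    intro k hk
    exact hpath.2.1 _ (List.mem_cons_of_mem _ (hops_node_mem (n := 0) hk))
  have hfill : (hops (path.zip (S.slotList κ seed))).foldl (S.fill κ (K s) t) R =
      (hops (path.zip (S.slotList κ seed))).foldl (S.fillPad κ fun v => P s v t) R := by
    refine List.foldl_ext _ _ _ fun X k hk => ?_
    rw [fill, fillPad, h.pad_eq _ _ _ hs (hnode k hk) ht]
    rfl
  have hwrap : ∀ X, (hops (path.zip (S.slotList κ seed))).foldr (S.wrap κ (K s) t) X =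
      (hops (path.zip (S.slotList κ seed))).foldr
        (S.wrapPad κ (fun v => P s v t) fun v => M s v t) X := by
    intro X
    refine List.foldr_ext _ _ _ fun k hk X => ?_
    rw [wrap, wrapPad, h.pad_eq _ _ _ hs (hnode k hk) ht, h.mac_eq _ _ _ hs (hnode k hk) ht]
    rfl
  rw [Scheme.build, hfill, hwrap]
  exact congrArg (Packet.mk _ _) hstage.symm

/-- An average over the random choices of the source. -/
theorem toReal_create_bind {α : Type} (t : ℕ) (path : List ℕ) (payload : List Bool)
    (K : ℕ → List Bool) (f : Packet → PMF α) (a : α) :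
    (((S.create κ K t path payload).bind f) a).toReal =
      avgBits (S.vecLen κ) fun R => avgBits (S.seedLen κ) fun seed =>
        (f (S.build κ K t path payload R seed) a).toReal := by
  rw [create, PMF.bind_bind, toReal_bind_randomBits]
  refine avgBits_congr fun R _ => ?_
  rw [PMF.bind_map, toReal_bind_randomBits]
  rfl

end Scheme

open Classical in
/-- The game against the scheme, given all random choices. -/
noncomputable def playResult (S : Scheme) (g : Game) (A : Adversary) (κ : ℕ)
    (K : ℕ → ℕ → List Bool) (r : List Bool) (b : Bool) (R₁ seed₁ R₂ seed₂ : List Bool) : Bool :=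
  let j := (A.router (view κ r [])).toNat
  let oracle : Tree → Tree := fun x => (S.process κ K j (.ofTree x)).toTree
  let answers₁ := interact (fun as => A.query₁ (view κ r as)) oracle (A.queries₁.eval κ) []
  let c := Challenge.ofTree (A.challenge (view κ r answers₁))
  let pkts := if c.Valid S κ g j then
      [linkView (S.relay κ K (c.before ++ [j])
        (S.build κ (K c.source) c.t (c.before ++ j :: c.after) c.payload₁ R₁ seed₁)),
      linkView (S.relay κ K (c.before₂ b ++ [j]) (S.build κ (K (c.source₂ b)) (c.t + 1)
        (c.before₂ b ++ j :: c.after) c.payload₂ R₂ seed₂))]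
    else [.nil, .nil]
  let answers₂ := interact (fun as => A.query₂ (view κ r as)) oracle (A.queries₂.eval κ)
    (answers₁ ++ pkts)
  (A.guess (view κ r answers₂)).toBool == b

variable {S : Scheme} {g : Game} {A : Adversary} {κ : ℕ} {K : ℕ → ℕ → List Bool}
  {P M : ℕ → ℕ → ℕ → List Bool} {r : List Bool}

theorem playResult_eq_gameResult (h : S.Tabulates κ K P M) (hwf : S.WellFormed)
    (hj : A.node κ r < S.nodes κ) (b : Bool) {R₁ R₂ : List Bool} (seed₁ seed₂ : List Bool)
    (hR₁ : R₁.length = S.vecLen κ) (hR₂ : R₂.length = S.vecLen κ) :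
    playResult S g A κ K r b R₁ seed₁ R₂ seed₂ =
      gameResult S.total g A κ P M r b R₁ R₂ (S.slotList κ seed₁) (S.slotList κ seed₂) := by
  have horacle : (fun x => (S.process κ K (A.node κ r) (.ofTree x)).toTree) =
      fun x => (S.total.processPad κ P M (A.node κ r) (.ofTree x)).toTree := by
    funext x
    rw [h.process hwf hj]
  have hviews : ∀ c : Challenge, challengeViews S.total κ g P M (A.node κ r) c b R₁ R₂
      (S.slotList κ seed₁) (S.slotList κ seed₂) = open Classical in if c.Valid S κ g
          (A.node κ r) then
      [linkView (S.relay κ K (c.before ++ [A.node κ r])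
        (S.build κ (K c.source) c.t (c.before ++ A.node κ r :: c.after) c.payload₁ R₁ seed₁)),
      linkView (S.relay κ K (c.before₂ b ++ [A.node κ r]) (S.build κ (K (c.source₂ b)) (c.t + 1)
        (c.before₂ b ++ A.node κ r :: c.after) c.payload₂ R₂ seed₂))]
    else [.nil, .nil] := by
    intro c
    by_cases hv : c.Valid S κ g (A.node κ r)
    · rw [if_pos hv, challengeViews]
      refine (if_pos (show c.Valid S.total κ g (A.node κ r) from hv)).trans ?_
      have hv₂ := hv.validPath₂ b
      obtain ⟨hp₁, hp₂, ht, -, hpath, -, -⟩ := id hv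
      have hmem : ∀ {s : ℕ} {l : List ℕ}, ValidPath S κ s (l ++ A.node κ r :: c.after) →
          ∀ v ∈ l ++ [A.node κ r], v < S.nodes κ := by
        intro s l hl v hv
        refine hl.2.1 v ?_
        simp only [List.mem_append, List.mem_cons, List.not_mem_nil, or_false] at hv ⊢
        tauto
      rw [h.relay hwf (hmem hpath), h.relay hwf (hmem hv₂), h.build hwf (by omega) hpath hp₁ hR₁,
        h.build hwf ht hv₂ hp₂ hR₂]
      rfl
    · rw [if_neg hv, challengeViews]
      exact if_neg (show ¬ c.Valid S.total κ g (A.node κ r) from hv)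
  have hgame : gameResult S.total g A κ P M r b R₁ R₂ (S.slotList κ seed₁) (S.slotList κ seed₂) =
      ((A.guess (view κ r (interact (fun as => A.query₂ (view κ r as))
        (fun x => (S.total.processPad κ P M (A.node κ r) (.ofTree x)).toTree) (A.queries₂.eval κ)
        (interact (fun as => A.query₁ (view κ r as))
          (fun x => (S.total.processPad κ P M (A.node κ r) (.ofTree x)).toTree)
          (A.queries₁.eval κ) [] ++
        challengeViews S.total κ g P M (A.node κ r) (Challenge.ofTree (A.challenge (view κ r
          (interact (fun as => A.query₁ (view κ r as))
          (fun x => (S.total.processPad κ P M (A.node κ r) (.ofTree x)).toTree)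
          (A.queries₁.eval κ) [])))) b R₁ R₂ (S.slotList κ seed₁) (S.slotList κ seed₂))))).toBool
        == b) := if_pos hj
  rw [hgame, hviews, ← horacle]
  rfl

theorem toReal_play : (play S g A κ true).toReal =
    𝔼 k : Fin (S.nodes κ) → Fin (S.nodes κ) → Fin κ → Bool,
      avgBits (A.coins.eval κ) fun r => 𝔼 b : Bool,
      avgBits (S.vecLen κ) fun R₁ => avgBits (S.seedLen κ) fun seed₁ =>
      avgBits (S.vecLen κ) fun R₂ => avgBits (S.seedLen κ) fun seed₂ =>
      ind (playResult S g A κ (fun s v => if h : s < S.nodes κ ∧ v < S.nodes κ then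
        List.ofFn (k ⟨s, h.1⟩ ⟨v, h.2⟩) else []) r b R₁ seed₁ R₂ seed₂) := by
  rw [play, Scheme.masterKeys, PMF.bind_map, toReal_bind_uniform]
  refine Finset.expect_congr rfl fun k _ => ?_
  rw [Function.comp_apply, toReal_bind_randomBits]
  refine avgBits_congr fun r _ => ?_
  rw [toReal_bind_uniform]
  refine Finset.expect_congr rfl fun b _ => ?_
  generalize (fun s v => if h : s < S.nodes κ ∧ v < S.nodes κ then
        List.ofFn (k ⟨s, h.1⟩ ⟨v, h.2⟩) else []) = K
  dsimp only [playResult]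
  generalize (A.router (view κ r [])).toNat = j
  generalize (fun x => (S.process κ K j (.ofTree x)).toTree) = oracle
  generalize interact (fun as => A.query₁ (view κ r as)) oracle (A.queries₁.eval κ) [] = as
  generalize Challenge.ofTree (A.challenge (view κ r as)) = c
  by_cases hv : c.Valid S κ g j
  · simp only [challengePackets, if_pos hv]
    rw [PMF.map_bind, Scheme.toReal_create_bind]
    refine avgBits_congr fun R₁ _ => avgBits_congr fun seed₁ _ => ?_
    rw [PMF.map_comp, ← PMF.bind_pure_comp, Scheme.toReal_create_bind]
    refine avgBits_congr fun R₂ _ => avgBits_congr fun seed₂ _ => ?_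
    rw [Function.comp_apply, toReal_pure]
    cases b <;> rfl
  -- For a refused challenge the game draws no vectors and seeds; the averages over them are
  -- averages of a constant.
  · simp only [challengePackets, if_neg hv, avgBits_const]
    rw [PMF.pure_map, toReal_pure]

/-- If the router is not a node, the two results may differ pointwise, as the tables say nothing
about it. But then no challenge is valid and the play does not depend on the bit, so both averages
over the bit are one half. -/
theorem expect_playResult (hwf : S.WellFormed) (h : S.Tabulates κ K P M) :
    (𝔼 b : Bool, avgBits (S.vecLen κ) fun R₁ => avgBits (S.seedLen κ) fun seed₁ =>
      avgBits (S.vecLen κ) fun R₂ => avgBits (S.seedLen κ) fun seed₂ =>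
      ind (playResult S g A κ K r b R₁ seed₁ R₂ seed₂)) =
    𝔼 b : Bool, avgBits (S.vecLen κ) fun R₁ => avgBits (S.seedLen κ) fun seed₁ =>
      avgBits (S.vecLen κ) fun R₂ => avgBits (S.seedLen κ) fun seed₂ =>
      ind (gameResult S.total g A κ P M r b R₁ R₂ (S.slotList κ seed₁) (S.slotList κ seed₂)) := by
  by_cases hj : A.node κ r < S.nodes κ
  · refine Finset.expect_congr rfl fun b _ => avgBits_congr fun R₁ hR₁ => avgBits_congr fun _ _ =>
      avgBits_congr fun R₂ hR₂ => avgBits_congr fun _ _ => ?_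
    rw [playResult_eq_gameResult h hwf hj b _ _ hR₁ hR₂]
  · have h₁ : ∀ (b : Bool) (R₁ R₂ : List Bool) (σ₁ σ₂ : List ℕ),
      gameResult S.total g A κ P M r b R₁ R₂ σ₁ σ₂ = b := fun _ _ _ _ _ => if_neg hj
    have h₂ : ∀ c : Challenge, ¬ c.Valid S κ g (A.router (view κ r [])).toNat := fun c hc =>
      hj (hc.2.2.2.2.1.2.1 (A.router (view κ r [])).toNat (by simp))
    obtain ⟨x, hx⟩ : ∃ x : Bool, ∀ (b : Bool) (R₁ seed₁ R₂ seed₂ : List Bool),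
        playResult S g A κ K r b R₁ seed₁ R₂ seed₂ = (x == b) := by
      refine ⟨(A.guess (view κ r (interact (fun as => A.query₂ (view κ r as))
        (fun x => (S.process κ K (A.node κ r) (.ofTree x)).toTree) (A.queries₂.eval κ)
        (interact (fun as => A.query₁ (view κ r as))
          (fun x => (S.process κ K (A.node κ r) (.ofTree x)).toTree)
          (A.queries₁.eval κ) [] ++ [.nil, .nil])))).toBool, fun b R₁ seed₁ R₂ seed₂ => ?_⟩
      rw [playResult]
      rw [if_neg (h₂ _)]
      rfl
    simp only [h₁, hx, avgBits_const]
    rw [expect_beq, ← expect_beq true]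
    exact Finset.expect_congr rfl fun b _ => by rw [Bool.true_beq]

end Ariadne

namespace Ariadne
open Enc
open scoped BigOperators

/-! ### Lists of blocks -/

theorem getElem?_flatMap_range {α : Type} {m n i j : ℕ} (f : ℕ → ℕ → α) (hi : i < m) (hj : j < n) :
    ((List.range m).flatMap fun i => (List.range n).map (f i))[i * n + j]? = some (f i j) := by
  induction m with
  | zero => omega
  | succ m ih =>
    have hlen : ((List.range m).flatMap fun i => (List.range n).map (f i)).length = m * n := by
      simp [List.length_flatMap]
    rw [List.range_succ, List.flatMap_append]
    rcases Nat.lt_succ_iff_lt_or_eq.1 hi with h | rfl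
    · rw [List.getElem?_append_left, ih h]
      rw [hlen]
      have := Nat.mul_le_mul_right n h
      rw [Nat.succ_mul] at this; omega
    · rw [List.getElem?_append_right (by omega), hlen, Nat.add_sub_cancel_left]
      simp [hj]

theorem flatMap_range_eq_map {α : Type} (m n : ℕ) (f : ℕ → α) :
    ((List.range m).flatMap fun i => (List.range n).map fun j => f (i * n + j)) =
      (List.range (m * n)).map f := by
  induction m with
  | zero => simp
  | succ m ih =>
    rw [List.range_succ, List.flatMap_append, ih, Nat.succ_mul, List.range_add, List.map_append,
      List.map_map]
    simp [Function.comp_def]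

theorem chunk_chunk {α : Type} {n w i j : ℕ} (l : List α) (hj : j < n) :
    chunk w (chunk (n * w) l i) j = chunk w l (i * n + j) := by
  have h : j * w + w ≤ n * w := by
    have := Nat.mul_le_mul_right w hj
    rwa [Nat.succ_mul] at this
  rw [chunk, chunk, chunk, List.drop_take, List.take_take, List.drop_drop]
  congr 1
  · omega
  · congr 1; ring

theorem ofFn_eq_map_range {α : Type} {n : ℕ} (f : ℕ → α) :
    (List.ofFn fun i : Fin n => f i) = (List.range n).map f :=
  List.ext_getElem (by simp) fun i h₁ h₂ => by simp

theorem length_blocks {m n i : ℕ} (u : Fin m → Fin n → Bool) (hi : i < m) :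
    (blocks u i).length = n := by simp [blocks, hi]

theorem avgBits_map_chunk {m n : ℕ} (F : List (List Bool) → ℝ) :
    avgBits (m * n) (fun x => F ((List.range m).map (chunk n x))) =
      𝔼 u : Fin m → Fin n → Bool, F ((List.range m).map (blocks u)) :=
  avgBits_chunk m n (fun f => F ((List.range m).map f)) fun _ _ h =>
    congrArg F (List.map_congr_left fun i hi => h i (List.mem_range.1 hi))

theorem expect_uncurry {β : Type} [Fintype β] {m n : ℕ} (F : (Fin m → Fin n → β) → ℝ) :
    𝔼 k, F k = 𝔼 u : Fin (m * n) → β, F fun i j => u (finProdFinEquiv (i, j)) :=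
  (Fintype.expect_equiv ((finProdFinEquiv.arrowCongr (Equiv.refl β)).symm.trans
    (Equiv.curry _ _ _)) _ _ fun _ => rfl).symm

theorem expect_append {m a b : ℕ} (F : (Fin m → Fin (a + b) → Bool) → ℝ) :
    𝔼 u, F u = 𝔼 v : Fin m → Fin a → Bool, 𝔼 w : Fin m → Fin b → Bool,
      F fun i => Fin.append (v i) (w i) := by
  rw [← expect_prod fun p : (Fin m → Fin a → Bool) × (Fin m → Fin b → Bool) =>
    F fun i => Fin.append (p.1 i) (p.2 i)]
  exact (Fintype.expect_equiv ((Equiv.arrowProdEquivProdArrow _ _ _).symm.trans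
    ((Equiv.refl (Fin m)).arrowCongr (Fin.appendEquiv a b))) _ _ fun p => rfl).symm

theorem avgBits_one (F : Bool → ℝ) : avgBits 1 (fun x => F (x.headD false)) = 𝔼 b, F b :=
  Fintype.expect_equiv (Equiv.funUnique (Fin 1) Bool) _ _ fun x => by simp

theorem abs_avgBits_sub_le {n : ℕ} {F : List Bool → ℝ} {a ε : ℝ}
    (h : ∀ x, x.length = n → |F x - a| ≤ ε) : |avgBits n F - a| ≤ ε := by
  rw [← avgBits_const n a]
  exact abs_expect_sub_le fun x => h _ List.length_ofFn

theorem randomBits_map_congr {α : Type} {n : ℕ} {f g : List Bool → α}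
    (h : ∀ x, x.length = n → f x = g x) : (randomBits n).map f = (randomBits n).map g := by
  rw [randomBits, PMF.map_comp, PMF.map_comp]
  congr 1
  funext x
  exact h _ List.length_ofFn

/-! ### Efficient primitives -/

namespace Scheme

variable {S : Scheme}

theorem Efficient.exists_kdf (h : S.Efficient) : ∃ f : ℕ × List Bool × ℕ → List Bool × List Bool,
    PT f ∧ ∀ κ k t, k.length = κ → f (κ, k, t) = S.kdf κ k t := by
  obtain ⟨F, hF, h⟩ := h.kdf
  have hF' : PT F := hF
  refine ⟨fun x => ((F (.ofList [.ofNat x.1, .ofBits x.2.1, .ofNat x.2.2])).fst.toBits,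
    (F (.ofList [.ofNat x.1, .ofBits x.2.1, .ofNat x.2.2])).snd.toBits), ?_, fun κ k t hk => ?_⟩
  · have : PT fun x : ℕ × List Bool × ℕ =>
        F (.ofList [.ofNat x.1, .ofBits x.2.1, .ofNat x.2.2]) := PT.comp hF' (by fun_prop)
    fun_prop
  · dsimp only
    rw [h κ k t hk]
    exact Prod.ext (Tree.toBits_ofBits _) (Tree.toBits_ofBits _)

theorem Efficient.exists_prg (h : S.Efficient) : ∃ f : ℕ × List Bool → List Bool,
    PT f ∧ ∀ κ k, k.length = κ → f (κ, k) = S.prg κ k := by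
  obtain ⟨F, hF, h⟩ := h.prg
  have hF' : PT F := hF
  refine ⟨fun x => (F (.ofList [.ofNat x.1, .ofBits x.2])).toBits,
    PT.tree_toBits (PT.comp hF' (by fun_prop)), fun κ k hk => ?_⟩
  dsimp only
  rw [h κ k hk, Tree.toBits_ofBits]

theorem Efficient.exists_perm (h : S.Efficient) : ∃ f : ℕ × List Bool → List ℕ,
    PT f ∧ ∀ κ seed, seed.length = S.seedLen κ → f (κ, seed) = S.slotList κ seed := by
  obtain ⟨F, hF, h⟩ := h.perm
  have hF' : PT F := hF
  refine ⟨fun x => (F (.ofList [.ofNat x.1, .ofBits x.2])).toNats,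
    PT.tree_toNats (PT.comp hF' (by fun_prop)), fun κ seed hs => ?_⟩
  dsimp only
  rw [h κ seed hs, Tree.toNats_ofNats]

/-- Efficiency promises nothing about the code on strings of wrong length, whereas the calculus
needs a function that is polynomial-time everywhere; `total` checks the lengths first. -/
theorem Efficient.feasible_total (h : S.Efficient) : S.total.Feasible := by
  have hnodes := PT.polyTimeNat h.nodes
  have hslots := PT.polyTimeNat h.slots
  have haddr := PT.polyTimeNat h.addrLen
  have hptr := PT.polyTimeNat h.ptrLen
  have hpay := PT.polyTimeNat h.payloadLen
  have hwin := PT.polyTimeNat h.window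
  have hpat : PT S.pattern := by
    obtain ⟨F, hF, h⟩ := h.pattern
    have hF' : PT F := hF
    exact hF'.congr_enc Enc.enc (fun _ => rfl) fun κ => (h κ).symm
  refine ⟨hnodes, hslots, haddr, hptr, hpay, hwin, hpat, ?_⟩
  obtain ⟨F, hF, h⟩ := h.mac
  have hF' : PT F := hF
  have hlen : PT fun κ => S.fullLen κ := by
    unfold fullLen vecLen elemLen; fun_prop
  have hmac : PT fun x : ℕ × List Bool × List Bool =>
      (F (.ofList [.ofNat x.1, .ofBits x.2.1, .ofBits x.2.2])).toBits :=
    PT.tree_toBits (PT.comp hF' (by fun_prop))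
  have hlen' : PT fun x : ℕ × List Bool × List Bool => S.fullLen x.1 := PT.comp hlen (by fun_prop)
  have : PT fun x : ℕ × List Bool × List Bool => if x.2.1.length = x.1 ∧ x.2.2.length =
      S.fullLen x.1
    then (F (.ofList [.ofNat x.1, .ofBits x.2.1, .ofBits x.2.2])).toBits else [] := by fun_prop
  refine this.congr fun x => ?_
  dsimp only [total]
  split_ifs with hx
  · rw [h _ _ _ hx.1 hx.2, Tree.toBits_ofBits]
  · rfl

end Scheme

end Ariadne

/-! ### The sequence of games: key derivation, pads, slots -/

namespace Ariadne
open Enc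
open scoped BigOperators

variable (S : Scheme) (g : Game) (A : Adversary) (q : ℕ → ℕ)
    (kd : ℕ × List Bool × ℕ → List Bool × List Bool)
  (pr : ℕ × List Bool → List Bool) (pm : ℕ × List Bool → List ℕ)

/-- The number of entries of all tables. -/
def entries (κ : ℕ) : ℕ := S.nodes κ * S.nodes κ * q κ

/-- The number of random bits of the game apart from the tables and the slots of the second
packet. -/
def tapeLen (κ : ℕ) : ℕ :=
  A.coins.eval κ + (S.vecLen κ + (S.seedLen κ + (S.vecLen κ + 1)))

/-- The game as a function of the tables, the other random bits, and the slots of the second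
packet. -/
noncomputable def tapeResult (x : ℕ × List (List Bool) × List (List Bool) × List Bool × List ℕ) :
    Bool :=
  let κ := x.1
  let u₁ := x.2.2.2.1.drop (A.coins.eval κ)
  let u₂ := u₁.drop (S.vecLen κ)
  let u₃ := u₂.drop (S.seedLen κ)
  gameResult S.total g A κ (table (S.nodes κ) (q κ) x.2.1) (table (S.nodes κ) (q κ) x.2.2.1)
    (x.2.2.2.1.take (A.coins.eval κ)) ((u₃.drop (S.vecLen κ)).headD false)
    (u₁.take (S.vecLen κ)) (u₃.take (S.vecLen κ)) (pm (κ, u₂.take (S.seedLen κ))) x.2.2.2.2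

variable {S g A q kd pr pm}

theorem avgBits_tapeResult {κ : ℕ}
    (hpm : ∀ seed : List Bool, seed.length = S.seedLen κ → pm (κ, seed) = S.slotList κ seed)
    (pads macs : List (List Bool)) (σ : List ℕ) :
    avgBits (tapeLen S A κ) (fun u => ind (tapeResult S g A q pm (κ, pads, macs, u, σ))) =
    avgBits (A.coins.eval κ) fun r => avgBits (S.vecLen κ) fun R₁ => avgBits (S.seedLen κ) fun sd =>
      avgBits (S.vecLen κ) fun R₂ => 𝔼 b : Bool,
        ind (gameResult S.total g A κ (table (S.nodes κ) (q κ) pads) (table (S.nodes κ) (q κ) macs)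
          r b R₁ R₂ (S.slotList κ sd) σ) := by
  rw [tapeLen, avgBits_add]
  refine avgBits_congr fun r hr => ?_
  rw [avgBits_add]
  refine avgBits_congr fun R₁ hR₁ => ?_
  rw [avgBits_add]
  refine avgBits_congr fun sd hsd => ?_
  rw [avgBits_add]
  refine avgBits_congr fun R₂ hR₂ => ?_
  rw [← avgBits_one]
  refine avgBits_congr fun x _ => ?_
  simp only [tapeResult, List.drop_left' hr, List.take_left' hr, List.drop_left' hR₁,
    List.take_left' hR₁, List.drop_left' hsd, List.take_left' hsd, List.drop_left' hR₂,
    List.take_left' hR₂, hpm sd hsd]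

theorem pt_tapeResult (hS : S.total.Feasible) (hsd : PT S.seedLen) (hq : PT q) (hpm : PT pm) :
    PT (tapeResult S g A q pm) := by
  have hn : PT fun x : (ℕ × List (List Bool) × List
      (List Bool) × List Bool × List ℕ) × ℕ × ℕ × ℕ => S.nodes x.1.1 := PT.comp hS.nodes
      (by fun_prop)
  have hq' : PT fun x : (ℕ × List (List Bool) × List
      (List Bool) × List Bool × List ℕ) × ℕ × ℕ × ℕ => q x.1.1 := PT.comp hq (by fun_prop)
  have hv : PT fun x : ℕ × List (List Bool) × List (List Bool) × List Bool × List ℕ =>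
      S.vecLen x.1 := Scheme.pt_vecLen (S := S.total) PT.fst'
  have hs : PT fun x : ℕ × List (List Bool) × List (List Bool) × List Bool × List ℕ =>
      S.seedLen x.1 := PT.comp hsd (by fun_prop)
  have hu₁ : PT fun x : ℕ × List (List Bool) × List (List Bool) × List Bool × List ℕ =>
      x.2.2.2.1.drop (A.coins.eval x.1) := by fun_prop
  refine pt_gameResult (S := S.total) (P := fun x : ℕ × List (List Bool) × List
      (List Bool) × List Bool × List ℕ => table (S.nodes x.1) (q x.1) x.2.1)
    (M := fun x : ℕ × List (List Bool) × List (List Bool) × List Bool × List ℕ => table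
        (S.nodes x.1) (q x.1) x.2.2.1) (B := fun x : ℕ × List (List Bool) × List
        (List Bool) × List Bool × List ℕ => esize x.2.1) g A
    PT.fst' (PT.table hn hq' ?_ ?_ ?_ ?_) (PT.table hn hq' ?_ ?_ ?_ ?_) (PT.pb ?_)
    (fun x s v t => table_length_le _ _ _ _ _ _) ?_ ?_ ?_ ?_ (PT.comp hpm ?_) ?_
  all_goals fun_prop

/-! ### Key derivation -/

/-- The keys that are derived from a master key, as a list. -/
def kdfSample (x : ℕ × List Bool) : Tree :=
  .ofList ((List.range (q x.1)).map fun t =>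
    .cons (.ofBits (kd (x.1, x.2, t)).1) (.ofBits (kd (x.1, x.2, t)).2))

/-- The list of pairs of keys in a bit string. -/
def pairSample (x : ℕ × List Bool) : Tree :=
  .ofList ((List.range (q x.1)).map fun t => .cons (.ofBits ((chunk (x.1 + x.1) x.2 t).take x.1))
    (.ofBits ((chunk (x.1 + x.1) x.2 t).drop x.1)))

variable (S g A q pr pm) in
/-- The game as a function of the derived keys. -/
noncomputable def kdfTest (x : ℕ × List Bool × List Tree) : Bool :=
  tapeResult S g A q pm (x.1,
    (x.2.2.flatMap Tree.toList).map (fun y => pr (x.1, y.fst.toBits)),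
    (x.2.2.flatMap Tree.toList).map (fun y => y.snd.toBits),
    x.2.1.take (tapeLen S A x.1), pm (x.1, x.2.1.drop (tapeLen S A x.1)))

theorem pt_kdfSample (hq : PT q) (hkd : PT kd) : PT (kdfSample (q := q) (kd := kd)) := by
  have h : PT fun x : (ℕ × List Bool) × ℕ => kd (x.1.1, x.1.2, x.2) := PT.comp hkd (by fun_prop)
  refine PT.tree_ofList (PT.map (g := fun (x : ℕ × List Bool) t => Tree.cons
    (.ofBits (kd (x.1, x.2, t)).1) (.ofBits (kd (x.1, x.2, t)).2)) ?_ (by fun_prop))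
  have : PT fun x : ℕ × List Bool => q x.1 := PT.comp hq (by fun_prop)
  fun_prop

theorem pt_pairSample (hq : PT q) : PT (pairSample (q := q)) := by
  refine PT.tree_ofList (PT.map (g := fun (x : ℕ × List Bool) t => Tree.cons
    (.ofBits ((chunk (x.1 + x.1) x.2 t).take x.1)) (.ofBits ((chunk (x.1 + x.1) x.2 t).drop x.1)))
    ?_ (by fun_prop))
  have : PT fun x : ℕ × List Bool => q x.1 := PT.comp hq (by fun_prop)
  fun_prop

theorem pt_tapeLen (hS : S.total.Feasible) (hsd : PT S.seedLen) : PT (tapeLen S A) := by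
  have hv : PT fun κ => S.vecLen κ := Scheme.pt_vecLen (S := S.total) PT.id
  unfold tapeLen
  fun_prop

theorem pt_kdfTest (hS : S.total.Feasible) (hsd : PT S.seedLen) (hq : PT q) (hpr : PT pr)
    (hpm : PT pm) : PT (kdfTest S g A q pr pm) := by
  have hl : PT fun x : ℕ × List Bool × List Tree => tapeLen S A x.1 :=
    PT.comp (pt_tapeLen hS hsd) (by fun_prop)
  have he : PT fun x : ℕ × List Bool × List Tree => x.2.2.flatMap Tree.toList :=
    PT.flatMap (g := fun (_ : ℕ × List Bool × List Tree) (y : Tree) => y.toList) (by fun_prop)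
        (by fun_prop)
  have hp : PT fun x : (ℕ × List Bool × List Tree) × Tree => pr (x.1.1, x.2.fst.toBits) :=
    PT.comp hpr (by fun_prop)
  have hpads : PT fun x : ℕ × List Bool × List Tree =>
      (x.2.2.flatMap Tree.toList).map (fun y => pr (x.1, y.fst.toBits)) :=
    PT.map (g := fun (x : ℕ × List Bool × List Tree) (y : Tree) => pr (x.1, y.fst.toBits)) he hp
  have hmacs : PT fun x : ℕ × List Bool × List Tree =>
      (x.2.2.flatMap Tree.toList).map (fun y => y.snd.toBits) :=
    PT.map (g := fun (_ : ℕ × List Bool × List Tree) (y : Tree) => y.snd.toBits) he (by fun_prop)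
  have hσ : PT fun x : ℕ × List Bool × List Tree => pm (x.1, x.2.1.drop (tapeLen S A x.1)) :=
    PT.comp hpm (by fun_prop)
  unfold kdfTest
  exact PT.comp (pt_tapeResult hS hsd hq hpm) (by fun_prop)

theorem kdf_real_eq (qp : ℕ[X]) (hkd : ∀ κ k t, k.length = κ → kd (κ, k, t) = S.kdf κ k t) (κ : ℕ) :
    ((randomBits κ).map fun k => Tree.ofList (List.ofFn fun t : Fin (qp.eval κ) =>
      .cons (.ofBits (S.kdf κ k t).1) (.ofBits (S.kdf κ k t).2))) =
    (randomBits κ).map fun x => kdfSample (q := fun κ => qp.eval κ) (kd := kd) (κ, x) := by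
  refine randomBits_map_congr fun k hk => ?_
  rw [ofFn_eq_map_range fun t => Tree.cons (.ofBits (S.kdf κ k t).1) (.ofBits (S.kdf κ k t).2),
    kdfSample]
  simp only [hkd κ k _ hk]

/-- Uniform pairs of keys are read off one random bit string, since the hybrid argument has to
sample both distributions from coins. -/
theorem kdf_ideal_eq (qp : ℕ[X]) (κ : ℕ) :
    ((PMF.uniformOfFintype (Fin (qp.eval κ) → (Fin κ → Bool) × (Fin κ → Bool))).map
      fun u => Tree.ofList (List.ofFn fun t =>
        .cons (.ofBits (List.ofFn (u t).1)) (.ofBits (List.ofFn (u t).2)))) =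
    (randomBits (qp.eval κ * (κ + κ))).map fun x =>
      pairSample (q := fun κ => qp.eval κ) (κ, x) := by
  rw [← randomBits_map_equiv (((finProdFinEquiv.arrowCongr (Equiv.refl Bool)).symm.trans
    (Equiv.curry (Fin (qp.eval κ)) (Fin (κ + κ)) Bool)).trans
    ((Equiv.refl _).arrowCongr (Fin.appendEquiv κ κ).symm)), PMF.map_comp, randomBits, PMF.map_comp]
  congr 1
  funext x
  rw [Function.comp_apply, Function.comp_apply, pairSample]
  dsimp only
  congr 1
  refine List.ext_getElem (by simp) fun i h₁ h₂ => ?_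
  have hi : i < qp.eval κ := by simpa using h₂
  rw [List.getElem_ofFn, List.getElem_map, List.getElem_range, chunk_ofFn x ⟨i, hi⟩]
  obtain ⟨p, hp⟩ := (Fin.appendEquiv κ κ).surjective fun j => x (finProdFinEquiv (⟨i, hi⟩, j))
  have hp' : (((finProdFinEquiv.arrowCongr (Equiv.refl Bool)).symm.trans
    (Equiv.curry (Fin (qp.eval κ)) (Fin (κ + κ)) Bool)).trans
    ((Equiv.refl _).arrowCongr (Fin.appendEquiv κ κ).symm)) x ⟨i, hi⟩ = p := by
    change (Fin.appendEquiv κ κ).symm (fun j => x (finProdFinEquiv (⟨i, hi⟩, j))) = p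
    rw [Equiv.symm_apply_eq, hp]
  rw [hp', ← hp]
  have happ : List.ofFn (Fin.appendEquiv κ κ p) = List.ofFn p.1 ++ List.ofFn p.2 :=
    List.ofFn_fin_append _ _
  rw [happ, List.take_left' (by simp), List.drop_left' (by simp)]

/-! ### The values of the games -/

variable (S g A q pm) in
/-- The probability that the adversary wins, for the given distributions of the tables. -/
noncomputable def tableValue (κ : ℕ) (pads macs : List (List Bool)) : ℝ :=
  avgBits (tapeLen S A κ) fun u => avgBits (S.seedLen κ) fun sd =>
    ind (tapeResult S g A q pm (κ, pads, macs, u, S.slotList κ sd))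

theorem avgBits_kdfTest {κ : ℕ}
    (hpm : ∀ seed : List Bool, seed.length = S.seedLen κ → pm (κ, seed) = S.slotList κ seed)
    (L : List Tree) :
    avgBits (tapeLen S A κ + S.seedLen κ) (fun c => ind (kdfTest S g A q pr pm (κ, c, L))) =
      tableValue S g A q pm κ ((L.flatMap Tree.toList).map fun y => pr (κ, y.fst.toBits))
        ((L.flatMap Tree.toList).map fun y => y.snd.toBits) := by
  rw [avgBits_add, tableValue]
  refine avgBits_congr fun u hu => avgBits_congr fun sd hsd => ?_
  rw [kdfTest]
  dsimp only
  rw [List.take_left' hu, List.drop_left' hu, hpm sd hsd]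

theorem table_flatMap {N n : ℕ} {f : ℕ → ℕ → Tree} {h : Tree → List Bool} {s v t : ℕ}
    (hs : s < N) (hv : v < N) (ht : t < n) :
    table N n ((((List.range (N * N)).map fun j => Tree.ofList ((List.range n).map (f j))).flatMap
      Tree.toList).map h) s v t = h (f (s * N + v) t) := by
  have hidx : s * N + v < N * N := by
    have := Nat.mul_le_mul_right N hs
    rw [Nat.succ_mul] at this; omega
  rw [table, if_pos ⟨hs, hv, ht⟩, List.getD_eq_getElem?_getD, List.getElem?_map, List.flatMap_map]
  simp only [Tree.toList_ofList]
  rw [getElem?_flatMap_range f hidx ht]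
  rfl

/-- The real game is the test on one key-derivation sample for each ordered pair of source and node.
The tables may have more indices than the window, because the number of derived keys must be a
polynomial. -/
theorem toReal_play_eq (hwf : S.WellFormed) (hW : ∀ κ, S.window κ ≤ q κ)
    (hkd : ∀ κ k t, k.length = κ → kd (κ, k, t) = S.kdf κ k t)
    (hpr : ∀ κ k, k.length = κ → pr (κ, k) = S.prg κ k)
    (hpm : ∀ κ seed, seed.length = S.seedLen κ → pm (κ, seed) = S.slotList κ seed) (κ : ℕ) :
    (play S g A κ true).toReal =
      𝔼 u : Fin (S.nodes κ * S.nodes κ) → Fin κ → Bool,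
        avgBits (tapeLen S A κ + S.seedLen κ) fun c => ind (kdfTest S g A q pr pm (κ, c,
          (List.range (S.nodes κ * S.nodes κ)).map fun j =>
            kdfSample (q := q) (kd := kd) (κ, blocks u j))) := by
  rw [toReal_play, expect_uncurry]
  refine Finset.expect_congr rfl fun u _ => ?_
  rw [avgBits_kdfTest (hpm κ)]
  set L := ((List.range (S.nodes κ * S.nodes κ)).map fun j =>
    kdfSample (q := q) (kd := kd) (κ, blocks u j)).flatMap Tree.toList with hL
  have htab : S.Tabulates κ (fun s v => if h : s < S.nodes κ ∧ v < S.nodes κ then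
        List.ofFn (u (finProdFinEquiv (⟨s, h.1⟩, ⟨v, h.2⟩))) else [])
      (table (S.nodes κ) (q κ) (L.map fun y => pr (κ, y.fst.toBits)))
      (table (S.nodes κ) (q κ) (L.map fun y => y.snd.toBits)) := by
    have hblock : ∀ s v, s < S.nodes κ → v < S.nodes κ → (if h : s < S.nodes κ ∧ v < S.nodes κ then
        List.ofFn (u (finProdFinEquiv (⟨s, h.1⟩, ⟨v, h.2⟩))) else []) =
        blocks u (s * S.nodes κ + v) := by
      intro s v hs hv
      have hidx : s * S.nodes κ + v < S.nodes κ * S.nodes κ := by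
        have := Nat.mul_le_mul_right (S.nodes κ) hs
        rw [Nat.succ_mul] at this; omega
      rw [dif_pos ⟨hs, hv⟩, blocks, dif_pos hidx]
      congr 2
      ext
      simp [finProdFinEquiv, Nat.mul_comm, Nat.add_comm]
    have hlen : ∀ s v, s < S.nodes κ → v < S.nodes κ →
        (blocks u (s * S.nodes κ + v)).length = κ := by
      intro s v hs hv
      rw [← hblock s v hs hv, dif_pos ⟨hs, hv⟩, List.length_ofFn]
    refine ⟨fun s v hs hv => ?_, fun s v t hs hv ht => ?_, fun s v t hs hv ht => ?_⟩
    · rw [hblock s v hs hv, hlen s v hs hv]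
    · have htq := ht.trans_le (hW κ)
      have hk := hlen s v hs hv
      rw [hblock s v hs hv, hL]
      simp only [kdfSample]
      rw [table_flatMap hs hv htq, hkd _ _ _ hk]
      change pr (κ, (Tree.ofBits _).toBits) = _
      rw [Tree.toBits_ofBits, hpr _ _ (hwf.kdf_length _ _ _ hk).1]
      rfl
    · have htq := ht.trans_le (hW κ)
      have hk := hlen s v hs hv
      rw [hblock s v hs hv, hL]
      simp only [kdfSample]
      rw [table_flatMap hs hv htq, hkd _ _ _ hk]
      exact Tree.toBits_ofBits _
  have key := avgBits_congr (n := A.coins.eval κ) fun r _ =>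
    expect_playResult (g := g) (A := A) (r := r) hwf htab
  rw [key, tableValue, avgBits_comm]
  have h1 := fun sd => avgBits_tapeResult (S := S) (g := g) (A := A) (q := q) (hpm κ)
    (L.map fun y => pr (κ, y.fst.toBits)) (L.map fun y => y.snd.toBits) (S.slotList κ sd)
  simp only [h1]
  rw [avgBits_comm]
  refine avgBits_congr fun r _ => ?_
  simp only [← avgBits_expect]
  conv_rhs => rw [avgBits_comm]
  refine avgBits_congr fun R₁ _ => ?_
  conv_rhs => rw [avgBits_comm]
  refine avgBits_congr fun sd₁ _ => ?_
  conv_rhs => rw [avgBits_comm]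

/-- The ideal samples, regrouped, are one uniform pair for each entry of the tables, and the halves
of the pairs form two independent families: seeds of the generator and MAC keys. -/
theorem expect_kdfTest_pairSample
    (hpm : ∀ κ seed, seed.length = S.seedLen κ → pm (κ, seed) = S.slotList κ seed) (κ : ℕ) :
    𝔼 u : Fin (S.nodes κ * S.nodes κ) → Fin (q κ * (κ + κ)) → Bool,
        avgBits (tapeLen S A κ + S.seedLen κ) (fun c => ind (kdfTest S g A q pr pm (κ, c,
          (List.range (S.nodes κ * S.nodes κ)).map fun j =>
            pairSample (q := q) (κ, blocks u j)))) =
      𝔼 e : Fin (entries S q κ) → Fin κ → Bool, 𝔼 w : Fin (entries S q κ) → Fin κ → Bool,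
        tableValue S g A q pm κ ((List.range (entries S q κ)).map fun i => pr (κ, blocks e i))
          ((List.range (entries S q κ)).map (blocks w)) := by
  simp only [avgBits_kdfTest (hpm κ), entries]
  set N := S.nodes κ * S.nodes κ
  set F : List Tree → ℝ := fun L => tableValue S g A q pm κ
    (L.map fun y => pr (κ, y.fst.toBits)) (L.map fun y => y.snd.toBits) with hF
  set f : List Bool → Tree := fun x => .cons (.ofBits (x.take κ)) (.ofBits (x.drop κ)) with hf
  have h₁ : ∀ B : ℕ → List Bool, ((List.range N).map fun j =>
      pairSample (q := q) (κ, B j)).flatMap Tree.toList =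
      (List.range N).flatMap fun j => (List.range (q κ)).map fun t =>
        f (chunk (κ + κ) (B j) t) := by
    intro B
    rw [List.flatMap_map]
    simp only [pairSample, Tree.toList_ofList, hf]
  calc 𝔼 u : Fin N → Fin (q κ * (κ + κ)) → Bool, F (((List.range N).map fun j =>
        pairSample (q := q) (κ, blocks u j)).flatMap Tree.toList)
      = avgBits (N * (q κ * (κ + κ))) fun x => F (((List.range N).map fun j =>
        pairSample (q := q) (κ, chunk (q κ * (κ + κ)) x j)).flatMap Tree.toList) := by
        refine (avgBits_chunk N (q κ * (κ + κ)) (fun B => F (((List.range N).map fun j =>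
          pairSample (q := q) (κ, B j)).flatMap Tree.toList)) fun B B' h => ?_).symm
        rw [List.map_congr_left fun j hj => by rw [h j (List.mem_range.1 hj)]]
    -- The nested blocks, first by master key and then by index, are flattened into a single level.
    _ = avgBits (N * q κ * (κ + κ)) fun x => F ((List.range (N * q κ)).map fun i =>
        f (chunk (κ + κ) x i)) := by
        rw [Nat.mul_assoc N (q κ) (κ + κ)]
        refine avgBits_congr fun x _ => ?_
        rw [h₁, ← flatMap_range_eq_map]
        congr 1
        refine List.flatMap_congr fun j _ => List.map_congr_left fun t ht => ?_
        rw [chunk_chunk _ (List.mem_range.1 ht)]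
    _ = 𝔼 u : Fin (N * q κ) → Fin (κ + κ) → Bool, F ((List.range (N * q κ)).map fun i =>
        f (blocks u i)) := by
        refine avgBits_chunk _ _ (fun B => F ((List.range (N * q κ)).map fun i => f (B i)))
          fun B B' h => ?_
        rw [List.map_congr_left fun j hj => by rw [h j (List.mem_range.1 hj)]]
    _ = _ := by
        rw [expect_append]
        refine Finset.expect_congr rfl fun e _ => Finset.expect_congr rfl fun w _ => ?_
        have hb : ∀ i < N * q κ, blocks (fun i => Fin.append (e i) (w i)) i =
            blocks e i ++ blocks w i := by
          intro i hi
          simp only [blocks, dif_pos hi]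
          exact List.ofFn_fin_append _ _
        have hfst : ∀ i < N * q κ, (f (blocks (fun i => Fin.append (e i) (w i)) i)).fst.toBits =
            blocks e i := fun i hi => by
          change (Tree.ofBits _).toBits = _
          rw [hb i hi, Tree.toBits_ofBits, List.take_left' (length_blocks e hi)]
        have hsnd : ∀ i < N * q κ, (f (blocks (fun i => Fin.append (e i) (w i)) i)).snd.toBits =
            blocks w i := fun i hi => by
          change (Tree.ofBits _).toBits = _
          rw [hb i hi, Tree.toBits_ofBits, List.drop_left' (length_blocks e hi)]
        simp only [hF, List.map_map]
        congr 1
        · exact List.map_congr_left fun i hi => by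
            rw [Function.comp_apply, hfst i (List.mem_range.1 hi)]
        · exact List.map_congr_left fun i hi => hsnd i (List.mem_range.1 hi)

/-! ### Pads -/

variable (S g A q pm) in
/-- The game as a function of the pads. -/
noncomputable def prgTest (x : ℕ × List Bool × List Tree) : Bool :=
  let m := entries S q x.1
  let u := x.2.1.drop (m * x.1)
  tapeResult S g A q pm (x.1, x.2.2.map Tree.toBits,
    (List.range m).map (fun i => chunk x.1 (x.2.1.take (m * x.1)) i),
    u.take (tapeLen S A x.1), pm (x.1, u.drop (tapeLen S A x.1)))

theorem pt_entries (hS : S.total.Feasible) (hq : PT q) : PT (entries S q) := by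
  have hn : PT fun κ => S.nodes κ := hS.nodes
  unfold entries
  fun_prop

theorem pt_prgTest (hS : S.total.Feasible) (hsd : PT S.seedLen) (hq : PT q) (hpm : PT pm) :
    PT (prgTest S g A q pm) := by
  have hl : PT fun x : ℕ × List Bool × List Tree => tapeLen S A x.1 :=
    PT.comp (pt_tapeLen hS hsd) (by fun_prop)
  have hm : PT fun x : ℕ × List Bool × List Tree => entries S q x.1 :=
    PT.comp (pt_entries hS hq) (by fun_prop)
  have hm' : PT fun x : (ℕ × List Bool × List Tree) × ℕ => entries S q x.1.1 :=
    PT.comp (pt_entries hS hq) (by fun_prop)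
  have hmacs : PT fun x : ℕ × List Bool × List Tree => (List.range (entries S q x.1)).map
      (fun i => chunk x.1 (x.2.1.take (entries S q x.1 * x.1)) i) :=
    PT.map (g := fun (x : ℕ × List Bool × List Tree) i =>
      chunk x.1 (x.2.1.take (entries S q x.1 * x.1)) i) (by fun_prop) (by fun_prop)
  have hpads : PT fun x : ℕ × List Bool × List Tree => x.2.2.map Tree.toBits :=
    PT.map (g := fun (_ : ℕ × List Bool × List Tree) (y : Tree) => y.toBits) (by fun_prop)
      (by fun_prop)
  have hσ : PT fun x : ℕ × List Bool × List Tree =>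
      pm (x.1, (x.2.1.drop (entries S q x.1 * x.1)).drop (tapeLen S A x.1)) :=
    PT.comp hpm (by fun_prop)
  unfold prgTest
  exact PT.comp (pt_tapeResult hS hsd hq hpm) (by fun_prop)

theorem avgBits_prgTest
    (hpm : ∀ κ seed, seed.length = S.seedLen κ → pm (κ, seed) = S.slotList κ seed) (κ : ℕ)
    (L : List Tree) :
    avgBits (entries S q κ * κ + (tapeLen S A κ + S.seedLen κ))
        (fun c => ind (prgTest S g A q pm (κ, c, L))) =
      𝔼 w : Fin (entries S q κ) → Fin κ → Bool,
        tableValue S g A q pm κ (L.map Tree.toBits) ((List.range (entries S q κ)).map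
            (blocks w)) := by
  rw [← avgBits_map_chunk fun macs => tableValue S g A q pm κ (L.map Tree.toBits) macs, avgBits_add]
  refine avgBits_congr fun x hx => ?_
  rw [avgBits_add, tableValue]
  refine avgBits_congr fun u hu => avgBits_congr fun sd hsd => ?_
  simp only [prgTest]
  rw [List.drop_left' hx, List.take_left' hx, List.take_left' hu, List.drop_left' hu, hpm κ sd hsd]

/-! ### Slots -/

variable (S g A q pm) in
/-- The game as a function of the slots of the second packet. -/
noncomputable def permTest (x : ℕ × List Bool × Tree) : Bool :=
  let m := entries S q x.1
  let u := x.2.1.drop (m * x.1)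
  tapeResult S g A q pm (x.1,
    (List.range m).map (fun i => chunk (S.padLen x.1) (u.drop (tapeLen S A x.1)) i),
    (List.range m).map (fun i => chunk x.1 (x.2.1.take (m * x.1)) i),
    u.take (tapeLen S A x.1), x.2.2.toNats)

theorem pt_padLen (hS : S.total.Feasible) : PT fun κ => S.padLen κ := by
  have h₁ : PT fun κ => S.elemLen κ := Scheme.pt_elemLen (S := S.total) PT.id
  have h₂ : PT fun κ => S.fullLen κ := Scheme.pt_fullLen (S := S.total) PT.id
  unfold Scheme.padLen
  fun_prop

theorem pt_permTest (hS : S.total.Feasible) (hsd : PT S.seedLen) (hq : PT q) (hpm : PT pm) :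
    PT (permTest S g A q pm) := by
  have hl : PT fun x : ℕ × List Bool × Tree => tapeLen S A x.1 :=
    PT.comp (pt_tapeLen hS hsd) (by fun_prop)
  have hm : PT fun x : ℕ × List Bool × Tree => entries S q x.1 :=
    PT.comp (pt_entries hS hq) (by fun_prop)
  have hl' : PT fun x : (ℕ × List Bool × Tree) × ℕ => tapeLen S A x.1.1 :=
    PT.comp (pt_tapeLen hS hsd) (by fun_prop)
  have hm' : PT fun x : (ℕ × List Bool × Tree) × ℕ => entries S q x.1.1 :=
    PT.comp (pt_entries hS hq) (by fun_prop)
  have hp' : PT fun x : (ℕ × List Bool × Tree) × ℕ => S.padLen x.1.1 :=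
    PT.comp (pt_padLen hS) (by fun_prop)
  have hmacs : PT fun x : ℕ × List Bool × Tree => (List.range (entries S q x.1)).map
      (fun i => chunk x.1 (x.2.1.take (entries S q x.1 * x.1)) i) :=
    PT.map (g := fun (x : ℕ × List Bool × Tree) i =>
      chunk x.1 (x.2.1.take (entries S q x.1 * x.1)) i) (by fun_prop) (by fun_prop)
  have hpads : PT fun x : ℕ × List Bool × Tree => (List.range (entries S q x.1)).map
      (fun i => chunk (S.padLen x.1) ((x.2.1.drop (entries S q x.1 * x.1)).drop
        (tapeLen S A x.1)) i) :=
    PT.map (g := fun (x : ℕ × List Bool × Tree) i =>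
      chunk (S.padLen x.1) ((x.2.1.drop (entries S q x.1 * x.1)).drop
        (tapeLen S A x.1)) i) (by fun_prop) (by fun_prop)
  unfold permTest
  exact PT.comp (pt_tapeResult hS hsd hq hpm) (by fun_prop)

variable (S g A q pm) in
/-- The probability that the adversary wins if the tables are random, for the given slots of the
second packet. -/
noncomputable def slotValue (κ : ℕ) (σ : List ℕ) : ℝ :=
  𝔼 w : Fin (entries S q κ) → Fin κ → Bool, avgBits (tapeLen S A κ) fun u =>
    𝔼 p : Fin (entries S q κ) → Fin (S.padLen κ) → Bool,
      ind (tapeResult S g A q pm (κ, (List.range (entries S q κ)).map (blocks p),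
        (List.range (entries S q κ)).map (blocks w), u, σ))

theorem avgBits_permTest (κ : ℕ) (x : Tree) :
    avgBits (entries S q κ * κ + (tapeLen S A κ + entries S q κ * S.padLen κ))
        (fun c => ind (permTest S g A q pm (κ, c, x))) = slotValue S g A q pm κ x.toNats := by
  rw [slotValue, ← avgBits_map_chunk fun macs => avgBits (tapeLen S A κ) fun u =>
    𝔼 p : Fin (entries S q κ) → Fin (S.padLen κ) → Bool,
      ind (tapeResult S g A q pm (κ, (List.range (entries S q κ)).map (blocks p), macs, u,
        x.toNats)), avgBits_add]
  refine avgBits_congr fun y hy => ?_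
  rw [avgBits_add]
  refine avgBits_congr fun u hu => ?_
  rw [← avgBits_map_chunk fun pads => ind (tapeResult S g A q pm (κ, pads, (List.range
    (entries S q κ)).map (chunk κ y), u, x.toNats))]
  refine avgBits_congr fun p _ => ?_
  simp only [permTest]
  rw [List.drop_left' hy, List.take_left' hy, List.take_left' hu, List.drop_left' hu]

theorem expect_tableValue (κ : ℕ) :
    𝔼 p : Fin (entries S q κ) → Fin (S.padLen κ) → Bool,
      𝔼 w : Fin (entries S q κ) → Fin κ → Bool,
        tableValue S g A q pm κ ((List.range (entries S q κ)).map (blocks p))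
          ((List.range (entries S q κ)).map (blocks w)) =
      avgBits (S.seedLen κ) fun sd => slotValue S g A q pm κ (S.slotList κ sd) := by
  simp only [slotValue, tableValue]
  rw [Finset.expect_comm, avgBits_expect]
  refine Finset.expect_congr rfl fun w _ => ?_
  rw [avgBits_comm]
  rw [← avgBits_expect]
  refine avgBits_congr fun u _ => ?_
  rw [avgBits_expect]

/-- The bound for random pads holds for every choice of MAC keys, coins, initial vectors and seed of
the first packet, so averaging over all of these preserves it. -/
theorem abs_expect_slotValue_le (hwf : S.WellFormed) (hW : ∀ κ, S.window κ ≤ q κ)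
    (hpm : ∀ κ seed, seed.length = S.seedLen κ → pm (κ, seed) = S.slotList κ seed) (κ : ℕ) :
    |(𝔼 σ : Equiv.Perm (Fin (S.slots κ)), slotValue S g A q pm κ (permList σ)) - 1 / 2| ≤
    ((A.queries₁.eval κ + A.queries₂.eval κ + S.slots κ + S.slots κ) * S.nodes κ * S.window κ : ℕ)
      * (1 / 2 : ℝ) ^ κ := by
  generalize hε : ((A.queries₁.eval κ + A.queries₂.eval κ + S.slots κ + S.slots κ) * S.nodes κ *
      S.window κ : ℕ) * (1 / 2 : ℝ) ^ κ = ε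
  simp only [slotValue]
  rw [Finset.expect_comm, ← Fintype.expect_const (ι := Fin (entries S q κ) → Fin κ → Bool)
    (1 / 2 : ℝ)]
  refine abs_expect_sub_le fun w => ?_
  simp only [avgBits_expect, avgBits_tapeResult (hpm κ)]
  simp only [← avgBits_expect]
  refine abs_avgBits_sub_le fun r _ => abs_avgBits_sub_le fun R₁ hR₁ => abs_avgBits_sub_le
    fun sd _ => abs_avgBits_sub_le fun R₂ hR₂ => ?_
  have h := abs_expect_gameResult_le (S := S.total) (g := g) (A := A) (r := r) (q := q κ)
    (M := randTable (S.nodes κ) (q κ) w) hwf.total (hW κ)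
    (fun s v t hs hv ht => length_randTable w hs hv (ht.trans_le (hW κ))) hR₁ hR₂
    (Scheme.isSlotList_slotList (S := S.total) sd)
  rw [← hε]
  refine le_trans (le_of_eq ?_) h
  congr 2
  symm
  rw [Finset.expect_comm]
  exact Finset.expect_congr rfl fun σ _ => Finset.expect_comm _ _ _

/-! ### The theorem -/

/-- The advantage is the sum of the gaps of the three hops and the advantage that remains with
random pads and slots; all four are negligible. -/
theorem unlinkable (hwf : S.WellFormed) (heff : S.Efficient) (hprg : S.PRGSecure)
    (hkdf : S.KDFSecure) (hperm : S.PermSecure) (g : Game) : Unlinkable S g := by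
  intro A
  obtain ⟨kd, hkd, hkd'⟩ := heff.exists_kdf
  obtain ⟨pr, hpr, hpr'⟩ := heff.exists_prg
  obtain ⟨pm, hpm, hpm'⟩ := heff.exists_perm
  have hS := heff.feasible_total
  have hsd := PT.polyTimeNat heff.seedLen
  -- Security of the key derivation is stated for polynomial numbers of keys, so the window is
  -- enlarged to a polynomial.
  obtain ⟨qp, hW⟩ := (PT.polyTimeNat heff.window).pb_nat.exists_poly
  set q : ℕ → ℕ := fun κ => qp.eval κ with hqdef
  have hq : PT q := by fun_prop
  have hnodes : PT S.nodes := hS.nodes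
  have hslots : PT S.slots := hS.slots
  have hwindow : PT S.window := hS.window
  have htape : PT (tapeLen S A) := pt_tapeLen hS hsd
  have hentries : PT (entries S q) := pt_entries hS hq
  have hpad : PT fun κ => S.padLen κ := pt_padLen hS
  -- Derived keys become independent uniform keys, simultaneously for all master keys.
  have h₁ := (hkdf qp).negligible_samples (fun κ => kdf_real_eq qp hkd' κ)
    (fun κ => kdf_ideal_eq qp κ) (cX := fun κ => κ) (m := fun κ => S.nodes κ * S.nodes κ)
    (c := fun κ => tapeLen S A κ + S.seedLen κ) (by fun_prop) (by fun_prop) (by fun_prop)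
    (by fun_prop) (pt_kdfSample hq hkd) (pt_pairSample hq)
    (pt_kdfTest (g := g) (A := A) hS hsd hq hpr hpm)
  -- The pads become uniform; the MAC keys, already uniform, are taken from the coins of the test.
  have h₂ := hprg.negligible_samples (cX := fun κ => κ) (cY := S.padLen) (m := entries S q)
    (c := fun κ => entries S q κ * κ + (tapeLen S A κ + S.seedLen κ))
    (fX := fun x => .ofBits (pr x)) (fY := fun x => .ofBits x.2)
    (fun κ => randomBits_map_congr fun k hk => by rw [hpr' κ k hk]) (fun κ => rfl) (by fun_prop)
    hpad hentries (by fun_prop) (by fun_prop) (by fun_prop)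
    (pt_prgTest (g := g) (A := A) hS hsd hq hpm)
  -- The slots of the second packet become a uniform permutation. A single sample suffices, so
  -- uniform permutations need not be sampled by the distinguisher.
  have h₃ := hperm.negligible_test (ΩX := fun κ => Fin (S.seedLen κ) → Bool)
    (ΩY := fun κ => Equiv.Perm (Fin (S.slots κ)))
    (tX := fun κ ω => .ofNats (S.slotList κ (List.ofFn ω))) (tY := fun κ σ => .ofNats (permList σ))
    (fun κ => by rw [randomBits, PMF.map_comp]; rfl) (fun κ => rfl)
    (c := fun κ => entries S q κ * κ + (tapeLen S A κ + entries S q κ * S.padLen κ))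
    (by fun_prop) (pt_permTest (g := g) (A := A) hS hsd hq hpm)
  have h₄ : Negligible fun κ =>
      (𝔼 σ : Equiv.Perm (Fin (S.slots κ)), slotValue S g A q pm κ (permList σ)) - 1 / 2 := by
    refine Negligible.of_abs_le (negligible_two_pow.mul_pb (g := fun κ => (A.queries₁.eval κ +
      A.queries₂.eval κ + S.slots κ + S.slots κ) * S.nodes κ * S.window κ)
      (PT.pb_nat (by fun_prop))) fun κ => ?_
    refine (abs_expect_slotValue_le hwf hW hpm' κ).trans ?_
    rw [mul_comm]
    exact le_abs_self _
  -- The ideal side of each hop equals the real side of the next, and the sum telescopes.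
  refine (((h₁.add h₂).add h₃).add h₄).of_eq fun κ => ?_
  rw [toReal_play_eq hwf hW hkd' hpr' hpm' κ]
  simp only [avgBits_prgTest hpm', avgBits_permTest, Tree.toNats_ofNats, List.map_map]
  have e₁ := expect_kdfTest_pairSample (S := S) (g := g) (A := A) (q := q) (pr := pr) hpm' κ
  have e₂ := expect_tableValue (S := S) (g := g) (A := A) (q := q) (pm := pm) κ
  have e₃ : ∀ f : ℕ → List Bool, (List.range (entries S q κ)).map
      (Tree.toBits ∘ fun j => Tree.ofBits (f j)) = (List.range (entries S q κ)).map f := fun f =>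
    List.map_congr_left fun j _ => Tree.toBits_ofBits _
  have e₄ : (𝔼 ω : Fin (S.seedLen κ) → Bool, slotValue S g A q pm κ (S.slotList κ (List.ofFn ω))) =
    avgBits (S.seedLen κ) fun sd => slotValue S g A q pm κ (S.slotList κ sd) := rfl
  simp only [e₃]
  rw [e₄, e₁, e₂]
  ring

end Ariadne

theorem theorem1 (S : Ariadne.Scheme) (hwf : S.WellFormed) (heff : S.Efficient)
    (hprg : S.PRGSecure) (hkdf : S.KDFSecure) (hperm : S.PermSecure) :
    Ariadne.SessionUnlinkable S :=
  ⟨Ariadne.unlinkable hwf heff hprg hkdf hperm .path,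
    Ariadne.unlinkable hwf heff hprg hkdf hperm .source⟩
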